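/- Let $m=GM/c^2$ and consider the static, spherically symmetric metrics, in isotropic coordinates $(x^0,\boldsymbol x)$, $x^0=ct$, $r=|\boldsymbol x|$, $$ds^2=\mathcal A(r)(dx^0)^2-\frac{1}{\mathcal B(r)}\,\delta_{ij}dx^idx^j,$$ where, for $r>r_h=\eta m$ (with a constant $\eta>0$), $\mathcal A$ and $1/\mathcal B$ are positive and given by convergent power series in $m/r$ whose coefficients do not depend on $m$, $$\mathcal A(r)=1-\frac{2m}{r}+2\beta\frac{m^2}{r^2}+\cdots,\qquad \frac1{\mathcal B(r)}=1+2\gamma\frac mr+\frac32\epsilon\frac{m^2}{r^2}+\cdots .$$ Put $\kappa=\frac14[8(1+\gamma)-4\beta+3\epsilon]$. For points $\boldsymbol x_A,\boldsymbol x_B$ not collinear with the origin put $r_A=|\boldsymbol x_A|$, $r_B=|\boldsymbol x_B|$, $\boldsymbol n_A=\boldsymbol x_A/r_A$, $\boldsymbol n_B=\boldsymbol x_B/r_B$ and $$\boldsymbol N=\frac{\boldsymbol x_B-\boldsymbol x_A}{|\boldsymbol x_B-\boldsymbol x_A|},\quad \boldsymbol P=\boldsymbol N\times\frac{\boldsymbol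 n_A\times\boldsymbol n_B}{|\boldsymbol n_A\times\boldsymbol n_B|},\quad r_c=\frac{r_Ar_B|\boldsymbol n_A\times\boldsymbol n_B|}{|\boldsymbol x_B-\boldsymbol x_A|}.$$ A quasi-Minkowskian light ray joining $\boldsymbol x_A$ to $\boldsymbol x_B$ is a null geodesic lying in $r>r_h$ that has, in terms of an affine parameter $\lambda\in[0,1]$, parametric equations of the form $$x^0=x^0_B-\lambda|\boldsymbol x_B-\boldsymbol x_A|+\sum_{n\ge1}G^nX^0_{(n)}(\lambda),\qquad \boldsymbol x=\boldsymbol x_B-\lambda(\boldsymbol x_B-\boldsymbol x_A)+\sum_{n\ge1}G^n\boldsymbol X_{(n)}(\lambda),$$ with coefficients independent of $G$ and $X^0_{(n)}(0)=0$, $\boldsymbol X_{(n)}(0)=\boldsymbol X_{(n)}(1)=0$; here $G$ is an expansion parameter, so that these equations describe such a geodesic for every $G$ in an interval $(0,G_{\max})$. Its direction triple at a point is $(l_1/l_0,l_2/l_0,l_3/l_0)$, where $l_\alpha=g_{\alpha\beta}\,dx^\beta/d\lambda$; it is denoted by $\widehat{\boldsymbol l}_e$ at $\boldsymbol x_A$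 and by $\widehat{\boldsymbol l}_r$ at $\boldsymbol x_B$. Suppose that $|\boldsymbol x_B-\lambda(\boldsymbol x_B-\boldsymbol x_A)|>r_h$ for $0\le\lambda\le1$. Then the direction triples of a quasi-Minkowskian light ray joining $\boldsymbol x_A$ to $\boldsymbol x_B$ satisfy $$\begin{aligned}\widehat{\boldsymbol l}_e={}&-\boldsymbol N-\frac{m|\boldsymbol N\times\boldsymbol n_A|}{r_c}\Big\{1+\gamma+\frac{m|\boldsymbol N\times\boldsymbol n_A|}{r_c}\Big[\kappa-\frac{(1+\gamma)^2}{1+\boldsymbol n_A\cdot\boldsymbol n_B}\Big]\Big\}\boldsymbol N\\&-\frac{m|\boldsymbol N\times\boldsymbol n_A|}{r_c}\Big\{(1+\gamma)\frac{|\boldsymbol n_A\times\boldsymbol n_B|}{1+\boldsymbol n_A\cdot\boldsymbol n_B}+\frac m{r_c}\Big\{\kappa\Big[\frac{\arccos(\boldsymbol n_A\cdot\boldsymbol n_B)}{|\boldsymbol n_A\times\boldsymbol n_B|}\boldsymbol N\cdot\boldsymbol n_B-\boldsymbol N\cdot\boldsymbol n_A\Big]-(1+\gamma)^2\frac{\boldsymbol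 N\cdot\boldsymbol n_B-\boldsymbol N\cdot\boldsymbol n_A}{1+\boldsymbol n_A\cdot\boldsymbol n_B}\Big\}\Big\}\boldsymbol P+O\Big(\frac{m^3}{r_c^3}\Big),\end{aligned}$$ $$\begin{aligned}\widehat{\boldsymbol l}_r={}&-\boldsymbol N-\frac{m|\boldsymbol N\times\boldsymbol n_B|}{r_c}\Big\{1+\gamma+\frac{m|\boldsymbol N\times\boldsymbol n_B|}{r_c}\Big[\kappa-\frac{(1+\gamma)^2}{1+\boldsymbol n_A\cdot\boldsymbol n_B}\Big]\Big\}\boldsymbol N\\&+\frac{m|\boldsymbol N\times\boldsymbol n_B|}{r_c}\Big\{(1+\gamma)\frac{|\boldsymbol n_A\times\boldsymbol n_B|}{1+\boldsymbol n_A\cdot\boldsymbol n_B}-\frac m{r_c}\Big\{\kappa\Big[\frac{\arccos(\boldsymbol n_A\cdot\boldsymbol n_B)}{|\boldsymbol n_A\times\boldsymbol n_B|}\boldsymbol N\cdot\boldsymbol n_A-\boldsymbol N\cdot\boldsymbol n_B\Big]+(1+\gamma)^2\frac{\boldsymbol N\cdot\boldsymbol n_B-\boldsymbol N\cdot\boldsymbol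 n_A}{1+\boldsymbol n_A\cdot\boldsymbol n_B}\Big\}\Big\}\boldsymbol P+O\Big(\frac{m^3}{r_c^3}\Big).\end{aligned}$$ Here $O(m^3/r_c^3)$ is understood as $m/r_c\to0$ with the shape of the configuration fixed: the bound $C(m/r_c)^3$ holds for $m/r_c<\delta$, where $C$ and $\delta>0$ depend only on the coefficients of the potentials, on $\eta$ and on the pair $(\boldsymbol x_A,\boldsymbol x_B)$ up to a common positive scale factor. -/

import Mathlib

namespace LightRay

noncomputable section

/-- Ordinary Euclidean 3-space. -/
abbrev E3 : Type := EuclideanSpace ℝ (Fin 3)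

/-- Points (and 4-vectors) in the global quasi-Cartesian coordinates: the pair `(x⁰, 𝐱)`,
with `x⁰ = c t`. -/
abbrev Event : Type := ℝ × E3

/-- The vector product of Euclidean 3-space. -/
def cross (v w : E3) : E3 := WithLp.toLp 2 (crossProduct v.ofLp w.ofLp)

/-! ### The family of metrics -/

/-- A static, spherically symmetric model: post-Newtonian parameters `β`, `γ`, `ε`, the
dimensionless coefficients `a n`, `d n` of the expansions in powers of `m / r` of the potentials
`𝒜(r)` and `1 / ℬ(r)`, and a number `η > 0` giving the radius `r_h = η m` outside which both
expansions converge and both potentials are positive (the metric is regular). -/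
structure Model where
  β : ℝ
  γ : ℝ
  ε : ℝ
  a : ℕ → ℝ
  d : ℕ → ℝ
  η : ℝ
  a_zero : a 0 = 1
  a_one : a 1 = -2
  a_two : a 2 = 2 * β
  d_zero : d 0 = 1
  d_one : d 1 = 2 * γ
  d_two : d 2 = 3 / 2 * ε
  η_pos : 0 < η
  summable_a : ∀ m r : ℝ, 0 < m → η * m < r → Summable fun n => a n * (m / r) ^ n
  summable_d : ∀ m r : ℝ, 0 < m → η * m < r → Summable fun n => d n * (m / r) ^ n
  a_pos : ∀ m r : ℝ, 0 < m → η * m < r → 0 < ∑' n, a n * (m / r) ^ n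
  d_pos : ∀ m r : ℝ, 0 < m → η * m < r → 0 < ∑' n, d n * (m / r) ^ n

/-- The length `m = G M / c²`. -/
def massLength (G M c : ℝ) : ℝ := G * M / c ^ 2

namespace Model

/-- The potential `𝒜(r) = 1 - 2 m / r + 2 β m² / r² + ⋯`. -/
def potA (P : Model) (m r : ℝ) : ℝ := ∑' n, P.a n * (m / r) ^ n

/-- The potential `ℬ(r)`, where `1 / ℬ(r) = 1 + 2 γ m / r + (3 / 2) ε m² / r² + ⋯`. -/
def potB (P : Model) (m r : ℝ) : ℝ := (∑' n, P.d n * (m / r) ^ n)⁻¹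

/-- The radius `r_h`. -/
def horizonRadius (P : Model) (m : ℝ) : ℝ := P.η * m

/-- The metric `ds² = 𝒜(r) (dx⁰)² - ℬ(r)⁻¹ δ_ij dx^i dx^j` at the point `p`, as a bilinear form. -/
def metric (P : Model) (m : ℝ) (p V W : Event) : ℝ :=
  P.potA m ‖p.2‖ * (V.1 * W.1) - (P.potB m ‖p.2‖)⁻¹ * inner ℝ V.2 W.2

/-- `κ = (8 (1 + γ) - 4 β + 3 ε) / 4`. -/
def κ (P : Model) : ℝ := (8 * (1 + P.γ) - 4 * P.β + 3 * P.ε) / 4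

end Model

/-! ### Null geodesics and direction triples -/

/-- The tangent vector `dx / dζ`, one-sided at the end points of the parameter interval `[0, 1]`. -/
def velocity (x : ℝ → Event) (ζ : ℝ) : Event := derivWithin x (Set.Icc 0 1) ζ

/-- `x : [0, 1] → ℝ⁴` is an affinely parametrized null geodesic of the metric `g`:
it solves `d/dζ (g_{αβ} x'^β) = (1 / 2) ∂_α g_{βγ} x'^β x'^γ` and its tangent vector is
null and nonzero. -/
structure IsNullGeodesic (g : Event → Event → Event → ℝ) (x : ℝ → Event) : Prop where
  differentiable : DifferentiableOn ℝ x (Set.Icc 0 1)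
  geodesic : ∀ ζ ∈ Set.Icc (0 : ℝ) 1, ∀ W : Event,
    HasDerivWithinAt (fun s => g (x s) (velocity x s) W)
      (1 / 2 * fderiv ℝ (fun p => g p (velocity x ζ) (velocity x ζ)) (x ζ) W) (Set.Icc 0 1) ζ
  null : ∀ ζ ∈ Set.Icc (0 : ℝ) 1, g (x ζ) (velocity x ζ) (velocity x ζ) = 0
  velocity_ne_zero : ∀ ζ ∈ Set.Icc (0 : ℝ) 1, velocity x ζ ≠ 0

/-- The direction triple `(l_i / l_0)` at the parameter value `ζ`, where
`l_α = g_{αβ} dx^β / dζ`. -/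
def directionTriple (g : Event → Event → Event → ℝ) (x : ℝ → Event) (ζ : ℝ) : E3 :=
  WithLp.toLp 2 fun i : Fin 3 =>
    g (x ζ) (velocity x ζ) (0, EuclideanSpace.single i 1) / g (x ζ) (velocity x ζ) (1, 0)

/-- `Γ G`, for `0 < G < Gmax`, is a quasi-Minkowskian light ray joining `xA` (parameter `1`) to
`xB` (parameter `0`, received at `x⁰ = x0B`): a null geodesic of the metric with `m = G M / c²`
that lies in `r > r_h` and whose parametric equations are power series in `G`, with coefficients
independent of `G`, around the Minkowskian null straight line. -/
def IsQuasiMinkowskian (P : Model) (M c Gmax : ℝ) (xA xB : E3) (x0B : ℝ)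
    (Γ : ℝ → ℝ → Event) : Prop :=
  ∃ (X0 : ℕ → ℝ → ℝ) (X : ℕ → ℝ → E3),
    (∀ n, 1 ≤ n → X0 n 0 = 0) ∧ (∀ n, 1 ≤ n → X n 0 = 0 ∧ X n 1 = 0) ∧
    ∀ G ∈ Set.Ioo 0 Gmax,
      IsNullGeodesic (P.metric (massLength G M c)) (Γ G) ∧
      ∀ ζ ∈ Set.Icc (0 : ℝ) 1,
        P.horizonRadius (massLength G M c) < ‖(Γ G ζ).2‖ ∧
        HasSum (fun n : ℕ => G ^ (n + 1) * X0 (n + 1) ζ)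
          ((Γ G ζ).1 - (x0B - ζ * ‖xB - xA‖)) ∧
        HasSum (fun n : ℕ => G ^ (n + 1) • X (n + 1) ζ)
          ((Γ G ζ).2 - (xB - ζ • (xB - xA)))

/-! ### The Euclidean geometry of the end points -/

/-- The unit vector `𝐧 = 𝐱 / |𝐱|`. -/
def unitVec (x : E3) : E3 := ‖x‖⁻¹ • x

/-- `𝐍_AB`. -/
def vecN (xA xB : E3) : E3 := unitVec (xB - xA)

/-- `𝐐_AB`. -/
def vecQ (xA xB : E3) : E3 := unitVec (cross (unitVec xA) (unitVec xB))

/-- `𝐏_AB = 𝐍_AB × 𝐐_AB`. -/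
def vecP (xA xB : E3) : E3 := cross (vecN xA xB) (vecQ xA xB)

/-- The zeroth-order distance of closest approach
`r_c = r_A r_B |𝐧_A × 𝐧_B| / |𝐱_B - 𝐱_A|`. -/
def rc (xA xB : E3) : ℝ :=
  ‖xA‖ * ‖xB‖ * ‖cross (unitVec xA) (unitVec xB)‖ / ‖xB - xA‖

/-! ### The second-order expansions -/

/-- The expansion of the direction triple at emission, up to and including `(m / r_c)²`. -/
def emissionExpansion (P : Model) (m : ℝ) (xA xB : E3) : E3 :=
  let nA := unitVec xA
  let nB := unitVec xB
  let N := vecN xA xB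
  let μ : ℝ := inner ℝ nA nB
  let q : ℝ := m / rc xA xB
  let S : ℝ := ‖cross nA nB‖
  let sA : ℝ := ‖cross N nA‖
  let cA : ℝ := inner ℝ N nA
  let cB : ℝ := inner ℝ N nB;
  -N
    - (q * sA * (1 + P.γ + q * sA * (P.κ - (1 + P.γ) ^ 2 / (1 + μ)))) • N
    - (q * sA * ((1 + P.γ) * (S / (1 + μ))
        + q * (P.κ * (Real.arccos μ / S * cB - cA)
          - (1 + P.γ) ^ 2 * ((cB - cA) / (1 + μ))))) • vecP xA xB

/-- The expansion of the direction triple at reception, up to and including `(m / r_c)²`. -/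
def receptionExpansion (P : Model) (m : ℝ) (xA xB : E3) : E3 :=
  let nA := unitVec xA
  let nB := unitVec xB
  let N := vecN xA xB
  let μ : ℝ := inner ℝ nA nB
  let q : ℝ := m / rc xA xB
  let S : ℝ := ‖cross nA nB‖
  let sB : ℝ := ‖cross N nB‖
  let cA : ℝ := inner ℝ N nA
  let cB : ℝ := inner ℝ N nB;
  -N
    - (q * sB * (1 + P.γ + q * sB * (P.κ - (1 + P.γ) ^ 2 / (1 + μ)))) • N
    + (q * sB * ((1 + P.γ) * (S / (1 + μ))
        - q * (P.κ * (Real.arccos μ / S * cA - cB)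
          + (1 + P.γ) ^ 2 * ((cB - cA) / (1 + μ))))) • vecP xA xB

end

end LightRay

/-! A null geodesic of a static isotropic metric is a light ray of an optical medium. The covariant
time component is conserved; after division by it the covariant spatial components become a vector
`y` with `|y|² = n²`, where `n² = 1/(𝒜ℬ)` depends only on `u = m/r`. In the optical time `τ` one has
`dx/dτ = y` and `dy/dτ = ½∇n² = -f(u) m x/r³`, with `f = (n²)'/2 = α + 2κu + O(u²)` and `α = 1 + γ`.
Everything depends on `m/r` only, so a similarity reduces to one fixed pair of end points of the
given shape.

Uniformity is the first difficulty. The power series in `G` come with no uniform bounds, and the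
field also has strongly deflected rays between the same points. The virial identity `d(x·y)/dτ = n²
- f u ≥ 1/2` in the weak field shows that `r` has no interior maximum there, so a ray cannot leave
the strong field and fall back (`IsRay.norm_le_of_endpoints`). It also bounds the total turning of
`y` by a small constant, independently of the length of the ray (`IsRay.norm_y_sub_le`). Hence a ray
is either nearly the straight segment or nearly radial on at least one side of the centre. The
mid-parameter point therefore never lies at a distance between `η/2` and `η` from the mid-point of
the segment (`IsRay.exists_near_segment`). A quasi-Minkowskian ray depends continuously on `G` and
tends to the segment as `G → 0`, so it cannot cross this gap and stays on the near side
(`IsQuasiMinkowskian.norm_midpoint_sub_le`).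

For rays near the segment, all estimates are `O`-statements along the filter `m → 0` on the type
`CloseRay` of such rays, which builds in the uniformity. The angular momentum `j` is conserved and
the motion is plane. The `α`-part of the force is of Kepler type and integrates exactly: the
component of `y` transverse to the segment, minus `(αm/j) cos θ`, is a component of the Hamilton
vector. What remains is the `κ`-force, already of order `m²`, so first-order closeness to the
segment determines it with an error `O(m³)` (`CloseRay.hamilton_sub_isBigO`).

With the conservation of `j` and `|y|² = n²` at both ends, this gives as many equations as there are
unknown components of `y` at the end points. They are solved to first and then to second order
(`endpoint_expansion`), and half-angle identities turn the solution into the stated formulas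
(`endpoint_identities`). -/

namespace LightRay

noncomputable section

open Filter Topology

/-! ### Power series potentials -/

/-- The sum of the power series with coefficients `c`. -/
def powSum (c : ℕ → ℝ) (u : ℝ) : ℝ := ∑' n, c n * u ^ n

/-- Convergence at one positive point bounds the radius of convergence from below; this makes the
potentials analytic at `u = 0`, a value that no actual radius attains. -/
theorem powSum_hasFPowerSeriesOnBall {c : ℕ → ℝ} {u₁ : ℝ} (hu : 0 < u₁)
    (hc : Summable fun n => c n * u₁ ^ n) :
    HasFPowerSeriesOnBall (powSum c) (FormalMultilinearSeries.ofScalars ℝ c) 0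
      (ENNReal.ofReal u₁) := by
  have hrad : ENNReal.ofReal u₁ ≤ (FormalMultilinearSeries.ofScalars ℝ c).radius := by
    apply FormalMultilinearSeries.le_radius_of_summable
    rw [Real.coe_toNNReal _ hu.le]
    refine hc.norm.congr fun n => ?_
    rw [FormalMultilinearSeries.ofScalars_norm, norm_mul, norm_pow, Real.norm_of_nonneg hu.le]
  have hpos : 0 < (FormalMultilinearSeries.ofScalars ℝ c).radius :=
    lt_of_lt_of_le (ENNReal.ofReal_pos.mpr hu) hrad
  have h := (FormalMultilinearSeries.hasFPowerSeriesOnBall _ hpos).mono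
    (ENNReal.ofReal_pos.mpr hu) hrad
  have e : (FormalMultilinearSeries.ofScalars ℝ c).sum = powSum c := by
    funext x
    change FormalMultilinearSeries.ofScalarsSum (E := ℝ) c x = _
    rw [FormalMultilinearSeries.ofScalarsSum_eq_tsum]
    simp [powSum, smul_eq_mul]
  rwa [e] at h

theorem powSum_analyticAt {c : ℕ → ℝ} {u₁ u : ℝ} (hu : |u| < u₁)
    (hc : Summable fun n => c n * u₁ ^ n) : AnalyticAt ℝ (powSum c) u := by
  have h1 : 0 < u₁ := lt_of_le_of_lt (abs_nonneg u) hu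
  refine (powSum_hasFPowerSeriesOnBall h1 hc).analyticAt_of_mem ?_
  rw [Metric.mem_eball, edist_dist, Real.dist_eq, sub_zero]
  exact (ENNReal.ofReal_lt_ofReal_iff h1).mpr hu

theorem summable_powSum_of_abs_lt {c : ℕ → ℝ} {u₁ u : ℝ} (hu : |u| < u₁)
    (hc : Summable fun n => c n * u₁ ^ n) : Summable fun n => c n * u ^ n := by
  have h1 : 0 < u₁ := lt_of_le_of_lt (abs_nonneg u) hu
  have h := (powSum_hasFPowerSeriesOnBall h1 hc).hasSum (y := u) (by
    rw [Metric.mem_eball, edist_dist, Real.dist_eq, sub_zero]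
    exact (ENNReal.ofReal_lt_ofReal_iff h1).mpr hu)
  refine h.summable.congr fun n => ?_
  simp [smul_eq_mul, mul_comm]

theorem powSum_eq_quadratic_add_tail {c : ℕ → ℝ} {u₁ u : ℝ} (hu : |u| < u₁)
    (hc : Summable fun n => c n * u₁ ^ n) :
    powSum c u = c 0 + c 1 * u + c 2 * u ^ 2 + u ^ 3 * powSum (fun n => c (n + 3)) u := by
  have h := (summable_powSum_of_abs_lt hu hc).sum_add_tsum_nat_add 3
  rw [powSum, ← h, powSum, ← tsum_mul_left]
  simp only [Finset.sum_range_succ, Finset.sum_range_zero]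
  congr 1
  · ring
  · exact tsum_congr fun n => by ring

theorem summable_tail {c : ℕ → ℝ} {u₁ : ℝ} (hu : 0 < u₁)
    (hc : Summable fun n => c n * u₁ ^ n) : Summable fun n => c (n + 3) * u₁ ^ n := by
  have h := (summable_nat_add_iff 3).mpr hc
  refine (h.mul_right ((u₁ ^ 3)⁻¹)).congr fun n => ?_
  field_simp
  ring

/-- The optical data of a static spherically symmetric metric as functions of `u = m / r`: the
spatial potential, the squared refractive index, half the derivative of the latter, and the
constants of their expansions for `u ≤ u0`. -/
structure Medium where
  D : ℝ → ℝ
  n2 : ℝ → ℝ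
  f : ℝ → ℝ
  α : ℝ
  κ : ℝ
  C : ℝ
  u0 : ℝ
  one_le_C : 1 ≤ C
  u0_pos : 0 < u0
  C_mul_u0 : C * u0 ≤ 1 / 96
  D_bound : ∀ u, 0 < u → u ≤ u0 → |D u - 1| ≤ C * u
  n2_bound : ∀ u, 0 < u → u ≤ u0 → |n2 u - (1 + 2 * α * u + 2 * κ * u ^ 2)| ≤ C * u ^ 3
  n2_bound_one : ∀ u, 0 < u → u ≤ u0 → |n2 u - 1| ≤ C * u
  f_bound : ∀ u, 0 < u → u ≤ u0 → |f u - (α + 2 * κ * u)| ≤ C * u ^ 2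
  f_bound_zero : ∀ u, 0 < u → u ≤ u0 → |f u| ≤ C

namespace Model

theorem summable_a_div_two (P : Model) : Summable fun n => P.a n * (1 / (2 * P.η)) ^ n := by
  have := P.η_pos
  exact P.summable_a 1 (2 * P.η) one_pos (by linarith)

theorem summable_d_div_two (P : Model) : Summable fun n => P.d n * (1 / (2 * P.η)) ^ n := by
  have := P.η_pos
  exact P.summable_d 1 (2 * P.η) one_pos (by linarith)

/-- The squared refractive index differs from its second Taylor polynomial by `u³` times an
analytic function. -/
theorem exists_refractive_tail (P : Model) : ∃ g : ℝ → ℝ, AnalyticAt ℝ g 0 ∧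
    ∀ᶠ u in 𝓝 (0 : ℝ), powSum P.d u / powSum P.a u
      = 1 + 2 * (1 + P.γ) * u + 2 * P.κ * u ^ 2 + u ^ 3 * g u := by
  have hη := P.η_pos
  have h1 : 0 < 1 / (2 * P.η) := by positivity
  have h0 : |(0 : ℝ)| < 1 / (2 * P.η) := by simpa using h1
  have hA := powSum_analyticAt h0 P.summable_a_div_two
  have hA' := powSum_analyticAt h0 (summable_tail h1 P.summable_a_div_two)
  have hD' := powSum_analyticAt h0 (summable_tail h1 P.summable_d_div_two)
  have hA0 : powSum P.a 0 = 1 := by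
    rw [powSum_eq_quadratic_add_tail h0 P.summable_a_div_two, P.a_zero]; simp
  have hid : AnalyticAt ℝ (fun u : ℝ => u) 0 := analyticAt_id
  -- The witness is `(D - (1 + 2(1+γ)u + 2κu²) A) / (u³ A)` with the powers of `u` cancelled by
  -- hand. The coefficients of orders 0, 1 and 2 vanish, the last one by the definition of `κ`; the
  -- two polynomial terms are those of orders 3 and 4 in the product of the quadratic parts.
  refine ⟨fun u => (powSum (fun n => P.d (n + 3)) u
      - (1 + 2 * (1 + P.γ) * u + 2 * P.κ * (u * u)) * powSum (fun n => P.a (n + 3)) u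
      - (4 * (1 + P.γ) * P.β - 4 * P.κ) - 4 * P.κ * P.β * u) / powSum P.a u, ?_, ?_⟩
  · refine AnalyticAt.div ?_ hA (by rw [hA0]; exact one_ne_zero)
    have c : ∀ k : ℝ, AnalyticAt ℝ (fun _ : ℝ => k) 0 := fun k => analyticAt_const
    exact (((hD'.sub ((((c _).add ((c _).mul hid)).add ((c _).mul (hid.mul hid))).mul hA')).sub
      (c _)).sub ((c _).mul hid))
  · have hne : ∀ᶠ u in 𝓝 (0 : ℝ), powSum P.a u ≠ 0 :=
      hA.continuousAt.eventually_ne (by rw [hA0]; exact one_ne_zero)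
    have hlt : ∀ᶠ u in 𝓝 (0 : ℝ), |u| < 1 / (2 * P.η) :=
      (continuous_abs.tendsto (0 : ℝ)).eventually_lt_const h0
    filter_upwards [hne, hlt] with u hu hl
    have ea := powSum_eq_quadratic_add_tail hl P.summable_a_div_two
    have ed := powSum_eq_quadratic_add_tail hl P.summable_d_div_two
    rw [P.a_zero, P.a_one, P.a_two] at ea
    rw [P.d_zero, P.d_one, P.d_two] at ed
    field_simp
    rw [ed, ea]
    unfold Model.κ
    ring

theorem exists_abs_le_of_continuousAt {g : ℝ → ℝ} (hg : ContinuousAt g 0) :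
    ∀ᶠ u in 𝓝 (0 : ℝ), |g u| ≤ |g 0| + 1 :=
  (hg.abs.eventually_lt_const (lt_add_one _)).mono fun _ h => h.le

/-- Every model gives an optical medium. -/
theorem exists_medium (P : Model) : ∃ O : Medium, O.α = 1 + P.γ ∧ O.κ = P.κ ∧
    O.D = powSum P.d ∧ O.n2 = (fun u => powSum P.d u / powSum P.a u) ∧
    O.f = (fun u => deriv (fun u => powSum P.d u / powSum P.a u) u / 2) ∧
    O.u0 < 1 / (2 * P.η) := by
  obtain ⟨g, hg, hgE⟩ := P.exists_refractive_tail
  have hη := P.η_pos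
  have h1 : 0 < 1 / (2 * P.η) := by positivity
  have h0 : |(0 : ℝ)| < 1 / (2 * P.η) := by simpa using h1
  have hD' := powSum_analyticAt h0 (summable_tail h1 P.summable_d_div_two)
  have hlt : ∀ᶠ u in 𝓝 (0 : ℝ), |u| < 1 / (2 * P.η) :=
    (continuous_abs.tendsto (0 : ℝ)).eventually_lt_const h0
  have hder : ∀ᶠ u in 𝓝 (0 : ℝ), deriv (fun u => powSum P.d u / powSum P.a u) u
      = 2 * (1 + P.γ) + 4 * P.κ * u + (3 * u ^ 2 * g u + u ^ 3 * deriv g u) := by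
    filter_upwards [hgE.eventually_nhds, hg.eventually_analyticAt] with u hu hga
    have e : (fun u => powSum P.d u / powSum P.a u) =ᶠ[𝓝 u] fun u =>
      1 + 2 * (1 + P.γ) * u + 2 * P.κ * u ^ 2 + u ^ 3 * g u := hu
    rw [e.deriv_eq]
    have hid := hasDerivAt_id' u
    have := (((hid.const_mul (2 * (1 + P.γ))).const_add 1).add
      ((hid.pow 2).const_mul (2 * P.κ))).add ((hid.pow 3).mul
        hga.differentiableAt.hasDerivAt)
    have h2 := this.deriv
    refine Eq.trans h2 ?_
    simp
    ring
  have b1 := exists_abs_le_of_continuousAt hg.continuousAt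
  have b2 := exists_abs_le_of_continuousAt hg.deriv.continuousAt
  have b3 := exists_abs_le_of_continuousAt hD'.continuousAt
  obtain ⟨w, hw, hW⟩ := Metric.eventually_nhds_iff.mp
    (hgE.and (hder.and (b1.and (b2.and (b3.and hlt)))))
  -- One constant large enough for all five bounds, once `u ≤ 1`.
  set C : ℝ := 2 * (|g 0| + 1) + (|deriv g 0| + 1) + (|powSum (fun n => P.d (n + 3)) 0| + 1)
    + 2 * |1 + P.γ| + 2 * |P.κ| + 2 * |P.γ| + 2 * |P.ε| with hC
  have hC1 : 1 ≤ C := by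
    have := abs_nonneg (g 0); have := abs_nonneg (deriv g 0)
    have := abs_nonneg (powSum (fun n => P.d (n + 3)) 0); have := abs_nonneg (1 + P.γ)
    have := abs_nonneg P.κ; have := abs_nonneg P.γ; have := abs_nonneg P.ε
    linarith
  have hCp : 0 < C := by linarith
  -- Half of `w` keeps `u0` itself strictly inside the neighbourhood; the other entry gives `C u0 ≤
  -- 1/96`, and also `u0 ≤ 1` because `C ≥ 1`.
  set u0 : ℝ := min (w / 2) (1 / (96 * C)) with hu0
  have hu0p : 0 < u0 := lt_min (by positivity) (by positivity)
  have hu1 : u0 ≤ 1 := (min_le_right _ _).trans (by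
    rw [div_le_one (by positivity)]; linarith)
  have key : ∀ u, 0 < u → u ≤ u0 → u ≤ 1 ∧ _ := fun u hu hu' =>
    ⟨hu'.trans hu1, hW (y := u) (by
      rw [Real.dist_eq, sub_zero, abs_of_pos hu]
      have := min_le_left (w / 2) (1 / (96 * C)); linarith)⟩
  refine ⟨⟨powSum P.d, fun u => powSum P.d u / powSum P.a u,
    fun u => deriv (fun u => powSum P.d u / powSum P.a u) u / 2, 1 + P.γ, P.κ, C, u0, hC1, hu0p,
    ?_, ?_, ?_, ?_, ?_, ?_⟩, rfl, rfl, rfl, rfl, rfl, ?_⟩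
  · have := min_le_right (w / 2) (1 / (96 * C))
    calc C * u0 ≤ C * (1 / (96 * C)) := by gcongr
      _ = 1 / 96 := by field_simp
  · intro u hu hu'
    obtain ⟨k1, -, -, -, -, kd, kl⟩ := key u hu hu'
    have ed := powSum_eq_quadratic_add_tail kl P.summable_d_div_two
    rw [P.d_zero, P.d_one, P.d_two] at ed
    have e : powSum P.d u - 1
        = u * (2 * P.γ + 3 / 2 * P.ε * u + u ^ 2 * powSum (fun n => P.d (n + 3)) u) := by
      rw [ed]; ring
    rw [e, abs_mul, abs_of_pos hu, mul_comm]
    refine mul_le_mul_of_nonneg_right ?_ hu.le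
    have hu2 : u ^ 2 ≤ 1 := pow_le_one₀ hu.le k1
    have i1 : |3 / 2 * P.ε * u| ≤ 3 / 2 * |P.ε| * 1 := by
      rw [abs_mul, abs_mul, abs_of_pos hu, abs_of_pos (by norm_num : (0 : ℝ) < 3 / 2)]
      gcongr
    have i2 : |u ^ 2 * powSum (fun n => P.d (n + 3)) u|
        ≤ 1 * (|powSum (fun n => P.d (n + 3)) 0| + 1) := by
      rw [abs_mul, abs_of_nonneg (sq_nonneg u)]
      gcongr
    have i3 : |2 * P.γ| = 2 * |P.γ| := by rw [abs_mul, abs_two]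
    have := abs_add_three (2 * P.γ) (3 / 2 * P.ε * u)
      (u ^ 2 * powSum (fun n => P.d (n + 3)) u)
    have := abs_nonneg (g 0); have := abs_nonneg (deriv g 0)
    have := abs_nonneg (1 + P.γ)
    have := abs_nonneg P.κ; have := abs_nonneg P.γ; have := abs_nonneg P.ε
    linarith
  · intro u hu hu'
    obtain ⟨k1, kg, -, kb, -⟩ := key u hu hu'
    have e : powSum P.d u / powSum P.a u - (1 + 2 * (1 + P.γ) * u + 2 * P.κ * u ^ 2)
        = u ^ 3 * g u := by rw [kg]; ring
    simp only [e]
    rw [abs_mul, abs_of_pos (by positivity : 0 < u ^ 3), mul_comm]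
    refine mul_le_mul_of_nonneg_right ?_ (by positivity)
    have := abs_nonneg (g 0); have := abs_nonneg (deriv g 0)
    have := abs_nonneg (powSum (fun n => P.d (n + 3)) 0); have := abs_nonneg (1 + P.γ)
    have := abs_nonneg P.κ; have := abs_nonneg P.γ; have := abs_nonneg P.ε
    linarith
  · intro u hu hu'
    obtain ⟨k1, kg, -, kb, -⟩ := key u hu hu'
    have e : powSum P.d u / powSum P.a u - 1
        = u * (2 * (1 + P.γ) + 2 * P.κ * u + u ^ 2 * g u) := by rw [kg]; ring
    simp only [e]
    rw [abs_mul, abs_of_pos hu, mul_comm]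
    refine mul_le_mul_of_nonneg_right ?_ (by positivity)
    have hu2 : u ^ 2 ≤ 1 := pow_le_one₀ hu.le k1
    have i1 : |2 * P.κ * u| ≤ 2 * |P.κ| * 1 := by
      rw [abs_mul, abs_mul, abs_of_pos hu, abs_two]
      gcongr
    have i2 : |u ^ 2 * g u| ≤ 1 * (|g 0| + 1) := by
      rw [abs_mul, abs_of_nonneg (sq_nonneg u)]
      gcongr
    have i3 : |2 * (1 + P.γ)| = 2 * |1 + P.γ| := by rw [abs_mul, abs_two]
    have := abs_add_three (2 * (1 + P.γ)) (2 * P.κ * u) (u ^ 2 * g u)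
    have := abs_nonneg (g 0); have := abs_nonneg (deriv g 0)
    have := abs_nonneg (powSum (fun n => P.d (n + 3)) 0); have := abs_nonneg (1 + P.γ)
    have := abs_nonneg P.κ; have := abs_nonneg P.γ; have := abs_nonneg P.ε
    linarith
  · intro u hu hu'
    obtain ⟨k1, -, kg, kb, kc, -⟩ := key u hu hu'
    have e : deriv (fun u => powSum P.d u / powSum P.a u) u / 2 - (1 + P.γ + 2 * P.κ * u)
        = u ^ 2 * (3 / 2 * g u + u * deriv g u / 2) := by rw [kg]; ring
    simp only [e]
    rw [abs_mul, abs_of_pos (by positivity : 0 < u ^ 2), mul_comm]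
    refine mul_le_mul_of_nonneg_right ?_ (by positivity)
    have i1 : |3 / 2 * g u| ≤ 3 / 2 * (|g 0| + 1) := by
      rw [abs_mul, abs_of_pos (by norm_num : (0 : ℝ) < 3 / 2)]
      gcongr
    have i2 : |u * deriv g u / 2| ≤ 1 * (|deriv g 0| + 1) / 2 := by
      rw [abs_div, abs_mul, abs_of_pos hu, abs_two]
      gcongr
    have := abs_add_le (3 / 2 * g u) (u * deriv g u / 2)
    have := abs_nonneg (g 0); have := abs_nonneg (deriv g 0)
    have := abs_nonneg (powSum (fun n => P.d (n + 3)) 0); have := abs_nonneg (1 + P.γ)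
    have := abs_nonneg P.κ; have := abs_nonneg P.γ; have := abs_nonneg P.ε
    linarith
  · intro u hu hu'
    obtain ⟨k1, -, kg, kb, kc, -⟩ := key u hu hu'
    have e : deriv (fun u => powSum P.d u / powSum P.a u) u / 2
        = (1 + P.γ) + 2 * P.κ * u + u ^ 2 * (3 / 2 * g u + u * deriv g u / 2) := by rw [kg]; ring
    simp only [e]
    have hu2 : u ^ 2 ≤ 1 := pow_le_one₀ hu.le k1
    have i0 : |2 * P.κ * u| ≤ 2 * |P.κ| * 1 := by
      rw [abs_mul, abs_mul, abs_of_pos hu, abs_two]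
      gcongr
    have i1 : |3 / 2 * g u| ≤ 3 / 2 * (|g 0| + 1) := by
      rw [abs_mul, abs_of_pos (by norm_num : (0 : ℝ) < 3 / 2)]
      gcongr
    have i2 : |u * deriv g u / 2| ≤ 1 * (|deriv g 0| + 1) / 2 := by
      rw [abs_div, abs_mul, abs_of_pos hu, abs_two]
      gcongr
    have i4 := abs_add_le (3 / 2 * g u) (u * deriv g u / 2)
    have i3 : |u ^ 2 * (3 / 2 * g u + u * deriv g u / 2)|
        ≤ 1 * (3 / 2 * (|g 0| + 1) + 1 * (|deriv g 0| + 1) / 2) := by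
      rw [abs_mul, abs_of_nonneg (sq_nonneg u)]
      gcongr
      linarith
    have := abs_add_three (1 + P.γ) (2 * P.κ * u)
      (u ^ 2 * (3 / 2 * g u + u * deriv g u / 2))
    have := abs_nonneg (g 0); have := abs_nonneg (deriv g 0)
    have := abs_nonneg (powSum (fun n => P.d (n + 3)) 0); have := abs_nonneg (1 + P.γ)
    have := abs_nonneg P.κ; have := abs_nonneg P.γ; have := abs_nonneg P.ε
    linarith
  · have hx : u0 < w := by
      have := min_le_left (w / 2) (1 / (96 * C)); linarith
    obtain ⟨-, -, -, -, -, -, kl⟩ := key u0 hu0p le_rfl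
    rwa [abs_of_pos hu0p] at kl

end Model

end

end LightRay

namespace LightRay

noncomputable section

open Filter Topology Set

/-! ### Light rays in an optical medium -/

section Rays

variable {V : Type*} [NormedAddCommGroup V] [InnerProductSpace ℝ V]

/-- A light ray `x` with direction triple `y` in the medium `O` around a mass of length `m`, with
affine parameter in `[0, 1]` and conserved energy `E`; the equations of motion are required where
the expansions of `O` are controlled. -/
structure IsRay (O : Medium) (m E : ℝ) (x y : ℝ → V) : Prop where
  m_pos : 0 < m
  E_pos : 0 < E
  continuousOn : ContinuousOn x (Icc 0 1)
  ne_zero : ∀ t ∈ Icc (0 : ℝ) 1, x t ≠ 0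
  deriv_x : ∀ t ∈ Icc (0 : ℝ) 1, m / ‖x t‖ ≤ O.u0 →
    HasDerivWithinAt x ((E / O.D (m / ‖x t‖)) • y t) (Icc 0 1) t
  deriv_y : ∀ t ∈ Icc (0 : ℝ) 1, m / ‖x t‖ ≤ O.u0 →
    HasDerivWithinAt y
      (-(E / O.D (m / ‖x t‖) * O.f (m / ‖x t‖) * (m / ‖x t‖ ^ 3)) • x t) (Icc 0 1) t
  norm_sq_y : ∀ t ∈ Icc (0 : ℝ) 1, m / ‖x t‖ ≤ O.u0 → ‖y t‖ ^ 2 = O.n2 (m / ‖x t‖)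

namespace Medium

theorem D_pos (O : Medium) {u : ℝ} (hu : 0 < u) (h : u ≤ O.u0) : 0 < O.D u := by
  have := abs_le.mp (O.D_bound u hu h)
  have := O.C_mul_u0
  have : O.C * u ≤ O.C * O.u0 := mul_le_mul_of_nonneg_left h (by linarith [O.one_le_C])
  linarith

theorem abs_inv_D_sub_one_le (O : Medium) {u : ℝ} (hu : 0 < u) (h : u ≤ O.u0) :
    |(O.D u)⁻¹ - 1| ≤ 2 * (O.C * u) := by
  have hD := O.D_pos hu h
  have h1 := abs_le.mp (O.D_bound u hu h)
  have := O.C_mul_u0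
  have : O.C * u ≤ O.C * O.u0 := mul_le_mul_of_nonneg_left h (by linarith [O.one_le_C])
  have e : (O.D u)⁻¹ - 1 = (1 - O.D u) / O.D u := by field_simp
  rw [e, abs_div, abs_of_pos hD, div_le_iff₀ hD, abs_le]
  constructor <;> nlinarith

end Medium

namespace IsRay

variable {O : Medium} {m E : ℝ} {x y : ℝ → V}

theorem norm_pos (h : IsRay O m E x y) {t : ℝ} (ht : t ∈ Icc (0 : ℝ) 1) : 0 < ‖x t‖ :=
  norm_pos_iff.mpr (h.ne_zero t ht)

theorem u_pos (h : IsRay O m E x y) {t : ℝ} (ht : t ∈ Icc (0 : ℝ) 1) : 0 < m / ‖x t‖ :=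
  div_pos h.m_pos (h.norm_pos ht)

/-- The radial virial function grows at a definite rate outside the strong field region. -/
theorem hasDerivWithinAt_inner (h : IsRay O m E x y) {t : ℝ} (ht : t ∈ Icc (0 : ℝ) 1)
    (hu : m / ‖x t‖ ≤ O.u0) :
    HasDerivWithinAt (fun s => inner ℝ (x s) (y s))
      (E / O.D (m / ‖x t‖) * (O.n2 (m / ‖x t‖) - O.f (m / ‖x t‖) * (m / ‖x t‖)))
      (Icc 0 1) t := by
  have h1 := (h.deriv_x t ht hu).inner ℝ (h.deriv_y t ht hu)
  refine h1.congr_deriv ?_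
  rw [real_inner_smul_left, real_inner_smul_right, real_inner_self_eq_norm_sq,
    real_inner_self_eq_norm_sq, h.norm_sq_y t ht hu]
  have := (h.norm_pos ht).ne'
  field_simp
  ring

/-- Both `n² - 1` and `f u` are at most `1/96` in absolute value. This positivity drives the global
control of rays: in the optical time, `½ r²` is uniformly convex. -/
theorem half_le_virial (O : Medium) {u : ℝ} (hu : 0 < u) (h : u ≤ O.u0) :
    1 / 2 ≤ O.n2 u - O.f u * u := by
  have h1 := abs_le.mp (O.n2_bound_one u hu h)
  have h2 := abs_le.mp (O.f_bound_zero u hu h)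
  have := O.C_mul_u0
  have : O.C * u ≤ O.C * O.u0 := mul_le_mul_of_nonneg_left h (by linarith [O.one_le_C])
  nlinarith

theorem n2_mem (O : Medium) {u : ℝ} (hu : 0 < u) (h : u ≤ O.u0) :
    95 / 96 ≤ O.n2 u ∧ O.n2 u ≤ 97 / 96 := by
  have h1 := abs_le.mp (O.n2_bound_one u hu h)
  have := O.C_mul_u0
  have : O.C * u ≤ O.C * O.u0 := mul_le_mul_of_nonneg_left h (by linarith [O.one_le_C])
  constructor <;> linarith

theorem norm_y_mem (h : IsRay O m E x y) {t : ℝ} (ht : t ∈ Icc (0 : ℝ) 1)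
    (hu : m / ‖x t‖ ≤ O.u0) : 3 / 4 ≤ ‖y t‖ ∧ ‖y t‖ ≤ 2 := by
  have h1 := n2_mem O (h.u_pos ht) hu
  rw [← h.norm_sq_y t ht hu] at h1
  have := norm_nonneg (y t)
  constructor <;> nlinarith

theorem norm_deriv_y (h : IsRay O m E x y) {t : ℝ} (ht : t ∈ Icc (0 : ℝ) 1)
    (hu : m / ‖x t‖ ≤ O.u0) :
    ‖-(E / O.D (m / ‖x t‖) * O.f (m / ‖x t‖) * (m / ‖x t‖ ^ 3)) • x t‖
      ≤ E / O.D (m / ‖x t‖) * (O.C * (m / ‖x t‖ ^ 2)) := by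
  have hr := h.norm_pos ht
  have hD := O.D_pos (h.u_pos ht) hu
  have hf := O.f_bound_zero _ (h.u_pos ht) hu
  have hE := h.E_pos
  have hm := h.m_pos
  rw [norm_smul, norm_neg, norm_mul, norm_mul, Real.norm_of_nonneg (by positivity : 0 ≤ E / O.D _),
    Real.norm_of_nonneg (by positivity : 0 ≤ m / ‖x t‖ ^ 3), Real.norm_eq_abs]
  calc E / O.D (m / ‖x t‖) * |O.f (m / ‖x t‖)| * (m / ‖x t‖ ^ 3) * ‖x t‖
      = E / O.D (m / ‖x t‖) * (|O.f (m / ‖x t‖)| * (m / ‖x t‖ ^ 2)) := by field_simp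
    _ ≤ _ := by gcongr

/-- The direction triple is nearly constant as long as the ray stays out of the strong field. -/
theorem norm_y_sub_le (h : IsRay O m E x y) {k p q : ℝ} (hk : 0 < k) (hku : k ≤ O.u0)
    (hp : 0 ≤ p) (hq : q ≤ 1) (hfar : ∀ t ∈ Icc p q, m / ‖x t‖ ≤ k) {t : ℝ}
    (ht : t ∈ Icc p q) : ‖y t - y p‖ ≤ 20 * (O.C * k) := by
  have hsub : ∀ t ∈ Icc p q, t ∈ Icc (0 : ℝ) 1 := fun t ht =>
    ⟨hp.trans ht.1, ht.2.trans hq⟩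
  have hfar' : ∀ t ∈ Icc p q, m / ‖x t‖ ≤ O.u0 := fun t ht => (hfar t ht).trans hku
  have hm := h.m_pos
  have hE := h.E_pos
  have hC : 0 < O.C := by linarith [O.one_le_C]
  -- The radius at which `m / r` equals `k`; the ray stays outside it on `[p, q]`.
  set b : ℝ := m / k with hb
  have hbp : 0 < b := by positivity
  set v : ℝ → ℝ := fun s => inner ℝ (x s) (y s) with hv
  -- Comparison function for the growth of `y`. Since `b ≤ r` and `v² ≤ 2r²`, one has `b² + v² ≤
  -- 3r²`, and `v` grows at rate at least `1/2` in optical time; the factor `6 = 2 · 3` makes the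
  -- derivative of `B` dominate the force bound `C m / r²`. As arctan is bounded, so is the total
  -- turning, whatever the duration.
  set B : ℝ → ℝ := fun s => 6 * (O.C * k) * (Real.arctan (v s / b) - Real.arctan (v p / b))
    with hB
  set w : ℝ → ℝ := fun s => E / O.D (m / ‖x s‖) * (O.n2 (m / ‖x s‖)
    - O.f (m / ‖x s‖) * (m / ‖x s‖)) with hw
  have hvd : ∀ s ∈ Icc p q, HasDerivWithinAt v (w s) (Icc 0 1) s := fun s hs =>
    h.hasDerivWithinAt_inner (hsub s hs) (hfar' s hs)
  have hBd : ∀ s ∈ Icc p q, HasDerivWithinAt B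
      (6 * (O.C * k) * (1 / (1 + (v s / b) ^ 2) * (w s / b))) (Icc 0 1) s := fun s hs =>
    ((((hvd s hs).div_const b).arctan).sub_const _).const_mul _
  have hnhds : ∀ s ∈ Ico p q, Icc (0 : ℝ) 1 ∈ 𝓝[Ici s] s := fun s hs =>
    Icc_mem_nhdsGE_of_mem ⟨hp.trans hs.1, hs.2.trans_le hq⟩
  have key := image_norm_le_of_norm_deriv_right_le_deriv_boundary'
    (f := fun s => y s - y p)
    (f' := fun s => -(E / O.D (m / ‖x s‖) * O.f (m / ‖x s‖) * (m / ‖x s‖ ^ 3)) • x s)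
    (B := B) (B' := fun s => 6 * (O.C * k) * (1 / (1 + (v s / b) ^ 2) * (w s / b)))
    (a := p) (b := q)
    (fun s hs => (((h.deriv_y s (hsub s hs) (hfar' s hs)).sub_const _).continuousWithinAt).mono
      (fun s hs => hsub s hs))
    (fun s hs => ((h.deriv_y s (hsub s (Ico_subset_Icc_self hs))
      (hfar' s (Ico_subset_Icc_self hs))).sub_const _).mono_of_mem_nhdsWithin (hnhds s hs))
    (by simp [hB])
    (fun s hs => ((hBd s hs).continuousWithinAt).mono (fun s hs => hsub s hs))
    (fun s hs => (hBd s (Ico_subset_Icc_self hs)).mono_of_mem_nhdsWithin (hnhds s hs))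
    (fun s hs' => by
      have hs := Ico_subset_Icc_self hs'
      refine (h.norm_deriv_y (hsub s hs) (hfar' s hs)).trans ?_
      have hr := h.norm_pos (hsub s hs)
      have hD := O.D_pos (h.u_pos (hsub s hs)) (hfar' s hs)
      have hvir := half_le_virial O (h.u_pos (hsub s hs)) (hfar' s hs)
      have hbr : b ≤ ‖x s‖ := by
        have := hfar s hs
        rw [div_le_iff₀ hr] at this
        rw [hb, div_le_iff₀ hk]; linarith
      have hv2 : (v s) ^ 2 ≤ 2 * ‖x s‖ ^ 2 := by
        have h1 := abs_real_inner_le_norm (x s) (y s)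
        have h2 := (n2_mem O (h.u_pos (hsub s hs)) (hfar' s hs)).2
        rw [← h.norm_sq_y s (hsub s hs) (hfar' s hs)] at h2
        have h3 : (v s) ^ 2 ≤ (‖x s‖ * ‖y s‖) ^ 2 := sq_le_sq' (by
          have := neg_abs_le (v s); simp only [hv] at *; linarith) ((le_abs_self _).trans h1)
        nlinarith [sq_nonneg ‖x s‖]
      have hden : b ^ 2 + v s ^ 2 ≤ 3 * ‖x s‖ ^ 2 := by nlinarith
      have e : 6 * (O.C * k) * (1 / (1 + (v s / b) ^ 2) * (w s / b))
          = E / O.D (m / ‖x s‖) * (O.C * (6 * m * (O.n2 (m / ‖x s‖)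
            - O.f (m / ‖x s‖) * (m / ‖x s‖)) / (b ^ 2 + v s ^ 2))) := by
        have : m = b * k := by rw [hb]; field_simp
        simp only [hw]
        rw [show 6 * m * (O.n2 (m / ‖x s‖) - O.f (m / ‖x s‖) * (m / ‖x s‖))
          = 6 * (b * k) * (O.n2 (m / ‖x s‖) - O.f (m / ‖x s‖) * (m / ‖x s‖)) by rw [← this]]
        have : b ^ 2 + v s ^ 2 ≠ 0 := by positivity
        field_simp
      rw [e]
      refine mul_le_mul_of_nonneg_left (mul_le_mul_of_nonneg_left ?_ hC.le) (by positivity)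
      rw [div_le_div_iff₀ (by positivity) (by positivity)]
      calc m * (b ^ 2 + v s ^ 2) ≤ m * (3 * ‖x s‖ ^ 2) := by gcongr
        _ = 6 * m * (1 / 2) * ‖x s‖ ^ 2 := by ring
        _ ≤ _ := by gcongr)
  refine (key ht).trans ?_
  simp only [hB]
  have h1 := Real.arctan_lt_pi_div_two (v t / b)
  have h2 := Real.neg_pi_div_two_lt_arctan (v p / b)
  have h3 := Real.pi_lt_d2
  -- The difference is less than `π`, and `10/3` yields the round constant `20`.
  have : Real.arctan (v t / b) - Real.arctan (v p / b) ≤ 10 / 3 := by linarith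
  calc _ ≤ 6 * (O.C * k) * (10 / 3) := by gcongr
    _ = _ := by ring

/-- As long as the ray stays out of the strong field it is nearly a uniformly parametrized
segment. -/
theorem norm_sub_segment_le (h : IsRay O m E x y) {k p q : ℝ} (hk : 0 < k) (hku : k ≤ O.u0)
    (hp : 0 ≤ p) (hq : q ≤ 1) (hpq : p < q) (hfar : ∀ t ∈ Icc p q, m / ‖x t‖ ≤ k) :
    E * (q - p) ≤ 2 * ‖x q - x p‖ ∧ ∀ t ∈ Icc p q,
      ‖x t - (x p + ((t - p) / (q - p)) • (x q - x p))‖ ≤ 96 * (O.C * k) * ‖x q - x p‖ := by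
  have hsub : ∀ t ∈ Icc p q, t ∈ Icc (0 : ℝ) 1 := fun t ht =>
    ⟨hp.trans ht.1, ht.2.trans hq⟩
  have hfar' : ∀ t ∈ Icc p q, m / ‖x t‖ ≤ O.u0 := fun t ht => (hfar t ht).trans hku
  have hE := h.E_pos
  have hC : 0 < O.C := by linarith [O.one_le_C]
  have hCk : O.C * k ≤ 1 / 96 := (mul_le_mul_of_nonneg_left hku hC.le).trans O.C_mul_u0
  have hCk0 : 0 < O.C * k := by positivity
  have hpm : p ∈ Icc p q := ⟨le_rfl, hpq.le⟩
  have hqm : q ∈ Icc p q := ⟨hpq.le, le_rfl⟩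
  -- Deviation from uniform motion with the initial velocity `E y p`: `4Ck` comes from replacing
  -- `1/D` by 1 and `20Ck` from the turning of `y`.
  have dev : ∀ t ∈ Icc p q, ‖x t - x p - (E * (t - p)) • y p‖
      ≤ 24 * (O.C * k) * E * (t - p) := by
    intro t ht
    have := norm_image_sub_le_of_norm_deriv_le_segment'
      (f := fun s => x s - x p - (E * (s - p)) • y p)
      (f' := fun s => (E / O.D (m / ‖x s‖)) • y s - (E * 1) • y p)
      (C := 24 * (O.C * k) * E) (a := p) (b := q)
      (fun s hs => (((h.deriv_x s (hsub s hs) (hfar' s hs)).mono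
        (fun s hs => hsub s hs)).sub_const _).sub
          ((((hasDerivWithinAt_id s _).sub_const p).const_mul E).smul_const _))
      (fun s hs' => by
        have hs := Ico_subset_Icc_self hs'
        have i1 := O.abs_inv_D_sub_one_le (h.u_pos (hsub s hs)) (hfar' s hs)
        have i2 := (h.norm_y_mem (hsub s hs) (hfar' s hs)).2
        have i3 := h.norm_y_sub_le hk hku hp hq hfar hs
        have i4 : O.C * (m / ‖x s‖) ≤ O.C * k := mul_le_mul_of_nonneg_left (hfar s hs) hC.le
        have e : (E / O.D (m / ‖x s‖)) • y s - (E * 1) • y p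
            = E • (((O.D (m / ‖x s‖))⁻¹ - 1) • y s + (y s - y p)) := by
          rw [div_eq_mul_inv]; module
        rw [e, norm_smul, Real.norm_of_nonneg hE.le]
        have i5 : ‖((O.D (m / ‖x s‖))⁻¹ - 1) • y s + (y s - y p)‖ ≤ 24 * (O.C * k) := by
          refine (norm_add_le _ _).trans ?_
          rw [norm_smul, Real.norm_eq_abs]
          have : |(O.D (m / ‖x s‖))⁻¹ - 1| * ‖y s‖ ≤ 2 * (O.C * k) * 2 := by
            gcongr
            linarith
          linarith
        calc _ ≤ E * (24 * (O.C * k)) := by gcongr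
          _ = _ := by ring) t ht
    simpa using this
  have hyp := (h.norm_y_mem (hsub p hpm) (hfar' p hpm)).1
  have hEq : 0 < E * (q - p) := mul_pos hE (sub_pos.mpr hpq)
  -- Here `C u0 ≤ 1/96` is used to the full: the deviation is at most a quarter of `E (q - p)`,
  -- while `‖y p‖ ≥ 3/4`, which leaves one half.
  have hEn : E * (q - p) ≤ 2 * ‖x q - x p‖ := by
    have h1 := dev q hqm
    have h2 : ‖(E * (q - p)) • y p‖ ≤ ‖x q - x p‖ + ‖x q - x p - (E * (q - p)) • y p‖ := by
      have := norm_sub_le (x q - x p) (x q - x p - (E * (q - p)) • y p)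
      simpa using this
    rw [norm_smul, Real.norm_of_nonneg hEq.le] at h2
    nlinarith
  refine ⟨hEn, fun t ht => ?_⟩
  set θ : ℝ := (t - p) / (q - p) with hθ
  have hqp : 0 < q - p := sub_pos.mpr hpq
  have hθ0 : 0 ≤ θ := div_nonneg (sub_nonneg.mpr ht.1) hqp.le
  have hθ1 : θ ≤ 1 := (div_le_one hqp).mpr (by linarith [ht.2])
  have htp : t - p = θ * (q - p) := by rw [hθ]; field_simp
  have e : x t - (x p + θ • (x q - x p)) = (x t - x p - (E * (t - p)) • y p)
      - θ • (x q - x p - (E * (q - p)) • y p) := by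
    rw [htp]; module
  rw [e]
  refine (norm_sub_le _ _).trans ?_
  rw [norm_smul, Real.norm_of_nonneg hθ0]
  have h1 := dev t ht
  have h2 := dev q hqm
  have h3 : θ * ‖x q - x p - (E * (q - p)) • y p‖ ≤ 1 * (24 * (O.C * k) * E * (q - p)) := by
    gcongr
  have h4 : 24 * (O.C * k) * E * (t - p) ≤ 24 * (O.C * k) * E * (q - p) := by
    gcongr
    linarith [ht.2]
  have h5 : O.C * k * (E * (q - p)) ≤ O.C * k * (2 * ‖x q - x p‖) := by gcongr
  nlinarith

end IsRay

end Rays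

end

end LightRay

namespace LightRay

noncomputable section

open Filter Topology Set

/-! ### The gap between nearly straight rays and rays approaching the centre -/

section Rays

variable {V : Type*} [NormedAddCommGroup V] [InnerProductSpace ℝ V]

namespace IsRay

variable {O : Medium} {m E : ℝ} {x y : ℝ → V}

/-- A ray that leaves the strong field region does not return to it. -/
theorem norm_le_of_endpoints (h : IsRay O m E x y) {b p q : ℝ} (hb : 0 < b)
    (hbu : m / b ≤ O.u0) (hp : 0 ≤ p) (hq : q ≤ 1) (hxp : ‖x p‖ ≤ b) (hxq : ‖x q‖ ≤ b)
    {t : ℝ} (ht : t ∈ Icc p q) : ‖x t‖ ≤ b := by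
  by_contra hlt
  push Not at hlt
  have hsub : Icc p q ⊆ Icc (0 : ℝ) 1 := Icc_subset_Icc hp hq
  have hm := h.m_pos
  have hfar : ∀ s, b < ‖x s‖ → m / ‖x s‖ ≤ O.u0 := fun s hs =>
    (div_le_div_of_nonneg_left hm.le hb hs.le).trans hbu
  -- At an interior maximum of the distance outside radius `b`, the virial function vanishes and has
  -- a positive derivative. It is then positive just after `c`, so the distance increases there, a
  -- contradiction.
  obtain ⟨c, hc, hmax⟩ := isCompact_Icc.exists_isMaxOn ⟨t, ht⟩
    ((h.continuousOn.mono hsub).norm)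
  have hcb : b < ‖x c‖ := hlt.trans_le (hmax ht)
  have hcp : p < c := lt_of_le_of_ne hc.1 fun e => by rw [← e] at hcb; linarith
  have hcq : c < q := lt_of_le_of_ne hc.2 fun e => by rw [e] at hcb; linarith
  have hint : ∀ s ∈ Ioo p q, Icc (0 : ℝ) 1 ∈ 𝓝 s := fun s hs =>
    Icc_mem_nhds (hp.trans_lt hs.1) (hs.2.trans_le hq)
  have hF : ∀ s ∈ Ioo p q, b < ‖x s‖ → HasDerivAt (fun s => ‖x s‖ ^ 2)
      (2 * (E / O.D (m / ‖x s‖) * inner ℝ (x s) (y s))) s := fun s hs hsb => by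
    have h1 := ((h.deriv_x s (hsub (Ioo_subset_Icc_self hs)) (hfar s hsb)).norm_sq).hasDerivAt
      (hint s hs)
    rwa [real_inner_smul_right] at h1
  have hEpos : ∀ s ∈ Ioo p q, b < ‖x s‖ → 0 < E / O.D (m / ‖x s‖) := fun s hs hsb =>
    div_pos h.E_pos (O.D_pos (h.u_pos (hsub (Ioo_subset_Icc_self hs))) (hfar s hsb))
  have hcI : c ∈ Ioo p q := ⟨hcp, hcq⟩
  have hv0 : inner ℝ (x c) (y c) = 0 := by
    have hloc : IsLocalMax (fun s => ‖x s‖ ^ 2) c := by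
      filter_upwards [Icc_mem_nhds hcp hcq] with s hs
      exact pow_le_pow_left₀ (norm_nonneg _) (hmax hs) 2
    have h1 := hloc.hasDerivAt_eq_zero (hF c hcI hcb)
    have := hEpos c hcI hcb
    simpa [this.ne'] using h1
  have hvd := (h.hasDerivWithinAt_inner (hsub hc) (hfar c hcb)).hasDerivAt (hint c hcI)
  have hpos : 0 < E / O.D (m / ‖x c‖) * (O.n2 (m / ‖x c‖)
      - O.f (m / ‖x c‖) * (m / ‖x c‖)) := by
    have := half_le_virial O (h.u_pos (hsub hc)) (hfar c hcb)
    exact mul_pos (hEpos c hcI hcb) (by linarith)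
  have hslope := (hasDerivAt_iff_tendsto_slope.mp hvd).eventually_const_lt hpos
  have hev : ∀ᶠ s in 𝓝[>] c, 0 < inner ℝ (x s) (y s) ∧ b < ‖x s‖ ∧ s < q := by
    have h1 : ∀ᶠ s in 𝓝[>] c, 0 < slope (fun s => inner ℝ (x s) (y s)) c s :=
      hslope.filter_mono (nhdsWithin_mono _ fun s hs => ne_of_gt hs)
    have h2 : ∀ᶠ s in 𝓝[>] c, b < ‖x s‖ :=
      (((h.continuousOn.continuousAt (hint c hcI)).norm).eventually_const_lt hcb).filter_mono
        nhdsWithin_le_nhds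
    have h3 : ∀ᶠ s in 𝓝[>] c, s < q := (eventually_lt_nhds hcq).filter_mono nhdsWithin_le_nhds
    filter_upwards [h1, h2, h3, self_mem_nhdsWithin] with s s1 s2 s3 s4
    refine ⟨?_, s2, s3⟩
    rw [slope_def_field, hv0, sub_zero] at s1
    have s5 : 0 < s - c := sub_pos.mpr s4
    exact (div_pos_iff_of_pos_right s5).mp s1
  obtain ⟨d, hd, hd'⟩ := mem_nhdsGT_iff_exists_Ioo_subset.mp hev
  have hcd : c < d := hd
  have hmid : (c + d) / 2 ∈ Ioo c d := ⟨by linarith, by linarith⟩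
  set s := (c + d) / 2 with hs
  have hIoo : ∀ σ ∈ Ioo c s, 0 < inner ℝ (x σ) (y σ) ∧ b < ‖x σ‖ ∧ σ < q := fun σ hσ =>
    hd' ⟨hσ.1, hσ.2.trans hmid.2⟩
  have hsq : s < q := (hd' hmid).2.2
  have hcont : ContinuousOn (fun s => ‖x s‖ ^ 2) (Icc c s) :=
    ((h.continuousOn.mono ((Icc_subset_Icc hc.1 hsq.le).trans hsub)).norm).pow 2
  obtain ⟨σ, hσ, e⟩ := exists_hasDerivAt_eq_slope (fun s => ‖x s‖ ^ 2)
    (fun s => 2 * (E / O.D (m / ‖x s‖) * inner ℝ (x s) (y s))) hmid.1 hcont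
    (fun σ hσ => hF σ ⟨hcp.trans hσ.1, (hIoo σ hσ).2.2⟩ (hIoo σ hσ).2.1)
  have h1 : 0 < 2 * (E / O.D (m / ‖x σ‖) * inner ℝ (x σ) (y σ)) := by
    have := hEpos σ ⟨hcp.trans hσ.1, (hIoo σ hσ).2.2⟩ (hIoo σ hσ).2.1
    have := (hIoo σ hσ).1
    positivity
  rw [e, div_pos_iff_of_pos_right (sub_pos.mpr hmid.1)] at h1
  have h2 : ‖x s‖ ≤ ‖x c‖ := hmax ⟨hc.1.trans hmid.1.le, hsq.le⟩
  have h3 := pow_le_pow_left₀ (norm_nonneg _) h2 2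
  linarith

theorem norm_sub_smul_le_of_near_zero {a b c : V} {θ k β : ℝ} (hθ0 : 0 ≤ θ) (hθ1 : θ ≤ 1)
    (hk : 0 ≤ k) (hb : ‖b‖ ≤ β) (h : ‖c - (b + θ • (a - b))‖ ≤ k * ‖a - b‖) :
    ‖c - θ • a‖ ≤ k * (‖a‖ + β) + β := by
  have e : c - θ • a = (c - (b + θ • (a - b))) + (1 - θ) • b := by module
  rw [e]
  refine (norm_add_le _ _).trans ?_
  rw [norm_smul, Real.norm_of_nonneg (by linarith)]
  have h1 : ‖a - b‖ ≤ ‖a‖ + β := (norm_sub_le _ _).trans (by linarith)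
  have h2 : (1 - θ) * ‖b‖ ≤ 1 * β := by
    have := norm_nonneg b
    gcongr
    linarith
  have h3 : k * ‖a - b‖ ≤ k * (‖a‖ + β) := by gcongr
  linarith

/-- A ray joining `xB` to `xA` in a weak field whose mid-point is close to the mid-point of the
segment stays even closer to the segment: there are no rays in between these and the ones that
approach the central mass. -/
theorem exists_near_segment (O : Medium) (xA xB : V) {η : ℝ} (hη : 0 < η)
    (hA : ∀ θ : ℝ, 2 * η ≤ ‖(1 / 2 : ℝ) • (xA + xB) - θ • xA‖)
    (hB : ∀ θ : ℝ, 2 * η ≤ ‖(1 / 2 : ℝ) • (xA + xB) - θ • xB‖) :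
    ∃ m₀ : ℝ, 0 < m₀ ∧ ∀ (m E : ℝ) (x y : ℝ → V), IsRay O m E x y → x 0 = xB → x 1 = xA →
      m < m₀ → ‖x (1 / 2) - (1 / 2 : ℝ) • (xA + xB)‖ ≤ η →
      E ≤ 2 * ‖xA - xB‖ ∧ ∀ t ∈ Icc (0 : ℝ) 1, m / ‖x t‖ ≤ O.u0 ∧
        ‖x t - (xB + t • (xA - xB))‖ ≤ η / 2 := by
  have hC : 0 < O.C := by linarith [O.one_le_C]
  set L : ℝ := ‖xA‖ + ‖xB‖ + 1 with hL
  have hL0 : 0 < L := by positivity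
  -- With this threshold the segment estimate gives an error at most `η/2`. The choice of `m₀` then
  -- makes the radius `b = m/k` less than `η/4` and less than 1, so that `η/2 + η/4 < η` in
  -- `hsmall`.
  set k : ℝ := min O.u0 (η / (192 * O.C * L)) with hk
  have hk0 : 0 < k := lt_min O.u0_pos (by positivity)
  have hku : k ≤ O.u0 := min_le_left _ _
  have hkL : 96 * (O.C * k) * L ≤ η / 2 := by
    have : k ≤ η / (192 * O.C * L) := min_le_right _ _
    calc 96 * (O.C * k) * L ≤ 96 * (O.C * (η / (192 * O.C * L))) * L := by gcongr
      _ = η / 2 := by field_simp; norm_num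
  refine ⟨k * min 1 (η / 4), by positivity, fun m E x y h h0 h1 hm hmid => ?_⟩
  set b : ℝ := m / k with hb
  have hb0 : 0 < b := div_pos h.m_pos hk0
  have hbm : b < min 1 (η / 4) := by rw [hb, div_lt_iff₀ hk0]; linarith
  have hb1 : b < 1 := hbm.trans_le (min_le_left _ _)
  have hbη : b < η / 4 := hbm.trans_le (min_le_right _ _)
  have hmb : m / b = k := by
    rw [hb]; have := h.m_pos.ne'; field_simp
  have hfar : ∀ s, b ≤ ‖x s‖ → m / ‖x s‖ ≤ k := fun s hs => by
    rw [← hmb]; exact div_le_div_of_nonneg_left h.m_pos.le hb0 hs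
  have hnn := norm_nonneg xA
  have hnn' := norm_nonneg xB
  have hhalf : b < ‖x (1 / 2)‖ := by
    by_contra hle
    push Not at hle
    have h2 := hA 0
    have h3 := norm_sub_norm_le ((1 / 2 : ℝ) • (xA + xB)) (x (1 / 2))
    rw [norm_sub_rev] at h3
    rw [zero_smul, sub_zero] at h2
    linarith
  have hk96 : 0 ≤ 96 * (O.C * k) := by positivity
  have hsmall : ∀ r : ℝ, r ≤ ‖xA‖ + ‖xB‖ → 96 * (O.C * k) * (r + b) + b < η := fun r hr => by
    have : 96 * (O.C * k) * (r + b) ≤ 96 * (O.C * k) * L := by gcongr; linarith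
    linarith
  -- The times spent in the ball of radius `b` form an interval that misses `1/2`, so at most one
  -- half of the ray is affected. If it is this one, the piece after the last contact is nearly a
  -- segment from the origin to `xA`, and the mid-parameter point lies within less than `η` of the
  -- line through the origin and `xA`, against `hA`.
  have hleft : ∀ t ∈ Icc (0 : ℝ) (1 / 2), b < ‖x t‖ := by
    by_contra hcon
    push Not at hcon
    obtain ⟨t₁, ht₁, hxt⟩ := hcon
    have hright : ∀ t ∈ Icc (1 / 2 : ℝ) 1, b < ‖x t‖ := by
      intro t ht
      by_contra hle
      push Not at hle
      have := h.norm_le_of_endpoints hb0 (hmb.trans_le hku) ht₁.1 ht.2 hxt hle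
        (t := 1 / 2) ⟨ht₁.2, ht.1⟩
      linarith
    have hcomp : IsCompact {t ∈ Icc (0 : ℝ) (1 / 2) | ‖x t‖ ≤ b} := by
      refine isCompact_Icc.of_isClosed_subset ?_ (sep_subset _ _)
      have hc : ContinuousOn (fun t => ‖x t‖) (Icc (0 : ℝ) (1 / 2)) :=
        (h.continuousOn.mono (Icc_subset_Icc_right (by norm_num))).norm
      exact hc.preimage_isClosed_of_isClosed isClosed_Icc isClosed_Iic
    obtain ⟨p, ⟨hp, hpb⟩, hpg⟩ := hcomp.exists_isGreatest ⟨t₁, ht₁, hxt⟩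
    have hp2 : p < 1 / 2 := lt_of_le_of_ne hp.2 fun e => by rw [e] at hpb; linarith
    have hpeq : ‖x p‖ = b := by
      have hc : ContinuousOn (fun t => ‖x t‖) (Icc p (1 / 2)) :=
        (h.continuousOn.mono (Icc_subset_Icc hp.1 (by norm_num))).norm
      obtain ⟨t, ht, e⟩ := intermediate_value_Icc hp.2 hc ⟨hpb, hhalf.le⟩
      have := hpg ⟨⟨hp.1.trans ht.1, ht.2⟩, (le_of_eq e : ‖x t‖ ≤ b)⟩
      have e2 : t = p := le_antisymm this ht.1
      rw [← e2]; exact e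
    have hge : ∀ t ∈ Icc p 1, b ≤ ‖x t‖ := by
      intro t ht
      by_contra hlt
      push Not at hlt
      rcases le_total t (1 / 2) with h2 | h2
      · have := hpg ⟨⟨hp.1.trans ht.1, h2⟩, hlt.le⟩
        have e2 : t = p := le_antisymm this ht.1
        rw [e2] at hlt; linarith
      · exact absurd (hright t ⟨h2, ht.2⟩) (not_lt.mpr hlt.le)
    have hseg := (h.norm_sub_segment_le hk0 hku hp.1 le_rfl (by linarith)
      fun t ht => hfar t (hge t ht)).2 (1 / 2) ⟨hp.2, by norm_num⟩
    have h1p : 0 < 1 - p := by linarith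
    have h3 := norm_sub_smul_le_of_near_zero (div_nonneg (by linarith) h1p.le)
      ((div_le_one h1p).mpr (by linarith)) hk96 hpb hseg
    rw [h1] at h3
    have h4 := hA ((1 / 2 - p) / (1 - p))
    have h5 := norm_sub_le_norm_sub_add_norm_sub ((1 / 2 : ℝ) • (xA + xB)) (x (1 / 2))
      (((1 / 2 - p) / (1 - p)) • xA)
    rw [norm_sub_rev ((1 / 2 : ℝ) • (xA + xB)) (x (1 / 2))] at h5
    linarith [hsmall ‖xA‖ (by linarith)]
  -- The mirror argument with the first contact and `hB`; the first half is already known to be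
  -- free.
  have hright : ∀ t ∈ Icc (1 / 2 : ℝ) 1, b < ‖x t‖ := by
    by_contra hcon
    push Not at hcon
    obtain ⟨t₁, ht₁, hxt⟩ := hcon
    have hcomp : IsCompact {t ∈ Icc (1 / 2 : ℝ) 1 | ‖x t‖ ≤ b} := by
      refine isCompact_Icc.of_isClosed_subset ?_ (sep_subset _ _)
      have hc : ContinuousOn (fun t => ‖x t‖) (Icc (1 / 2 : ℝ) 1) :=
        (h.continuousOn.mono (Icc_subset_Icc_left (by norm_num))).norm
      exact hc.preimage_isClosed_of_isClosed isClosed_Icc isClosed_Iic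
    obtain ⟨q, ⟨hq, hqb⟩, hqg⟩ := hcomp.exists_isLeast ⟨t₁, ht₁, hxt⟩
    have hq2 : 1 / 2 < q := lt_of_le_of_ne hq.1 fun e => by rw [← e] at hqb; linarith
    have hqeq : ‖x q‖ = b := by
      have hc : ContinuousOn (fun t => ‖x t‖) (Icc (1 / 2) q) :=
        (h.continuousOn.mono (Icc_subset_Icc (by norm_num) hq.2)).norm
      obtain ⟨t, ht, e⟩ := intermediate_value_Icc' hq.1 hc ⟨hqb, hhalf.le⟩
      have := hqg ⟨⟨ht.1, ht.2.trans hq.2⟩, (le_of_eq e : ‖x t‖ ≤ b)⟩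
      have e2 : t = q := le_antisymm ht.2 this
      rw [← e2]; exact e
    have hge : ∀ t ∈ Icc 0 q, b ≤ ‖x t‖ := by
      intro t ht
      by_contra hlt
      push Not at hlt
      rcases le_total t (1 / 2) with h2 | h2
      · exact absurd (hleft t ⟨ht.1, h2⟩) (not_lt.mpr hlt.le)
      · have := hqg ⟨⟨h2, ht.2.trans hq.2⟩, hlt.le⟩
        have e2 : t = q := le_antisymm ht.2 this
        rw [e2] at hlt; linarith
    have hq0 : 0 < q := by linarith
    have hseg := (h.norm_sub_segment_le hk0 hku le_rfl hq.2 hq0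
      fun t ht => hfar t (hge t ht)).2 (1 / 2) ⟨by norm_num, hq.1⟩
    simp only [sub_zero] at hseg
    -- The segment is read backwards so that the end near the origin becomes its base point.
    have e : x (1 / 2) - (x 0 + (1 / 2 / q) • (x q - x 0))
        = x (1 / 2) - (x q + (1 - 1 / 2 / q) • (x 0 - x q)) := by module
    rw [e, norm_sub_rev (x q)] at hseg
    have hle1 : 1 / 2 / q ≤ 1 := (div_le_one hq0).mpr hq.1
    have hge0 : 0 ≤ 1 / 2 / q := by positivity
    have h3 := norm_sub_smul_le_of_near_zero (by linarith)
      (by linarith) hk96 hqb hseg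
    rw [h0] at h3
    have h4 := hB (1 - 1 / 2 / q)
    have h5 := norm_sub_le_norm_sub_add_norm_sub ((1 / 2 : ℝ) • (xA + xB)) (x (1 / 2))
      ((1 - 1 / 2 / q) • xB)
    rw [norm_sub_rev ((1 / 2 : ℝ) • (xA + xB)) (x (1 / 2))] at h5
    linarith [hsmall ‖xB‖ (by linarith)]
  have hall : ∀ t ∈ Icc (0 : ℝ) 1, m / ‖x t‖ ≤ k := fun t ht => hfar t (by
    rcases le_total t (1 / 2) with h2 | h2
    · exact (hleft t ⟨ht.1, h2⟩).le
    · exact (hright t ⟨h2, ht.2⟩).le)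
  obtain ⟨s1, s2⟩ := h.norm_sub_segment_le hk0 hku le_rfl le_rfl one_pos hall
  rw [h0, h1, sub_zero, mul_one] at s1
  refine ⟨s1, fun t ht => ⟨(hall t ht).trans hku, ?_⟩⟩
  have s3 := s2 t ht
  rw [h0, h1] at s3
  simp only [sub_zero, div_one] at s3
  refine s3.trans (le_trans ?_ hkL)
  have : ‖xA - xB‖ ≤ L := (norm_sub_le _ _).trans (by linarith)
  gcongr

end IsRay

end Rays

end

end LightRay

namespace LightRay

noncomputable section

open Filter Topology Set Asymptotics

/-! ### Weak field asymptotics, uniform over rays with given end points -/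

section Close

variable {V : Type*} [NormedAddCommGroup V] [InnerProductSpace ℝ V]

/-- A light ray joining `xB` to `xA` that keeps a distance `ρ` from the central mass. -/
structure CloseRay (O : Medium) (xA xB : V) (ρ : ℝ) where
  m : ℝ
  E : ℝ
  x : ℝ → V
  y : ℝ → V
  isRay : IsRay O m E x y
  x_zero : x 0 = xB
  x_one : x 1 = xA
  E_le : E ≤ 2 * ‖xA - xB‖
  far : ∀ t ∈ Icc (0 : ℝ) 1, ρ ≤ ‖x t‖
  weak : ∀ t ∈ Icc (0 : ℝ) 1, m / ‖x t‖ ≤ O.u0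

namespace CloseRay

variable {O : Medium} {xA xB : V} {ρ : ℝ}

/-- The rays around small masses. -/
def small (O : Medium) (xA xB : V) (ρ : ℝ) : Filter (CloseRay O xA xB ρ) :=
  comap CloseRay.m (𝓝 0)

/-- The points, uniformly, of the rays around small masses. -/
def smallPts (O : Medium) (xA xB : V) (ρ : ℝ) : Filter (CloseRay O xA xB ρ × ℝ) :=
  small O xA xB ρ ×ˢ 𝓟 (Icc 0 1)

/-- The rate `dτ / dζ` of the optical time. -/
def rate (z : CloseRay O xA xB ρ × ℝ) : ℝ := z.1.E / O.D (z.1.m / ‖z.1.x z.2‖)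

theorem tendsto_m : Tendsto CloseRay.m (small O xA xB ρ) (𝓝 0) := tendsto_comap

theorem tendsto_pt {t : ℝ} (ht : t ∈ Icc (0 : ℝ) 1) :
    Tendsto (fun c => (c, t)) (small O xA xB ρ) (smallPts O xA xB ρ) :=
  tendsto_id.prodMk (tendsto_principal.mpr (Eventually.of_forall fun _ => ht))

theorem tendsto_fst_small : Tendsto Prod.fst (smallPts O xA xB ρ) (small O xA xB ρ) :=
  tendsto_fst

theorem eventually_pts {p : CloseRay O xA xB ρ × ℝ → Prop}
    (h : ∀ c, ∀ t ∈ Icc (0 : ℝ) 1, p (c, t)) : ∀ᶠ z in smallPts O xA xB ρ, p z := by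
  refine eventually_prod_principal_iff.mpr (Eventually.of_forall h)

theorem bound_of_forall {W : Type*} [Norm W] {F : CloseRay O xA xB ρ × ℝ → W}
    {g : CloseRay O xA xB ρ × ℝ → ℝ} (K : ℝ)
    (h : ∀ c, ∀ t ∈ Icc (0 : ℝ) 1, ‖F (c, t)‖ ≤ K * |g (c, t)|) : F =O[smallPts O xA xB ρ] g :=
  IsBigO.of_bound K (eventually_pts fun c t ht => by
    simpa [Real.norm_eq_abs] using h c t ht)

theorem m_pos (c : CloseRay O xA xB ρ) : 0 < c.m := c.isRay.m_pos

theorem m_isBigO_one : (fun c : CloseRay O xA xB ρ => c.m) =O[small O xA xB ρ]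
    (fun _ => (1 : ℝ)) := tendsto_m.isBigO_one ℝ

theorem m_isBigO_one_pts : (fun z : CloseRay O xA xB ρ × ℝ => z.1.m) =O[smallPts O xA xB ρ]
    (fun _ => (1 : ℝ)) := m_isBigO_one.comp_tendsto tendsto_fst_small

/-- The mean value inequality, uniformly over rays. -/
theorem sub_isBigO_of_hasDerivWithinAt {W : Type*} [NormedAddCommGroup W] [NormedSpace ℝ W]
    {F F' : CloseRay O xA xB ρ → ℝ → W} {k : ℕ}
    (hF : ∀ᶠ c in small O xA xB ρ, ∀ t ∈ Icc (0 : ℝ) 1,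
      HasDerivWithinAt (F c) (F' c t) (Icc 0 1) t)
    (hF' : (fun z : CloseRay O xA xB ρ × ℝ => F' z.1 z.2) =O[smallPts O xA xB ρ]
      fun z => z.1.m ^ k) :
    (fun z : CloseRay O xA xB ρ × ℝ => F z.1 z.2 - F z.1 0) =O[smallPts O xA xB ρ]
      fun z => z.1.m ^ k := by
  obtain ⟨K, hK⟩ := hF'.bound
  refine IsBigO.of_bound K (eventually_prod_principal_iff.mpr ?_)
  filter_upwards [hF, eventually_prod_principal_iff.mp hK] with c h1 h2 t ht
  have h3 := norm_image_sub_le_of_norm_deriv_le_segment' (f := F c) (a := 0) (b := 1) h1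
    (fun s hs => h2 s (Ico_subset_Icc_self hs)) t ht
  have h4 : 0 ≤ K * ‖c.m ^ k‖ := (norm_nonneg _).trans (h2 t ht)
  refine h3.trans ?_
  rw [sub_zero]
  exact mul_le_of_le_one_right h4 ht.2

theorem inv_norm_isBigO (hρ : 0 < ρ) : (fun z : CloseRay O xA xB ρ × ℝ => ‖z.1.x z.2‖⁻¹)
    =O[smallPts O xA xB ρ] fun _ => (1 : ℝ) :=
  bound_of_forall ρ⁻¹ fun c t ht => by
    have := c.far t ht
    rw [norm_inv, norm_norm, abs_one, mul_one]
    exact inv_anti₀ hρ this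

theorem u_isBigO (hρ : 0 < ρ) : (fun z : CloseRay O xA xB ρ × ℝ => z.1.m / ‖z.1.x z.2‖)
    =O[smallPts O xA xB ρ] fun z => z.1.m := by
  simpa [div_eq_mul_inv] using
    (isBigO_refl (fun z : CloseRay O xA xB ρ × ℝ => z.1.m) _).mul (inv_norm_isBigO hρ)

theorem isBigO_of_abs_le_u (hρ : 0 < ρ) {F : ℝ → ℝ} {k : ℕ}
    (h : ∀ u, 0 < u → u ≤ O.u0 → |F u| ≤ 2 * O.C * u ^ k) :
    (fun z : CloseRay O xA xB ρ × ℝ => F (z.1.m / ‖z.1.x z.2‖))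
      =O[smallPts O xA xB ρ] fun z => z.1.m ^ k :=
  IsBigO.trans (bound_of_forall (2 * O.C) fun c t ht => by
    have hu := c.isRay.u_pos ht
    rw [Real.norm_eq_abs, abs_of_nonneg (pow_nonneg hu.le k)]
    exact h _ hu (c.weak t ht)) ((u_isBigO hρ).pow k)

theorem E_isBigO : (fun z : CloseRay O xA xB ρ × ℝ => z.1.E)
    =O[smallPts O xA xB ρ] fun _ => (1 : ℝ) :=
  bound_of_forall (2 * ‖xA - xB‖) fun c t ht => by
    rw [Real.norm_of_nonneg c.isRay.E_pos.le, abs_one, mul_one]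
    exact c.E_le

theorem y_isBigO : (fun z : CloseRay O xA xB ρ × ℝ => z.1.y z.2)
    =O[smallPts O xA xB ρ] fun _ => (1 : ℝ) :=
  bound_of_forall 2 fun c t ht => by
    rw [abs_one, mul_one]
    exact (c.isRay.norm_y_mem ht (c.weak t ht)).2

/-- The spatial potential is `1 + O(u)`, so optical time and affine parameter are proportional to
leading order. -/
theorem rate_sub_E_isBigO (hρ : 0 < ρ) : (fun z : CloseRay O xA xB ρ × ℝ => rate z - z.1.E)
    =O[smallPts O xA xB ρ] fun z => z.1.m ^ 1 := by
  have h := isBigO_of_abs_le_u (O := O) (xA := xA) (xB := xB) hρ (F := fun u => (O.D u)⁻¹ - 1)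
    (k := 1) fun u hu h => by
      rw [pow_one, mul_assoc]; exact O.abs_inv_D_sub_one_le hu h
  refine (E_isBigO.mul h).congr (fun z => ?_) (fun z => by ring)
  simp only [rate]
  ring

theorem rate_isBigO (hρ : 0 < ρ) : (fun z : CloseRay O xA xB ρ × ℝ => rate z)
    =O[smallPts O xA xB ρ] fun _ => (1 : ℝ) := by
  have := ((rate_sub_E_isBigO hρ).trans (by simpa using m_isBigO_one_pts)).add
    (E_isBigO (O := O) (xA := xA) (xB := xB) (ρ := ρ))
  simpa using this

theorem deriv_y_isBigO (hρ : 0 < ρ) : (fun z : CloseRay O xA xB ρ × ℝ =>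
    -(rate z * O.f (z.1.m / ‖z.1.x z.2‖) * (z.1.m / ‖z.1.x z.2‖ ^ 3)) • z.1.x z.2)
      =O[smallPts O xA xB ρ] fun z => z.1.m ^ 1 := by
  have h1 : (fun z : CloseRay O xA xB ρ × ℝ =>
      -(rate z * O.f (z.1.m / ‖z.1.x z.2‖) * (z.1.m / ‖z.1.x z.2‖ ^ 3)) • z.1.x z.2)
      =O[smallPts O xA xB ρ] fun z => rate z * (z.1.m * (‖z.1.x z.2‖⁻¹ * ‖z.1.x z.2‖⁻¹)) :=
    bound_of_forall O.C fun c t ht => by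
      refine (c.isRay.norm_deriv_y ht (c.weak t ht)).trans (le_of_eq ?_)
      have hD := O.D_pos (c.isRay.u_pos ht) (c.weak t ht)
      have hE := c.isRay.E_pos
      have hm := c.m_pos
      simp only [rate]
      rw [abs_of_nonneg (by positivity)]
      field_simp
  refine h1.trans ?_
  have := (rate_isBigO (O := O) (xA := xA) (xB := xB) hρ).mul
    ((isBigO_refl (fun z : CloseRay O xA xB ρ × ℝ => z.1.m) _).mul
      ((inv_norm_isBigO hρ).mul (inv_norm_isBigO hρ)))
  simpa using this

theorem y_sub_isBigO (hρ : 0 < ρ) :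
    (fun z : CloseRay O xA xB ρ × ℝ => z.1.y z.2 - z.1.y 0)
      =O[smallPts O xA xB ρ] fun z => z.1.m ^ 1 :=
  sub_isBigO_of_hasDerivWithinAt (F := fun c => c.y)
    (Eventually.of_forall fun c t ht => c.isRay.deriv_y t ht (c.weak t ht)) (deriv_y_isBigO hρ)

theorem rate_smul_y_sub_isBigO (hρ : 0 < ρ) :
    (fun z : CloseRay O xA xB ρ × ℝ => rate z • z.1.y z.2 - z.1.E • z.1.y 0)
      =O[smallPts O xA xB ρ] fun z => z.1.m ^ 1 := by
  have h1 := (rate_sub_E_isBigO (O := O) (xA := xA) (xB := xB) hρ).smul y_isBigO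
  have h2 := (E_isBigO (O := O) (xA := xA) (xB := xB) (ρ := ρ)).smul (y_sub_isBigO hρ)
  refine ((h1.congr_right (g₂ := fun z => z.1.m ^ 1) fun z => by simp).add
    (h2.congr_right (g₂ := fun z => z.1.m ^ 1) fun z => by simp)).congr_left fun z => ?_
  module

theorem x_sub_isBigO_aux (hρ : 0 < ρ) :
    (fun z : CloseRay O xA xB ρ × ℝ => z.1.x z.2 - xB - (z.1.E * z.2) • z.1.y 0)
      =O[smallPts O xA xB ρ] fun z => z.1.m ^ 1 := by
  have := sub_isBigO_of_hasDerivWithinAt (O := O) (xA := xA) (xB := xB) (ρ := ρ) (k := 1)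
    (F := fun c t => c.x t - (c.E * t) • c.y 0)
    (F' := fun c t => rate (c, t) • c.y t - (c.E * 1) • c.y 0)
    (Eventually.of_forall fun c t ht => (c.isRay.deriv_x t ht (c.weak t ht)).sub
      (((hasDerivWithinAt_id t _).const_mul c.E).smul_const _))
    (by simpa using rate_smul_y_sub_isBigO hρ)
  refine this.congr_left fun z => ?_
  simp only [z.1.x_zero, mul_zero, zero_smul, sub_zero]
  abel

/-- The boundary condition at parameter 1 fixes the initial velocity to leading order; this turns
the shooting estimate into one relative to the segment. -/
theorem E_smul_y_zero_isBigO (hρ : 0 < ρ) :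
    (fun c : CloseRay O xA xB ρ => xA - xB - c.E • c.y 0)
      =O[small O xA xB ρ] fun c => c.m ^ 1 := by
  have := (x_sub_isBigO_aux (O := O) (xA := xA) (xB := xB) hρ).comp_tendsto
    (tendsto_pt (t := 1) ⟨zero_le_one, le_rfl⟩)
  refine this.congr_left fun c => ?_
  simp [c.x_one]

/-- The ray deviates from the segment by a quantity of the first order. -/
theorem x_sub_isBigO (hρ : 0 < ρ) :
    (fun z : CloseRay O xA xB ρ × ℝ => z.1.x z.2 - (xB + z.2 • (xA - xB)))
      =O[smallPts O xA xB ρ] fun z => z.1.m ^ 1 := by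
  have h1 := (E_smul_y_zero_isBigO (O := O) (xA := xA) (xB := xB) hρ).comp_tendsto
    tendsto_fst_small
  have h2 : (fun z : CloseRay O xA xB ρ × ℝ => z.2) =O[smallPts O xA xB ρ]
      fun _ => (1 : ℝ) := bound_of_forall 1 fun c t ht => by
    simpa [abs_of_nonneg ht.1] using ht.2
  refine ((x_sub_isBigO_aux hρ).sub ((h2.smul h1).congr_right (g₂ := fun z => z.1.m ^ 1)
    fun z => by simp)).congr_left fun z => ?_
  simp only [Function.comp]
  module

theorem E_smul_y_sub_isBigO (hρ : 0 < ρ) :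
    (fun z : CloseRay O xA xB ρ × ℝ => z.1.E • z.1.y z.2 - (xA - xB))
      =O[smallPts O xA xB ρ] fun z => z.1.m ^ 1 := by
  have h1 := (E_smul_y_zero_isBigO (O := O) (xA := xA) (xB := xB) hρ).comp_tendsto
    tendsto_fst_small
  have h2 := (E_isBigO (O := O) (xA := xA) (xB := xB) (ρ := ρ)).smul (y_sub_isBigO hρ)
  refine ((h2.congr_right (g₂ := fun z => z.1.m ^ 1) fun z => by simp).sub h1).congr_left
    fun z => ?_
  simp only [Function.comp]
  module

theorem norm_y_sub_one_isBigO (hρ : 0 < ρ) :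
    (fun z : CloseRay O xA xB ρ × ℝ => ‖z.1.y z.2‖ - 1)
      =O[smallPts O xA xB ρ] fun z => z.1.m ^ 1 := by
  refine IsBigO.trans ?_ (isBigO_of_abs_le_u (O := O) (xA := xA) (xB := xB) hρ
    (F := fun u => O.n2 u - 1) (k := 1) fun u hu h => ?_)
  · refine bound_of_forall 1 fun c t ht => ?_
    rw [← c.isRay.norm_sq_y t ht (c.weak t ht), one_mul, Real.norm_eq_abs,
      show ‖c.y t‖ ^ 2 - 1 = (‖c.y t‖ - 1) * (‖c.y t‖ + 1) by ring, abs_mul]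
    have := norm_nonneg (c.y t)
    refine le_mul_of_one_le_right (abs_nonneg _) ?_
    rw [abs_of_nonneg (by linarith)]; linarith
  · have := O.n2_bound_one u hu h
    have h2 := O.one_le_C
    have : 0 ≤ O.C * u := by positivity
    rw [pow_one]
    linarith

/-- Take norms in `E y = xA - xB + O(m)`, using `‖y‖ = 1 + O(m)`. -/
theorem E_sub_isBigO (hρ : 0 < ρ) :
    (fun z : CloseRay O xA xB ρ × ℝ => z.1.E - ‖xA - xB‖)
      =O[smallPts O xA xB ρ] fun z => z.1.m ^ 1 := by
  have h1 : (fun z : CloseRay O xA xB ρ × ℝ => z.1.E * ‖z.1.y z.2‖ - ‖xA - xB‖)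
      =O[smallPts O xA xB ρ] fun z => z.1.m ^ 1 := by
    refine IsBigO.trans (IsBigO.of_bound 1 (Eventually.of_forall fun z => ?_))
      (E_smul_y_sub_isBigO hρ)
    rw [one_mul, Real.norm_eq_abs]
    have := abs_norm_sub_norm_le (z.1.E • z.1.y z.2) (xA - xB)
    rwa [norm_smul, Real.norm_of_nonneg z.1.isRay.E_pos.le] at this
  have h2 := (E_isBigO (O := O) (xA := xA) (xB := xB) (ρ := ρ)).mul (norm_y_sub_one_isBigO hρ)
  refine (h1.sub (h2.congr_right (g₂ := fun z => z.1.m ^ 1) fun z => by simp)).congr_left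
    fun z => ?_
  ring

theorem rate_sub_isBigO (hρ : 0 < ρ) :
    (fun z : CloseRay O xA xB ρ × ℝ => rate z - ‖xA - xB‖)
      =O[smallPts O xA xB ρ] fun z => z.1.m ^ 1 :=
  ((rate_sub_E_isBigO hρ).add (E_sub_isBigO hρ)).congr_left fun z => by ring

/-- The direction triple differs from the Minkowskian one by a quantity of the first order. -/
theorem y_add_isBigO (hρ : 0 < ρ) (hR : 0 < ‖xA - xB‖) :
    (fun z : CloseRay O xA xB ρ × ℝ => z.1.y z.2 - ‖xA - xB‖⁻¹ • (xA - xB))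
      =O[smallPts O xA xB ρ] fun z => z.1.m ^ 1 := by
  have h2 := (E_sub_isBigO (O := O) (xA := xA) (xB := xB) hρ).smul y_isBigO
  have h3 := (E_smul_y_sub_isBigO hρ).sub (h2.congr_right (g₂ := fun z => z.1.m ^ 1)
    fun z => by simp)
  refine (h3.const_smul_left ‖xA - xB‖⁻¹).congr_left fun z => ?_
  simp only [Pi.smul_apply]
  have : ‖xA - xB‖⁻¹ • (z.1.E • z.1.y z.2 - (xA - xB) - (z.1.E - ‖xA - xB‖) • z.1.y z.2)
      = (‖xA - xB‖⁻¹ * ‖xA - xB‖) • z.1.y z.2 - ‖xA - xB‖⁻¹ • (xA - xB) := by module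
  rw [this, inv_mul_cancel₀ hR.ne', one_smul]

end CloseRay

end Close

end

end LightRay

namespace LightRay

noncomputable section

open Filter Topology Set Asymptotics

/-! ### Adapted coordinates, conservation laws and the Hamilton vector -/

section Frames

variable {V : Type*} [NormedAddCommGroup V] [InnerProductSpace ℝ V]

/-- Cartesian coordinates in which the segment from `xA` to `xB` is parallel to the first axis and
the origin lies in the plane of the first two axes. -/
structure Frame (xA xB : V) where
  e : OrthonormalBasis (Fin 3) ℝ V
  a : ℝ
  b : ℝ
  h : ℝ
  a_lt_b : a < b
  h_pos : 0 < h
  eq_A : xA = a • e 0 + h • e 1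
  eq_B : xB = b • e 0 + h • e 1

namespace Frame

variable {xA xB : V} (F : Frame xA xB)

/-- The Cartesian coordinates of a vector. -/
def coord (i : Fin 3) (v : V) : ℝ := inner ℝ (F.e i) v

theorem coord_add (i : Fin 3) (v w : V) : F.coord i (v + w) = F.coord i v + F.coord i w :=
  inner_add_right _ _ _

theorem coord_sub (i : Fin 3) (v w : V) : F.coord i (v - w) = F.coord i v - F.coord i w :=
  inner_sub_right _ _ _

theorem coord_smul (i : Fin 3) (k : ℝ) (v : V) : F.coord i (k • v) = k * F.coord i v :=
  real_inner_smul_right _ _ _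

theorem coord_e (i j : Fin 3) : F.coord i (F.e j) = if i = j then 1 else 0 :=
  orthonormal_iff_ite.mp F.e.orthonormal i j

theorem abs_coord_le (i : Fin 3) (v : V) : |F.coord i v| ≤ ‖v‖ := by
  have := abs_real_inner_le_norm (F.e i) v
  rwa [F.e.orthonormal.1 i, one_mul] at this

theorem inner_eq (v w : V) : inner ℝ v w = F.coord 0 v * F.coord 0 w + F.coord 1 v * F.coord 1 w
    + F.coord 2 v * F.coord 2 w := by
  rw [← F.e.sum_inner_mul_inner v w, Fin.sum_univ_three]
  simp only [coord, real_inner_comm v]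

theorem norm_sq_eq (v : V) : ‖v‖ ^ 2 = F.coord 0 v ^ 2 + F.coord 1 v ^ 2 + F.coord 2 v ^ 2 := by
  rw [← real_inner_self_eq_norm_sq, F.inner_eq]; ring

theorem norm_le_sum (v : V) : ‖v‖ ≤ |F.coord 0 v| + |F.coord 1 v| + |F.coord 2 v| := by
  refine abs_le_of_sq_le_sq' ?_ (by positivity) |>.2
  rw [F.norm_sq_eq]
  have h0 := abs_nonneg (F.coord 0 v)
  have h1 := abs_nonneg (F.coord 1 v)
  have h2 := abs_nonneg (F.coord 2 v)
  rw [← sq_abs (F.coord 0 v), ← sq_abs (F.coord 1 v), ← sq_abs (F.coord 2 v)]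
  nlinarith [mul_nonneg h0 h1, mul_nonneg h0 h2, mul_nonneg h1 h2]

theorem coord_zero_A : F.coord 0 xA = F.a := by
  refine (congrArg (F.coord 0) F.eq_A).trans ?_
  rw [coord_add, coord_smul, coord_smul, coord_e, coord_e]; simp

theorem coord_one_A : F.coord 1 xA = F.h := by
  refine (congrArg (F.coord 1) F.eq_A).trans ?_
  rw [coord_add, coord_smul, coord_smul, coord_e, coord_e]; simp

theorem coord_two_A : F.coord 2 xA = 0 := by
  refine (congrArg (F.coord 2) F.eq_A).trans ?_
  rw [coord_add, coord_smul, coord_smul, coord_e, coord_e]; simp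

theorem coord_zero_B : F.coord 0 xB = F.b := by
  refine (congrArg (F.coord 0) F.eq_B).trans ?_
  rw [coord_add, coord_smul, coord_smul, coord_e, coord_e]; simp

theorem coord_one_B : F.coord 1 xB = F.h := by
  refine (congrArg (F.coord 1) F.eq_B).trans ?_
  rw [coord_add, coord_smul, coord_smul, coord_e, coord_e]; simp

theorem coord_two_B : F.coord 2 xB = 0 := by
  refine (congrArg (F.coord 2) F.eq_B).trans ?_
  rw [coord_add, coord_smul, coord_smul, coord_e, coord_e]; simp

theorem norm_sq_A : ‖xA‖ ^ 2 = F.a ^ 2 + F.h ^ 2 := by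
  rw [F.norm_sq_eq, coord_zero_A, coord_one_A, coord_two_A]; ring

theorem norm_sq_B : ‖xB‖ ^ 2 = F.b ^ 2 + F.h ^ 2 := by
  rw [F.norm_sq_eq, coord_zero_B, coord_one_B, coord_two_B]; ring

theorem A_sub_B : xA - xB = -(F.b - F.a) • F.e 0 := by
  refine (congrArg₂ (· - ·) F.eq_A F.eq_B).trans ?_
  module

theorem norm_A_sub_B : ‖xA - xB‖ = F.b - F.a := by
  rw [F.A_sub_B, norm_smul, norm_neg, F.e.orthonormal.1, mul_one,
    Real.norm_of_nonneg (sub_nonneg.mpr F.a_lt_b.le)]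

theorem norm_A_sub_B_pos (F : Frame xA xB) : 0 < ‖xA - xB‖ := by
  rw [F.norm_A_sub_B]; exact sub_pos.mpr F.a_lt_b

theorem norm_sq_segment (t : ℝ) :
    ‖xB + t • (xA - xB)‖ ^ 2 = F.h ^ 2 + (F.b - t * (F.b - F.a)) ^ 2 := by
  rw [F.norm_sq_eq]
  simp only [coord_add, coord_smul, coord_sub, coord_zero_A, coord_one_A, coord_two_A,
    coord_zero_B, coord_one_B, coord_two_B]
  ring

theorem h_le_norm_segment (t : ℝ) : F.h ≤ ‖xB + t • (xA - xB)‖ := by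
  refine abs_le_of_sq_le_sq' ?_ (norm_nonneg _) |>.2
  rw [F.norm_sq_segment]
  nlinarith [sq_nonneg (F.b - t * (F.b - F.a))]

theorem hasDerivWithinAt_coord (i : Fin 3) {x : ℝ → V} {x' : V} {s : Set ℝ} {t : ℝ}
    (hx : HasDerivWithinAt x x' s t) :
    HasDerivWithinAt (fun t => F.coord i (x t)) (F.coord i x') s t :=
  (innerSL ℝ (F.e i)).hasFDerivAt.comp_hasDerivWithinAt t hx

theorem coord_isBigO {T : Type*} {l : Filter T} {g : T → V} {k : T → ℝ} (i : Fin 3)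
    (hg : g =O[l] k) : (fun z => F.coord i (g z)) =O[l] k :=
  IsBigO.trans (IsBigO.of_bound 1 (Eventually.of_forall fun z => by
    rw [one_mul]; exact F.abs_coord_le i _)) hg

/-- The primitive of `-2 h / r ^ 4` along the line of height `h`. -/
def lineIntegral (s : ℝ) : ℝ := s / (F.h * (F.h ^ 2 + s ^ 2)) + Real.arctan (s / F.h) / F.h ^ 2

theorem hasDerivAt_lineIntegral (s : ℝ) :
    HasDerivAt F.lineIntegral (2 * F.h / (F.h ^ 2 + s ^ 2) ^ 2) s := by
  have hh := F.h_pos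
  have hd : F.h * (F.h ^ 2 + s ^ 2) ≠ 0 := by positivity
  have h1 := (hasDerivAt_id' s).div ((((hasDerivAt_id' s).pow 2).const_add (F.h ^ 2)).const_mul F.h)
    hd
  have h2 := (((hasDerivAt_id' s).div_const F.h).arctan).div_const (F.h ^ 2)
  refine (h1.add h2).congr_deriv ?_
  have : F.h ^ 2 + s ^ 2 ≠ 0 := by positivity
  have h3 : 1 + (s / F.h) ^ 2 = (F.h ^ 2 + s ^ 2) / F.h ^ 2 := by field_simp
  simp only [h3, Pi.pow_apply]
  field_simp
  push_cast
  ring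

end Frame

namespace CloseRay

variable {O : Medium} {xA xB : V} {ρ : ℝ}

/-- The force is central and the velocity is parallel to `y`, so each component of `x ∧ y` has zero
derivative. -/
theorem angularMomentum_eq (F : Frame xA xB) (c : CloseRay O xA xB ρ) (i k : Fin 3) {t : ℝ}
    (ht : t ∈ Icc (0 : ℝ) 1) :
    F.coord i (c.x t) * F.coord k (c.y t) - F.coord k (c.x t) * F.coord i (c.y t)
      = F.coord i (c.x 0) * F.coord k (c.y 0) - F.coord k (c.x 0) * F.coord i (c.y 0) := by
  have := norm_image_sub_le_of_norm_deriv_le_segment' (C := 0) (a := 0) (b := 1)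
    (f := fun t => F.coord i (c.x t) * F.coord k (c.y t) - F.coord k (c.x t) * F.coord i (c.y t))
    (f' := fun _ => 0) (fun t ht => by
      have h1 := c.isRay.deriv_x t ht (c.weak t ht)
      have h2 := c.isRay.deriv_y t ht (c.weak t ht)
      refine (((F.hasDerivWithinAt_coord i h1).mul (F.hasDerivWithinAt_coord k h2)).sub
        ((F.hasDerivWithinAt_coord k h1).mul (F.hasDerivWithinAt_coord i h2))).congr_deriv ?_
      simp only [F.coord_smul]
      ring) (by simp) t ht
  rw [zero_mul, norm_le_zero_iff, sub_eq_zero] at this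
  exact this

/-- The angular momentum of a ray. -/
def angMom (F : Frame xA xB) (c : CloseRay O xA xB ρ) : ℝ :=
  F.b * F.coord 1 (c.y 0) - F.h * F.coord 0 (c.y 0)

theorem angMom_eq (F : Frame xA xB) (c : CloseRay O xA xB ρ) {t : ℝ} (ht : t ∈ Icc (0 : ℝ) 1) :
    F.coord 0 (c.x t) * F.coord 1 (c.y t) - F.coord 1 (c.x t) * F.coord 0 (c.y t)
      = c.angMom F := by
  rw [c.angularMomentum_eq F 0 1 ht, c.x_zero, F.coord_zero_B, F.coord_one_B, angMom]

/-- Rays with nonvanishing angular momentum are plane curves. -/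
theorem coord_two_eq_zero (F : Frame xA xB) (c : CloseRay O xA xB ρ) (hj : c.angMom F ≠ 0)
    {t : ℝ} (ht : t ∈ Icc (0 : ℝ) 1) : F.coord 2 (c.x t) = 0 ∧ F.coord 2 (c.y t) = 0 := by
  have h1 : (1 : ℝ) ∈ Icc (0 : ℝ) 1 := ⟨zero_le_one, le_rfl⟩
  have e0 := c.angularMomentum_eq F 0 2 h1
  have e1 := c.angularMomentum_eq F 1 2 h1
  rw [c.x_zero, c.x_one, F.coord_zero_A, F.coord_two_A, F.coord_zero_B, F.coord_two_B] at e0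
  rw [c.x_zero, c.x_one, F.coord_one_A, F.coord_two_A, F.coord_one_B, F.coord_two_B] at e1
  simp only [zero_mul, sub_zero] at e0 e1
  have e2 := mul_left_cancel₀ F.h_pos.ne' e1
  -- Comparing the two out-of-plane angular momenta at both ends gives the same component of `y` at
  -- `xA` and `xB`, and then shows that it vanishes, since the end points are distinct.
  have e3 : (F.b - F.a) * F.coord 2 (c.y 0) = 0 := by rw [e2] at e0; linarith
  have hy0 : F.coord 2 (c.y 0) = 0 :=
    (mul_eq_zero.mp e3).resolve_left (sub_pos.mpr F.a_lt_b).ne'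
  have i0 := c.angularMomentum_eq F 0 2 ht
  have i1 := c.angularMomentum_eq F 1 2 ht
  rw [c.x_zero, F.coord_two_B, hy0] at i0 i1
  have ej := c.angMom_eq F ht
  constructor
  · have : F.coord 2 (c.x t) * c.angMom F = 0 := by
      rw [← ej]
      linear_combination F.coord 1 (c.x t) * i0 - F.coord 0 (c.x t) * i1
    exact (mul_eq_zero.mp this).resolve_right hj
  · have : F.coord 2 (c.y t) * c.angMom F = 0 := by
      rw [← ej]
      linear_combination F.coord 1 (c.y t) * i0 - F.coord 0 (c.y t) * i1
    exact (mul_eq_zero.mp this).resolve_right hj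

/-- `A` equals `B` up to the first order, both being bounded. -/
def Near (A B : CloseRay O xA xB ρ × ℝ → ℝ) : Prop :=
  (fun z => A z - B z) =O[smallPts O xA xB ρ] (fun z => z.1.m ^ 1) ∧
    B =O[smallPts O xA xB ρ] fun _ => (1 : ℝ)

theorem Near.isBigO_left {A B : CloseRay O xA xB ρ × ℝ → ℝ} (h : Near A B) :
    A =O[smallPts O xA xB ρ] fun _ => (1 : ℝ) := by
  have := (h.1.trans (by simpa using m_isBigO_one_pts)).add h.2
  simpa using this

theorem Near.mul {A B A' B' : CloseRay O xA xB ρ × ℝ → ℝ} (h : Near A B) (h' : Near A' B') :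
    Near (fun z => A z * A' z) (fun z => B z * B' z) := by
  refine ⟨?_, by simpa using h.2.mul h'.2⟩
  have h1 := (h.1.mul h'.isBigO_left).add ((h.2.mul h'.1).congr_right
    (g₂ := fun z => z.1.m ^ 1 * 1) fun z => by ring)
  have h2 := h1.congr_right (g₂ := fun z => z.1.m ^ 1) fun z => by ring
  exact h2.congr_left fun z => by ring

theorem near_coord_one_x (F : Frame xA xB) (hρ : 0 < ρ) :
    Near (fun z : CloseRay O xA xB ρ × ℝ => F.coord 1 (z.1.x z.2)) (fun _ => F.h) := by
  refine ⟨(F.coord_isBigO 1 (x_sub_isBigO hρ)).congr_left fun z => ?_, isBigO_const_one ℝ _ _⟩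
  simp only [F.coord_add, F.coord_smul, F.coord_sub, F.coord_one_A, F.coord_one_B]
  ring

theorem near_rate (F : Frame xA xB) (hρ : 0 < ρ) :
    Near (rate : CloseRay O xA xB ρ × ℝ → ℝ) (fun _ => F.b - F.a) :=
  ⟨by rw [← F.norm_A_sub_B]; exact rate_sub_isBigO hρ, isBigO_const_one ℝ _ _⟩

theorem near_inv_norm (F : Frame xA xB) (hρ : 0 < ρ) :
    Near (fun z : CloseRay O xA xB ρ × ℝ => ‖z.1.x z.2‖⁻¹)
      (fun z => ‖xB + z.2 • (xA - xB)‖⁻¹) := by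
  have hb : (fun z : CloseRay O xA xB ρ × ℝ => ‖xB + z.2 • (xA - xB)‖⁻¹)
      =O[smallPts O xA xB ρ] fun _ => (1 : ℝ) := bound_of_forall F.h⁻¹ fun c t ht => by
    rw [norm_inv, norm_norm, abs_one, mul_one]
    exact inv_anti₀ F.h_pos (F.h_le_norm_segment t)
  refine ⟨?_, hb⟩
  have h1 : (fun z : CloseRay O xA xB ρ × ℝ => ‖xB + z.2 • (xA - xB)‖ - ‖z.1.x z.2‖)
      =O[smallPts O xA xB ρ] fun z => z.1.m ^ 1 := by
    refine IsBigO.trans (IsBigO.of_bound 1 (Eventually.of_forall fun z => ?_)) (x_sub_isBigO hρ)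
    rw [one_mul, Real.norm_eq_abs, abs_sub_comm]
    exact abs_norm_sub_norm_le _ _
  have h2 := h1.mul ((inv_norm_isBigO (O := O) (xA := xA) (xB := xB) hρ).mul hb)
  refine (h2.congr_right (g₂ := fun z => z.1.m ^ 1) fun z => by ring).congr' ?_ EventuallyEq.rfl
  refine eventually_pts fun c t ht => ?_
  have e1 := (c.isRay.norm_pos ht).ne'
  have e2 := (F.h_pos.trans_le (F.h_le_norm_segment t)).ne'
  simp only
  field_simp

theorem coord_y_isBigO (F : Frame xA xB) (hρ : 0 < ρ) :
    ((fun z : CloseRay O xA xB ρ × ℝ => F.coord 0 (z.1.y z.2) + 1)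
      =O[smallPts O xA xB ρ] fun z => z.1.m ^ 1) ∧
    ((fun z : CloseRay O xA xB ρ × ℝ => F.coord 1 (z.1.y z.2))
      =O[smallPts O xA xB ρ] fun z => z.1.m ^ 1) := by
  have h := y_add_isBigO (O := O) (xA := xA) (xB := xB) hρ F.norm_A_sub_B_pos
  have hne := F.norm_A_sub_B_pos.ne'
  have e : ‖xA - xB‖⁻¹ • (xA - xB) = -F.e 0 := by
    rw [F.norm_A_sub_B] at *
    rw [F.A_sub_B, smul_smul, mul_neg, inv_mul_cancel₀ hne]; simp
  rw [e] at h
  refine ⟨(F.coord_isBigO 0 h).congr_left fun z => ?_, (F.coord_isBigO 1 h).congr_left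
    fun z => ?_⟩
  · rw [sub_neg_eq_add, F.coord_add, F.coord_e]; simp
  · rw [sub_neg_eq_add, F.coord_add, F.coord_e]; simp

theorem angMom_sub_isBigO (F : Frame xA xB) (hρ : 0 < ρ) :
    (fun c : CloseRay O xA xB ρ => c.angMom F - F.h) =O[small O xA xB ρ] fun c => c.m ^ 1 := by
  have h0 := (coord_y_isBigO (O := O) F hρ).1.comp_tendsto (tendsto_pt ⟨le_rfl, zero_le_one⟩)
  have h1 := (coord_y_isBigO (O := O) F hρ).2.comp_tendsto (tendsto_pt ⟨le_rfl, zero_le_one⟩)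
  refine ((h1.const_mul_left F.b).sub (h0.const_mul_left F.h)).congr_left fun c => ?_
  simp only [Function.comp, angMom]
  ring

theorem eventually_angMom (F : Frame xA xB) (hρ : 0 < ρ) :
    ∀ᶠ c in small O xA xB ρ, F.h / 2 < c.angMom F := by
  have h1 : Tendsto (fun c : CloseRay O xA xB ρ => c.angMom F - F.h) (small O xA xB ρ) (𝓝 0) := by
    refine (angMom_sub_isBigO F hρ).trans_tendsto ?_
    simpa using tendsto_m
  have hh := F.h_pos
  filter_upwards [h1.eventually_const_lt (show -(F.h / 2) < 0 by linarith)] with c hc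
  linarith

/-- For a plane motion the derivative of `cos θ` is proportional to `j x₁ / r³`, that is, to the
transverse Kepler force. This is the exact integration behind the Hamilton vector. -/
theorem hasDerivWithinAt_cos (F : Frame xA xB) (c : CloseRay O xA xB ρ) (hj : c.angMom F ≠ 0)
    {t : ℝ} (ht : t ∈ Icc (0 : ℝ) 1) :
    HasDerivWithinAt (fun t => F.coord 0 (c.x t) / ‖c.x t‖)
      (-(rate (c, t) * c.angMom F * F.coord 1 (c.x t) / ‖c.x t‖ ^ 3)) (Icc 0 1) t := by
  have h1 := c.isRay.deriv_x t ht (c.weak t ht)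
  have hr := c.isRay.norm_pos ht
  have h2 := h1.norm_sq.sqrt (by positivity)
  simp only [Real.sqrt_sq (norm_nonneg _)] at h2
  refine ((F.hasDerivWithinAt_coord 0 h1).div h2 hr.ne').congr_deriv ?_
  have hz := c.coord_two_eq_zero F hj ht
  have ej := c.angMom_eq F ht
  have er := F.norm_sq_eq (c.x t)
  rw [real_inner_smul_right, F.coord_smul, F.inner_eq, hz.1, hz.2, ← ej]
  rw [hz.1] at er
  change (rate (c, t) * F.coord 0 (c.y t) * ‖c.x t‖ - F.coord 0 (c.x t) * (2 * (rate (c, t) *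
    (F.coord 0 (c.x t) * F.coord 0 (c.y t) + F.coord 1 (c.x t) * F.coord 1 (c.y t) + 0 * 0))
      / (2 * ‖c.x t‖))) / ‖c.x t‖ ^ 2 = _
  field_simp
  rw [er]
  ring

/-- The second component of the Hamilton vector, corrected to the second order. -/
def hamilton (F : Frame xA xB) (c : CloseRay O xA xB ρ) (t : ℝ) : ℝ :=
  F.coord 1 (c.y t) - O.α * c.m / c.angMom F * (F.coord 0 (c.x t) / ‖c.x t‖)
    - O.κ * c.m ^ 2 * F.lineIntegral (F.b - t * (F.b - F.a))

/-- The derivative of `hamilton`. -/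
def hamiltonDeriv (F : Frame xA xB) (c : CloseRay O xA xB ρ) (t : ℝ) : ℝ :=
  -(rate (c, t) * F.coord 1 (c.x t) * ‖c.x t‖⁻¹ ^ 3 * c.m
      * (O.f (c.m / ‖c.x t‖) - (O.α + 2 * O.κ * (c.m / ‖c.x t‖))))
    - 2 * O.κ * c.m ^ 2 * (rate (c, t) * F.coord 1 (c.x t) * (‖c.x t‖⁻¹ * ‖c.x t‖⁻¹
        * (‖c.x t‖⁻¹ * ‖c.x t‖⁻¹))
      - (F.b - F.a) * F.h * (‖xB + t • (xA - xB)‖⁻¹ * ‖xB + t • (xA - xB)‖⁻¹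
        * (‖xB + t • (xA - xB)‖⁻¹ * ‖xB + t • (xA - xB)‖⁻¹)))

/-- The `α`-force cancels exactly against the derivative of `cos θ`. What is left is the remainder
of `f` and the difference between the `κ`-force on the ray and on the straight segment. -/
theorem hasDerivWithinAt_hamilton (F : Frame xA xB) (c : CloseRay O xA xB ρ)
    (hj : c.angMom F ≠ 0) {t : ℝ} (ht : t ∈ Icc (0 : ℝ) 1) :
    HasDerivWithinAt (hamilton F c)
      (hamiltonDeriv F c t) (Icc 0 1) t := by
  have h2 := c.isRay.deriv_y t ht (c.weak t ht)
  have h3 := (c.hasDerivWithinAt_cos F hj ht).const_mul (O.α * c.m / c.angMom F)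
  have h4 : HasDerivWithinAt (fun t => F.b - t * (F.b - F.a)) (-(1 * (F.b - F.a))) (Icc 0 1) t :=
    ((hasDerivWithinAt_id t _).mul_const _).const_sub _
  have h5 := ((F.hasDerivAt_lineIntegral _).comp_hasDerivWithinAt t h4).const_mul
    (O.κ * c.m ^ 2)
  refine (((F.hasDerivWithinAt_coord 1 h2).sub h3).sub h5).congr_deriv ?_
  rw [F.coord_smul, ← F.norm_sq_segment, hamiltonDeriv]
  have hr := (c.isRay.norm_pos ht).ne'
  have hr0 := (F.h_pos.trans_le (F.h_le_norm_segment t)).ne'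
  change -(rate (c, t) * O.f (c.m / ‖c.x t‖) * (c.m / ‖c.x t‖ ^ 3)) * _ - _ - _ = _
  generalize rate (c, t) = ω
  generalize O.f (c.m / ‖c.x t‖) = f
  generalize ‖xB + t • (xA - xB)‖ = r₀ at *
  generalize ‖c.x t‖ = r at *
  field_simp
  ring

/-- Both terms of the derivative are `O(m³)`: one is `m` times a remainder of order `m²`, the other
`m²` times a difference of order `m`. No second-order knowledge of the trajectory is needed. -/
theorem hamilton_sub_isBigO (F : Frame xA xB) (hρ : 0 < ρ) :
    (fun c : CloseRay O xA xB ρ => hamilton F c 1 - hamilton F c 0)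
      =O[small O xA xB ρ] fun c => c.m ^ 3 := by
  have hev : ∀ᶠ c in small O xA xB ρ, ∀ t ∈ Icc (0 : ℝ) 1, HasDerivWithinAt (hamilton F c)
      (hamiltonDeriv F c t)
      (Icc 0 1) t := by
    filter_upwards [eventually_angMom F hρ] with c hc t ht
    exact hasDerivWithinAt_hamilton F c (by have := F.h_pos; linarith) ht
  have hN := near_inv_norm (O := O) F hρ
  have hωY := (near_rate (O := O) F hρ).mul (near_coord_one_x F hρ)
  have hN4 := hωY.mul ((hN.mul hN).mul (hN.mul hN))
  have hm := isBigO_refl (fun z : CloseRay O xA xB ρ × ℝ => z.1.m) (smallPts O xA xB ρ)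
  have i1 := (hm.pow 2).mul hN4.1
  have hf := isBigO_of_abs_le_u (O := O) (xA := xA) (xB := xB) hρ
    (F := fun u => O.f u - (O.α + 2 * O.κ * u)) (k := 2) fun u hu h => by
      have h1 := O.f_bound u hu h
      have h2 := O.one_le_C
      have : 0 ≤ O.C * u ^ 2 := by positivity
      linarith
  have i2 := ((hωY.isBigO_left.mul (hN.isBigO_left.pow 3)).mul hm).mul hf
  have key := sub_isBigO_of_hasDerivWithinAt (k := 3) hev
    (((i2.congr_right (g₂ := fun z => z.1.m ^ 3) fun z => by ring).neg_left.sub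
      ((i1.congr_right (g₂ := fun z => z.1.m ^ 3) fun z => by ring).const_mul_left
        (2 * O.κ))).congr_left fun z => by simp only [hamiltonDeriv]; ring)
  exact (key.comp_tendsto (tendsto_pt ⟨zero_le_one, le_rfl⟩))

end CloseRay

end Frames

end

end LightRay

namespace LightRay

noncomputable section

open Filter Topology Set Asymptotics

/-! ### Second-order solution of the end-point equations -/

section Endpoints

variable {T : Type*} {l : Filter T} {m : T → ℝ}

theorem pow_isBigO_pow_of_tendsto_zero (hm : Tendsto m l (𝓝 0)) {k n : ℕ} (h : n ≤ k) :
    (fun t => m t ^ k) =O[l] fun t => m t ^ n := by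
  obtain ⟨d, rfl⟩ := Nat.exists_eq_add_of_le h
  simpa [pow_add] using (isBigO_refl (fun t => m t ^ n) _).mul ((hm.isBigO_one ℝ).pow d)

/-- The component of the direction triple along the line of sight is determined by the other one
and by the refractive index. -/
theorem longitudinal_expansion (hm : Tendsto m l (𝓝 0)) {p q : T → ℝ} {α κ u : ℝ}
    (hpq : (fun t => p t ^ 2 + q t ^ 2 - (1 + 2 * α * (m t * u) + 2 * κ * (m t * u) ^ 2))
      =O[l] fun t => m t ^ 3)
    (hp : (fun t => p t + 1) =O[l] fun t => m t ^ 1) (hq : q =O[l] fun t => m t ^ 1) :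
    (fun t => p t + (1 + α * (m t * u) + (κ - α ^ 2 / 2) * (m t * u) ^ 2 - q t ^ 2 / 2))
      =O[l] fun t => m t ^ 3 := by
  have hM := isBigO_refl m l
  have hq2 : (fun t => q t ^ 2) =O[l] fun t => m t ^ 2 :=
    (hq.pow 2).congr_right fun t => by ring
  have hm2 : (fun t => m t ^ 2) =O[l] fun t => m t ^ 2 := isBigO_refl _ _
  have hw2 : (fun t => (κ - α ^ 2 / 2) * (m t * u) ^ 2 - q t ^ 2 / 2) =O[l]
      fun t => m t ^ 2 :=
    ((hm2.const_mul_left ((κ - α ^ 2 / 2) * u ^ 2)).sub (hq2.const_mul_left (1 / 2))).congr_left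
      fun t => by ring
  have hw1 : (fun t => α * (m t * u)) =O[l] fun t => m t ^ 1 :=
    (hM.const_mul_left (α * u)).congr (fun t => by ring) fun t => by ring
  have h21 := pow_isBigO_pow_of_tendsto_zero hm (show 1 ≤ 2 by norm_num)
  have hw12 : (fun t => 2 * (α * (m t * u)) + ((κ - α ^ 2 / 2) * (m t * u) ^ 2 - q t ^ 2 / 2))
      =O[l] fun t => m t ^ 1 := (hw1.const_mul_left 2).add (hw2.trans h21)
  have hprod : (fun t => ((κ - α ^ 2 / 2) * (m t * u) ^ 2 - q t ^ 2 / 2)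
      * (2 * (α * (m t * u)) + ((κ - α ^ 2 / 2) * (m t * u) ^ 2 - q t ^ 2 / 2)))
      =O[l] fun t => m t ^ 3 := (hw2.mul hw12).congr_right fun t => by ring
  have hm1 : Tendsto (fun t => m t ^ 1) l (𝓝 0) := by simpa using hm
  -- With `W` the sum of the correction terms, `p² - (1 + W)²` factors as `(p + 1 + W)(p - 1 - W)`,
  -- and the second factor tends to `-2`. Dividing by it selects the root near `-1`.
  have hdiff : Tendsto (fun t => p t + 1 - (α * (m t * u)
      + ((κ - α ^ 2 / 2) * (m t * u) ^ 2 - q t ^ 2 / 2)) - 2) l (𝓝 (0 - 0 - 2)) :=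
    ((hp.trans_tendsto hm1).sub ((hw1.add (hw2.trans h21)).trans_tendsto hm1)).sub_const 2
  have hinv := (hdiff.inv₀ (by norm_num)).isBigO_one ℝ
  have hne := hdiff.eventually_ne (show (0 : ℝ) - 0 - 2 ≠ 0 by norm_num)
  refine (((hpq.sub hprod).mul hinv).congr_right (g₂ := fun t => m t ^ 3)
    fun t => by ring).congr' ?_ EventuallyEq.rfl
  filter_upwards [hne] with t ht
  rw [mul_inv_eq_iff_eq_mul₀ ht]
  ring

/-- The angular momentum and Hamilton relations always produce this system, of determinant `b - a`,
for the transverse components at the two ends; it is used once for each order. -/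
theorem linear_system_isBigO {x y g : T → ℝ} {a b : ℝ} (hab : b - a ≠ 0)
    (h1 : (fun t => a * x t - b * y t) =O[l] g) (h2 : (fun t => x t - y t) =O[l] g) :
    x =O[l] g ∧ y =O[l] g := by
  have hx : x =O[l] g := by
    have := ((h2.const_mul_left b).sub h1).const_mul_left ((b - a)⁻¹)
    exact this.congr_left fun t => by field_simp; ring
  exact ⟨hx, (hx.sub h2).congr_left fun t => by ring⟩

/-- The direction triples at the end points, up to the second order. -/
theorem endpoint_expansion (hm : Tendsto m l (𝓝 0)) {pA qA pB qB j : T → ℝ}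
    {a b h α κ uA uB cA cB Λ Q1A Q1B Q2A Q2B : ℝ} (hab : b - a ≠ 0) (hh : h ≠ 0)
    (jA : ∀ t, a * qA t - h * pA t = j t) (jB : ∀ t, b * qB t - h * pB t = j t)
    (nA : (fun t => pA t ^ 2 + qA t ^ 2 - (1 + 2 * α * (m t * uA) + 2 * κ * (m t * uA) ^ 2))
      =O[l] fun t => m t ^ 3)
    (nB : (fun t => pB t ^ 2 + qB t ^ 2 - (1 + 2 * α * (m t * uB) + 2 * κ * (m t * uB) ^ 2))
      =O[l] fun t => m t ^ 3)
    (hpA : (fun t => pA t + 1) =O[l] fun t => m t ^ 1) (hqA : qA =O[l] fun t => m t ^ 1)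
    (hpB : (fun t => pB t + 1) =O[l] fun t => m t ^ 1) (hqB : qB =O[l] fun t => m t ^ 1)
    (hH : (fun t => qA t - qB t - α * m t / j t * (cA - cB) - κ * m t ^ 2 * Λ)
      =O[l] fun t => m t ^ 3)
    (e1 : a * Q1A - b * Q1B = h * α * (uB - uA)) (e1' : Q1A - Q1B = α / h * (cA - cB))
    (e2 : a * Q2A - b * Q2B
      = h * ((κ - α ^ 2 / 2) * (uB ^ 2 - uA ^ 2) - (Q1B ^ 2 - Q1A ^ 2) / 2))
    (e2' : Q2A - Q2B = -(α * (a * Q1A + h * α * uA) / h ^ 2) * (cA - cB) + κ * Λ) :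
    ((fun t => qA t - (m t * Q1A + m t ^ 2 * Q2A)) =O[l] fun t => m t ^ 3) ∧
    ((fun t => qB t - (m t * Q1B + m t ^ 2 * Q2B)) =O[l] fun t => m t ^ 3) ∧
    ((fun t => pA t + (1 + α * (m t * uA) + (κ - α ^ 2 / 2) * (m t * uA) ^ 2
      - (m t * Q1A) ^ 2 / 2)) =O[l] fun t => m t ^ 3) ∧
    ((fun t => pB t + (1 + α * (m t * uB) + (κ - α ^ 2 / 2) * (m t * uB) ^ 2
      - (m t * Q1B) ^ 2 / 2)) =O[l] fun t => m t ^ 3) := by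
  have h21 := pow_isBigO_pow_of_tendsto_zero hm (show 1 ≤ 2 by norm_num)
  have h32 := pow_isBigO_pow_of_tendsto_zero hm (show 2 ≤ 3 by norm_num)
  have hm1 : Tendsto (fun t => m t ^ 1) l (𝓝 0) := by simpa using hm
  have M1 : m =O[l] fun t => m t ^ 1 := (isBigO_refl m l).congr_right fun t => by ring
  have M2 : (fun t => m t ^ 2) =O[l] fun t => m t ^ 2 := isBigO_refl _ _
  have xA := longitudinal_expansion hm nA hpA hqA
  have xB := longitudinal_expansion hm nB hpB hqB
  have sqA : (fun t => qA t ^ 2) =O[l] fun t => m t ^ 2 :=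
    (hqA.pow 2).congr_right fun t => by ring
  have sqB : (fun t => qB t ^ 2) =O[l] fun t => m t ^ 2 :=
    (hqB.pow 2).congr_right fun t => by ring
  have yA : (fun t => pA t + 1 + α * (m t * uA)) =O[l] fun t => m t ^ 2 :=
    (((xA.trans h32).sub (M2.const_mul_left ((κ - α ^ 2 / 2) * uA ^ 2))).add
      (sqA.const_mul_left (1 / 2))).congr_left fun t => by ring
  have yB : (fun t => pB t + 1 + α * (m t * uB)) =O[l] fun t => m t ^ 2 :=
    (((xB.trans h32).sub (M2.const_mul_left ((κ - α ^ 2 / 2) * uB ^ 2))).add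
      (sqB.const_mul_left (1 / 2))).congr_left fun t => by ring
  have hj1 : (fun t => j t - h) =O[l] fun t => m t ^ 1 :=
    ((hqA.const_mul_left a).sub (hpA.const_mul_left h)).congr_left fun t => by rw [← jA]; ring
  have hjt : Tendsto j l (𝓝 h) := by
    have := (hj1.trans_tendsto hm1).add_const h
    simpa using this
  have hjne := hjt.eventually_ne hh
  have hji : (fun t => (j t)⁻¹) =O[l] fun _ => (1 : ℝ) := (hjt.inv₀ hh).isBigO_one ℝ
  have hji1 : (fun t => (j t)⁻¹ - h⁻¹) =O[l] fun t => m t ^ 1 := by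
    refine (((hj1.mul hji).const_mul_left (-h⁻¹)).congr_right (g₂ := fun t => m t ^ 1)
      fun t => by ring).congr' ?_ EventuallyEq.rfl
    filter_upwards [hjne] with t ht
    field_simp
    ring
  -- first order
  have d1 : (fun t => a * (qA t - m t * Q1A) - b * (qB t - m t * Q1B)) =O[l]
      fun t => m t ^ 2 := by
    refine ((yA.const_mul_left h).sub (yB.const_mul_left h)).congr_left fun t => ?_
    linear_combination -(jA t) + jB t + m t * e1
  have d2 : (fun t => (qA t - m t * Q1A) - (qB t - m t * Q1B)) =O[l] fun t => m t ^ 2 := by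
    have k1 : (fun t => m t * ((j t)⁻¹ - h⁻¹)) =O[l] fun t => m t ^ 2 :=
      (M1.mul hji1).congr_right fun t => by ring
    refine (((hH.trans h32).add (M2.const_mul_left (κ * Λ))).add
      (k1.const_mul_left (α * (cA - cB)))).congr_left fun t => ?_
    linear_combination m t * e1'
  obtain ⟨f1, f2⟩ := linear_system_isBigO hab d1 d2
  have qsq : ∀ {q : T → ℝ} {Q : ℝ}, q =O[l] (fun t => m t ^ 1) →
      (fun t => q t - m t * Q) =O[l] (fun t => m t ^ 2) →
      (fun t => q t ^ 2 - (m t * Q) ^ 2) =O[l] fun t => m t ^ 3 := by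
    intro q Q hq hd
    have k1 : (fun t => q t + m t * Q) =O[l] fun t => m t ^ 1 :=
      hq.add ((M1.const_mul_left Q).congr_left fun t => by ring)
    have k2 := (hd.mul k1).congr_right (g₂ := fun t => m t ^ 3) fun t => by ring
    exact k2.congr_left fun t => by ring
  have zA := qsq hqA f1
  have zB := qsq hqB f2
  have wA : (fun t => pA t + (1 + α * (m t * uA) + (κ - α ^ 2 / 2) * (m t * uA) ^ 2
      - (m t * Q1A) ^ 2 / 2)) =O[l] fun t => m t ^ 3 :=
    (xA.add (zA.const_mul_left (1 / 2))).congr_left fun t => by ring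
  have wB : (fun t => pB t + (1 + α * (m t * uB) + (κ - α ^ 2 / 2) * (m t * uB) ^ 2
      - (m t * Q1B) ^ 2 / 2)) =O[l] fun t => m t ^ 3 :=
    (xB.add (zB.const_mul_left (1 / 2))).congr_left fun t => by ring
  -- second order
  have hj2 : (fun t => j t - h - m t * (a * Q1A + h * α * uA)) =O[l] fun t => m t ^ 2 :=
    ((f1.const_mul_left a).sub (yA.const_mul_left h)).congr_left fun t => by rw [← jA]; ring
  -- The Hamilton relation contains `m / j`, so the first-order part of `1 / j` enters the
  -- second-order equation `e2'`.
  have hji2 : (fun t => (j t)⁻¹ - h⁻¹ + m t * (a * Q1A + h * α * uA) / h ^ 2) =O[l]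
      fun t => m t ^ 2 := by
    have k1 := (hj2.mul hji).congr_right (g₂ := fun t => m t ^ 2) fun t => by ring
    have k2 := (M1.mul hji1).congr_right (g₂ := fun t => m t ^ 2) fun t => by ring
    refine ((k1.const_mul_left (-h⁻¹)).add
      (k2.const_mul_left (-((a * Q1A + h * α * uA) / h)))).congr' ?_ EventuallyEq.rfl
    filter_upwards [hjne] with t ht
    field_simp
    ring
  have g1 : (fun t => a * (qA t - (m t * Q1A + m t ^ 2 * Q2A))
      - b * (qB t - (m t * Q1B + m t ^ 2 * Q2B))) =O[l] fun t => m t ^ 3 := by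
    refine ((wA.const_mul_left h).sub (wB.const_mul_left h)).congr_left fun t => ?_
    linear_combination -(jA t) + jB t + m t * e1 + m t ^ 2 * e2
  have g2 : (fun t => (qA t - (m t * Q1A + m t ^ 2 * Q2A))
      - (qB t - (m t * Q1B + m t ^ 2 * Q2B))) =O[l] fun t => m t ^ 3 := by
    have k1 := (M1.mul hji2).congr_right (g₂ := fun t => m t ^ 3) fun t => by ring
    refine (hH.add (k1.const_mul_left (α * (cA - cB)))).congr_left fun t => ?_
    linear_combination m t * e1' + m t ^ 2 * e2'
  obtain ⟨r1, r2⟩ := linear_system_isBigO hab g1 g2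
  exact ⟨r1, r2, wA, wB⟩

end Endpoints

/-! ### Second-order direction triples of rays near the segment -/

section Frames

variable {V : Type*} [NormedAddCommGroup V] [InnerProductSpace ℝ V]

namespace CloseRay

variable {O : Medium} {xA xB : V} {ρ : ℝ}

theorem n2_at_isBigO (F : Frame xA xB) (hρ : 0 < ρ) {t : ℝ} (ht : t ∈ Icc (0 : ℝ) 1) {X : V}
    (hX : ∀ c : CloseRay O xA xB ρ, c.x t = X) :
    (fun c : CloseRay O xA xB ρ => F.coord 0 (c.y t) ^ 2 + F.coord 1 (c.y t) ^ 2
      - (1 + 2 * O.α * (c.m * ‖X‖⁻¹) + 2 * O.κ * (c.m * ‖X‖⁻¹) ^ 2))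
      =O[small O xA xB ρ] fun c => c.m ^ 3 := by
  have hn := (isBigO_of_abs_le_u (O := O) (xA := xA) (xB := xB) hρ
    (F := fun u => O.n2 u - (1 + 2 * O.α * u + 2 * O.κ * u ^ 2)) (k := 3) fun u hu h => by
      have h1 := O.n2_bound u hu h
      have h2 := O.one_le_C
      have : 0 ≤ O.C * u ^ 3 := by positivity
      linarith).comp_tendsto (tendsto_pt ht)
  refine hn.congr' ?_ EventuallyEq.rfl
  filter_upwards [eventually_angMom F hρ] with c hc
  have hz := c.coord_two_eq_zero F (by have := F.h_pos; linarith) ht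
  have h1 := c.isRay.norm_sq_y t ht (c.weak t ht)
  rw [F.norm_sq_eq, hz.2, hX] at h1
  simp only [Function.comp, hX]
  rw [← h1, div_eq_mul_inv]
  ring

/-- The direction triples of a ray joining `xB` to `xA`, up to the second order, in terms of the
solution of the end-point equations. -/
theorem exists_bound (O : Medium) (F : Frame xA xB) (hρ : 0 < ρ) {Q1A Q1B Q2A Q2B : ℝ}
    (e1 : F.a * Q1A - F.b * Q1B = F.h * O.α * (‖xB‖⁻¹ - ‖xA‖⁻¹))
    (e1' : Q1A - Q1B = O.α / F.h * (F.a / ‖xA‖ - F.b / ‖xB‖))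
    (e2 : F.a * Q2A - F.b * Q2B = F.h * ((O.κ - O.α ^ 2 / 2) * (‖xB‖⁻¹ ^ 2 - ‖xA‖⁻¹ ^ 2)
      - (Q1B ^ 2 - Q1A ^ 2) / 2))
    (e2' : Q2A - Q2B = -(O.α * (F.a * Q1A + F.h * O.α * ‖xA‖⁻¹) / F.h ^ 2)
      * (F.a / ‖xA‖ - F.b / ‖xB‖) + O.κ * (F.lineIntegral F.a - F.lineIntegral F.b)) :
    ∃ C δ : ℝ, 0 < δ ∧ ∀ c : CloseRay O xA xB ρ, c.m < δ →
      ‖c.y 1 - (-(1 + O.α * (c.m * ‖xA‖⁻¹) + (O.κ - O.α ^ 2 / 2) * (c.m * ‖xA‖⁻¹) ^ 2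
        - (c.m * Q1A) ^ 2 / 2) • F.e 0 + (c.m * Q1A + c.m ^ 2 * Q2A) • F.e 1)‖ ≤ C * c.m ^ 3 ∧
      ‖c.y 0 - (-(1 + O.α * (c.m * ‖xB‖⁻¹) + (O.κ - O.α ^ 2 / 2) * (c.m * ‖xB‖⁻¹) ^ 2
        - (c.m * Q1B) ^ 2 / 2) • F.e 0 + (c.m * Q1B + c.m ^ 2 * Q2B) • F.e 1)‖
        ≤ C * c.m ^ 3 := by
  have m0 : (0 : ℝ) ∈ Icc (0 : ℝ) 1 := ⟨le_rfl, zero_le_one⟩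
  have m1 : (1 : ℝ) ∈ Icc (0 : ℝ) 1 := ⟨zero_le_one, le_rfl⟩
  have hy := coord_y_isBigO (O := O) F hρ
  have hH := hamilton_sub_isBigO (O := O) F hρ
  obtain ⟨r1, r2, r3, r4⟩ := endpoint_expansion (l := small O xA xB ρ) (m := CloseRay.m)
    (pA := fun c => F.coord 0 (c.y 1)) (qA := fun c => F.coord 1 (c.y 1))
    (pB := fun c => F.coord 0 (c.y 0)) (qB := fun c => F.coord 1 (c.y 0))
    (j := fun c => c.angMom F) (a := F.a) (b := F.b) (h := F.h) (α := O.α) (κ := O.κ)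
    (uA := ‖xA‖⁻¹) (uB := ‖xB‖⁻¹) tendsto_m (sub_pos.mpr F.a_lt_b).ne' F.h_pos.ne'
    (fun c => by rw [← c.angMom_eq F m1, c.x_one, F.coord_zero_A, F.coord_one_A])
    (fun c => rfl)
    (n2_at_isBigO F hρ m1 fun c => c.x_one) (n2_at_isBigO F hρ m0 fun c => c.x_zero)
    (hy.1.comp_tendsto (tendsto_pt m1)) (hy.2.comp_tendsto (tendsto_pt m1))
    (hy.1.comp_tendsto (tendsto_pt m0)) (hy.2.comp_tendsto (tendsto_pt m0))
    (hH.congr_left fun c => by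
      simp only [hamilton, c.x_one, c.x_zero, F.coord_zero_A, F.coord_zero_B]
      rw [show F.b - 1 * (F.b - F.a) = F.a by ring, show F.b - 0 * (F.b - F.a) = F.b by ring]
      ring) e1 e1' e2 e2'
  obtain ⟨K1, k1⟩ := r1.bound
  obtain ⟨K2, k2⟩ := r2.bound
  obtain ⟨K3, k3⟩ := r3.bound
  obtain ⟨K4, k4⟩ := r4.bound
  have hall := k1.and (k2.and (k3.and (k4.and (eventually_angMom (O := O) F hρ))))
  -- Unfolding the filter turns the `O`-statements into one pair of constants valid for every ray
  -- with `m < δ`.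
  obtain ⟨s, hs, hsub⟩ := mem_comap.mp hall
  obtain ⟨δ, hδ, hball⟩ := Metric.mem_nhds_iff.mp hs
  refine ⟨max (K3 + K1) (K4 + K2), δ, hδ, fun c hc => ?_⟩
  obtain ⟨b1, b2, b3, b4, bj⟩ := hsub (a := c) (hball (by
    rw [Metric.mem_ball, Real.dist_eq, sub_zero, abs_of_pos c.m_pos]; exact hc))
  have hm3 : 0 ≤ c.m ^ 3 := (pow_pos c.m_pos 3).le
  have hj : c.angMom F ≠ 0 := by have := F.h_pos; linarith
  rw [Real.norm_eq_abs, Real.norm_of_nonneg hm3] at b1 b2 b3 b4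
  have fin : ∀ (v : V) (P Q K K' : ℝ), F.coord 2 v = 0 → |F.coord 0 v + P| ≤ K * c.m ^ 3 →
      |F.coord 1 v - Q| ≤ K' * c.m ^ 3 →
      ‖v - (-P • F.e 0 + Q • F.e 1)‖ ≤ (K + K') * c.m ^ 3 := by
    intro v P Q K K' h2 h0 h1
    refine (F.norm_le_sum _).trans ?_
    simp only [F.coord_sub, F.coord_add, F.coord_smul, F.coord_e, h2]
    simp only [Fin.isValue, if_true, if_false, Fin.reduceEq, mul_one, mul_zero, add_zero,
      zero_add, sub_neg_eq_add, sub_zero, abs_zero]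
    linarith
  constructor
  · refine (fin _ _ _ _ _ (c.coord_two_eq_zero F hj m1).2 b3 b1).trans ?_
    gcongr
    exact le_max_left _ _
  · refine (fin _ _ _ _ _ (c.coord_two_eq_zero F hj m0).2 b4 b2).trans ?_
    gcongr
    exact le_max_right _ _

end CloseRay

end Frames

end

end LightRay

namespace LightRay

noncomputable section

open Filter Topology Set

/-! ### Euclidean geometry of the end points -/

theorem inner_E3 (v w : E3) : inner ℝ v w = v 0 * w 0 + v 1 * w 1 + v 2 * w 2 := by
  rw [PiLp.inner_apply, Fin.sum_univ_three]
  simp [mul_comm]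

theorem cross_apply_zero (v w : E3) : cross v w 0 = v 1 * w 2 - v 2 * w 1 := by
  simp [cross, crossProduct]

theorem cross_apply_one (v w : E3) : cross v w 1 = v 2 * w 0 - v 0 * w 2 := by
  simp [cross, crossProduct]

theorem cross_apply_two (v w : E3) : cross v w 2 = v 0 * w 1 - v 1 * w 0 := by
  simp [cross, crossProduct]

theorem cross_smul_left (k : ℝ) (v w : E3) : cross (k • v) w = k • cross v w := by
  ext i; fin_cases i <;> simp [cross, crossProduct, mul_sub]

theorem cross_smul_right (k : ℝ) (v w : E3) : cross v (k • w) = k • cross v w := by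
  ext i; fin_cases i <;> simp [cross, crossProduct, mul_sub]

theorem inner_left_cross (v w : E3) : inner ℝ v (cross v w) = 0 := by
  rw [inner_E3, cross_apply_zero, cross_apply_one, cross_apply_two]; ring

theorem inner_right_cross (v w : E3) : inner ℝ w (cross v w) = 0 := by
  rw [inner_E3, cross_apply_zero, cross_apply_one, cross_apply_two]; ring

theorem inner_cross_cyclic (u v w : E3) : inner ℝ (cross u v) w = inner ℝ v (cross w u) := by
  simp only [inner_E3, cross_apply_zero, cross_apply_one, cross_apply_two]; ring

theorem norm_cross_sq (v w : E3) :
    ‖cross v w‖ ^ 2 = ‖v‖ ^ 2 * ‖w‖ ^ 2 - (inner ℝ v w) ^ 2 := by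
  simp only [← real_inner_self_eq_norm_sq, inner_E3, cross_apply_zero, cross_apply_one,
    cross_apply_two]
  ring

theorem unitVec_smul {s : ℝ} (hs : 0 < s) (v : E3) : unitVec (s • v) = unitVec v := by
  rw [unitVec, unitVec, norm_smul, Real.norm_of_nonneg hs.le, smul_smul]
  congr 1
  field_simp

theorem norm_unitVec {v : E3} (hv : v ≠ 0) : ‖unitVec v‖ = 1 := by
  rw [unitVec, norm_smul, norm_inv, norm_norm, inv_mul_cancel₀ (norm_ne_zero_iff.mpr hv)]

theorem vecN_smul {s : ℝ} (hs : 0 < s) (v w : E3) : vecN (s • v) (s • w) = vecN v w := by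
  rw [vecN, vecN, ← smul_sub, unitVec_smul hs]

theorem vecP_smul {s : ℝ} (hs : 0 < s) (v w : E3) : vecP (s • v) (s • w) = vecP v w := by
  rw [vecP, vecP, vecN_smul hs, vecQ, vecQ, unitVec_smul hs, unitVec_smul hs]

theorem rc_smul {s : ℝ} (hs : 0 < s) (v w : E3) : rc (s • v) (s • w) = s * rc v w := by
  rw [rc, rc, unitVec_smul hs, unitVec_smul hs, ← smul_sub, norm_smul, norm_smul, norm_smul,
    Real.norm_of_nonneg hs.le]
  by_cases h : ‖w - v‖ = 0
  · simp [h]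
  · field_simp

theorem emissionExpansion_smul (P : Model) (m : ℝ) {s : ℝ} (hs : 0 < s) (v w : E3) :
    emissionExpansion P m (s • v) (s • w) = emissionExpansion P (m / s) v w := by
  simp only [emissionExpansion, unitVec_smul hs, vecN_smul hs, vecP_smul hs, rc_smul hs, div_div]

theorem receptionExpansion_smul (P : Model) (m : ℝ) {s : ℝ} (hs : 0 < s) (v w : E3) :
    receptionExpansion P m (s • v) (s • w) = receptionExpansion P (m / s) v w := by
  simp only [receptionExpansion, unitVec_smul hs, vecN_smul hs, vecP_smul hs, rc_smul hs, div_div]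

section Noncollinear

variable {v w : E3}

theorem left_ne_zero_of_cross (h : cross v w ≠ 0) : v ≠ 0 := by
  rintro rfl
  exact h (by simpa using cross_smul_left 0 0 w)

theorem right_ne_zero_of_cross (h : cross v w ≠ 0) : w ≠ 0 := by
  rintro rfl
  exact h (by simpa using cross_smul_right 0 v 0)

theorem sub_ne_zero_of_cross (h : cross v w ≠ 0) : w - v ≠ 0 := by
  intro e
  rw [sub_eq_zero.mp e] at h
  apply h
  rw [← norm_eq_zero, ← sq_eq_zero_iff, norm_cross_sq, real_inner_self_eq_norm_sq]
  ring

theorem vecQ_eq (h : cross v w ≠ 0) : vecQ v w = ‖cross v w‖⁻¹ • cross v w := by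
  have hv := norm_pos_iff.mpr (left_ne_zero_of_cross h)
  have hw := norm_pos_iff.mpr (right_ne_zero_of_cross h)
  rw [vecQ]
  conv_lhs => rw [unitVec.eq_1 v, unitVec.eq_1 w, cross_smul_left, cross_smul_right, smul_smul]
  rw [unitVec_smul (by positivity), unitVec]

theorem norm_vecN (h : cross v w ≠ 0) : ‖vecN v w‖ = 1 := norm_unitVec (sub_ne_zero_of_cross h)

theorem norm_vecQ (h : cross v w ≠ 0) : ‖vecQ v w‖ = 1 := by
  rw [vecQ_eq h]; exact norm_unitVec h

theorem inner_left_vecQ (h : cross v w ≠ 0) : inner ℝ v (vecQ v w) = 0 := by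
  rw [vecQ_eq h, real_inner_smul_right, inner_left_cross, mul_zero]

theorem inner_right_vecQ (h : cross v w ≠ 0) : inner ℝ w (vecQ v w) = 0 := by
  rw [vecQ_eq h, real_inner_smul_right, inner_right_cross, mul_zero]

theorem inner_vecN_vecQ (h : cross v w ≠ 0) : inner ℝ (vecN v w) (vecQ v w) = 0 := by
  rw [vecN, unitVec, real_inner_smul_left, inner_sub_left, inner_left_vecQ h, inner_right_vecQ h]
  simp

theorem norm_vecP (h : cross v w ≠ 0) : ‖vecP v w‖ = 1 := by
  have := norm_cross_sq (vecN v w) (vecQ v w)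
  rw [norm_vecN h, norm_vecQ h, inner_vecN_vecQ h] at this
  have h2 : ‖vecP v w‖ ^ 2 = 1 := by rw [vecP, this]; ring
  have := norm_nonneg (vecP v w)
  nlinarith

theorem orthonormal_frame (h : cross v w ≠ 0) :
    Orthonormal ℝ ![vecN v w, vecP v w, vecQ v w] := by
  have h1 := inner_vecN_vecQ h
  have h2 : inner ℝ (vecN v w) (vecP v w) = 0 := inner_left_cross _ _
  have h3 : inner ℝ (vecQ v w) (vecP v w) = 0 := inner_right_cross _ _
  refine ⟨fun i => ?_, fun i j hij => ?_⟩
  · fin_cases i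
    exacts [norm_vecN h, norm_vecP h, norm_vecQ h]
  · fin_cases i <;> fin_cases j <;>
      simp [h1, h2, h3, real_inner_comm _ (vecQ v w)] at hij ⊢ <;>
      (rw [real_inner_comm]; assumption)

/-- The orthonormal basis `(𝐍, 𝐏, 𝐐)`. -/
def frameBasis (h : cross v w ≠ 0) : OrthonormalBasis (Fin 3) ℝ E3 :=
  OrthonormalBasis.mk (orthonormal_frame h)
    ((orthonormal_frame h).linearIndependent.span_eq_top_of_card_eq_finrank' (by simp)).ge

theorem frameBasis_zero (h : cross v w ≠ 0) : frameBasis h 0 = vecN v w := by simp [frameBasis]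

theorem frameBasis_one (h : cross v w ≠ 0) : frameBasis h 1 = vecP v w := by simp [frameBasis]

theorem frameBasis_two (h : cross v w ≠ 0) : frameBasis h 2 = vecQ v w := by simp [frameBasis]

theorem rc_eq (h : cross v w ≠ 0) : rc v w = ‖cross v w‖ / ‖w - v‖ := by
  have hv := norm_pos_iff.mpr (left_ne_zero_of_cross h)
  have hw := norm_pos_iff.mpr (right_ne_zero_of_cross h)
  rw [rc, unitVec, unitVec, cross_smul_left, cross_smul_right, norm_smul, norm_smul, norm_inv,
    norm_inv, norm_norm, norm_norm]
  congr 1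
  field_simp

theorem rc_pos (h : cross v w ≠ 0) : 0 < rc v w := by
  rw [rc_eq h]
  exact div_pos (norm_pos_iff.mpr h) (norm_pos_iff.mpr (sub_ne_zero_of_cross h))

/-- By the cyclic symmetry of the triple product this is `|v × w| / |w - v|`, the distance of the
origin from the line through `v` and `w`. -/
theorem inner_vecP_left (h : cross v w ≠ 0) : inner ℝ (vecP v w) v = rc v w := by
  have hc := norm_pos_iff.mpr h
  have e : cross v (w - v) = cross v w := by
    ext i; fin_cases i <;> simp [cross, crossProduct] <;> ring
  rw [vecP, inner_cross_cyclic, vecN, unitVec, cross_smul_right, e, vecQ_eq h,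
    real_inner_smul_left, real_inner_smul_right, real_inner_self_eq_norm_sq, rc_eq h]
  field_simp

theorem inner_vecP_right (h : cross v w ≠ 0) : inner ℝ (vecP v w) w = rc v w := by
  have hR := norm_pos_iff.mpr (sub_ne_zero_of_cross h)
  have h1 : inner ℝ (vecP v w) (vecN v w) = 0 := by
    rw [real_inner_comm]; exact inner_left_cross _ _
  rw [vecN, unitVec, real_inner_smul_right, inner_sub_right, inner_vecP_left h] at h1
  have := (mul_eq_zero.mp h1).resolve_left (inv_pos.mpr hR).ne'
  linarith

/-- The coordinates adapted to two points that are not collinear with the origin. -/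
def adaptedFrame (h : cross v w ≠ 0) : Frame v w where
  e := frameBasis h
  a := inner ℝ (vecN v w) v
  b := inner ℝ (vecN v w) w
  h := rc v w
  a_lt_b := by
    have hR := norm_pos_iff.mpr (sub_ne_zero_of_cross h)
    rw [← sub_pos, ← inner_sub_right, vecN, unitVec, real_inner_smul_left,
      real_inner_self_eq_norm_sq]
    positivity
  h_pos := rc_pos h
  eq_A := by
    have := (frameBasis h).sum_repr' v
    rw [Fin.sum_univ_three, frameBasis_zero, frameBasis_one, frameBasis_two, inner_vecP_left h,
      real_inner_comm v (vecQ v w), inner_left_vecQ h, zero_smul, add_zero] at this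
    rw [frameBasis_zero, frameBasis_one]
    exact this.symm
  eq_B := by
    have := (frameBasis h).sum_repr' w
    rw [Fin.sum_univ_three, frameBasis_zero, frameBasis_one, frameBasis_two, inner_vecP_right h,
      real_inner_comm w (vecQ v w), inner_right_vecQ h, zero_smul, add_zero] at this
    rw [frameBasis_zero, frameBasis_one]
    exact this.symm

end Noncollinear

/-- Seen from the foot of the perpendicular, the end points have polar angles `arctan (a/h)` and
`arctan (b/h)`. This matches the angle in the statement with the arctangents of
`Frame.lineIntegral`. -/
theorem arccos_eq_arctan_sub {a b h rA rB : ℝ} (hab : a < b) (hh : 0 < h) (hrA : 0 < rA)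
    (hrB : 0 < rB) (hA : rA ^ 2 = a ^ 2 + h ^ 2) (hB : rB ^ 2 = b ^ 2 + h ^ 2) :
    Real.arccos ((a * b + h ^ 2) / (rA * rB)) = Real.arctan (b / h) - Real.arctan (a / h) := by
  have sq : ∀ {x r : ℝ}, 0 < r → r ^ 2 = x ^ 2 + h ^ 2 → √(1 + (x / h) ^ 2) = r / h := by
    intro x r hr e
    rw [Real.sqrt_eq_iff_mul_self_eq (by positivity) (by positivity)]
    field_simp
    linarith
  have e : (a * b + h ^ 2) / (rA * rB)
      = Real.cos (Real.arctan (b / h) - Real.arctan (a / h)) := by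
    rw [Real.cos_sub, Real.cos_arctan, Real.cos_arctan, Real.sin_arctan, Real.sin_arctan,
      sq hrA hA, sq hrB hB]
    field_simp
    ring
  rw [e, Real.arccos_cos]
  · have := Real.arctan_strictMono.monotone (div_le_div_of_nonneg_right hab.le hh.le)
    linarith
  · have h1 := Real.arctan_lt_pi_div_two (b / h)
    have h2 := Real.neg_pi_div_two_lt_arctan (a / h)
    linarith

/-- The trigonometric identities behind the end-point equations; `u`, `w` are the inverse
distances of the end points, `G = 1 / (1 + cos Φ)` and `T = tan (Φ / 2)`. -/
theorem endpoint_identities {a b h u w α κ Φ ψ G T : ℝ} (hh : h ≠ 0)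
    (hu : u ^ 2 * (a ^ 2 + h ^ 2) = 1) (hw : w ^ 2 * (b ^ 2 + h ^ 2) = 1)
    (hG : G * (1 + (a * b + h ^ 2) * (u * w)) = 1) (hT : T = h * (b - a) * (u * w) * G)
    (hψ : ψ * (h * (b - a) * (u * w)) = Φ) :
    1 + T ^ 2 = 2 * G ∧
    a * (-(α * u * T)) - b * (α * w * T) = h * α * (w - u) ∧
    -(α * u * T) - α * w * T = α / h * (a * u - b * w) ∧
    a * (-(u / h * (κ * (ψ * (b * w) - a * u) - α ^ 2 * (G * (b * w - a * u)))))
      - b * (-(w / h * (κ * (ψ * (a * u) - b * w) + α ^ 2 * (G * (b * w - a * u)))))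
      = h * ((κ - α ^ 2 / 2) * (w ^ 2 - u ^ 2) - ((α * w * T) ^ 2 - (-(α * u * T)) ^ 2) / 2) ∧
    -(u / h * (κ * (ψ * (b * w) - a * u) - α ^ 2 * (G * (b * w - a * u))))
      - -(w / h * (κ * (ψ * (a * u) - b * w) + α ^ 2 * (G * (b * w - a * u))))
      = -(α * (a * (-(α * u * T)) + h * α * u) / h ^ 2) * (a * u - b * w)
        + κ * ((a * u ^ 2 - b * w ^ 2) / h - Φ / h ^ 2) := by
  -- This is `sin² Φ = 1 - cos² Φ`; with it `t3` becomes `1 + tan² (Φ/2) = 2 / (1 + cos Φ)`.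
  have hS : (h * (b - a) * (u * w)) ^ 2 = 1 - ((a * b + h ^ 2) * (u * w)) ^ 2 := by
    linear_combination (-1 : ℝ) * (-(w ^ 2 * (b ^ 2 + h ^ 2)) * hu) + hw
  have t3 : 1 + T ^ 2 = 2 * G := by
    rw [hT, mul_pow, hS]
    linear_combination (-1 + G * (1 - (a * b + h ^ 2) * (u * w))) * hG
  have t1 : T * (a * u + b * w) = h * (u - w) := by
    rw [hT]
    linear_combination (h * (u - w)) * hG + G * h * (-(w) * hu + u * hw)
  have t2 : h * T * (u + w) = b * w - a * u := by
    rw [hT]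
    linear_combination (b * w - a * u) * hG + G * (b * w * hu - a * u * hw)
  have t4 : G * (u + w) * h = u * (h - a * T) := by
    rw [hT]
    linear_combination (u * h) * hG - G * h * w * hu
  have hhi : h * h⁻¹ = 1 := mul_inv_cancel₀ hh
  refine ⟨t3, ?_, ?_, ?_, ?_⟩
  · linear_combination (-α) * t1
  · field_simp
    linear_combination (-α) * t2
  · simp only [div_eq_mul_inv]
    linear_combination h⁻¹ * (α ^ 2 * G - κ) * (hw - hu)
      - (α ^ 2 * G - κ) * (w ^ 2 - u ^ 2) * h * hhi + h * (w ^ 2 - u ^ 2) * α ^ 2 / 2 * t3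
  · rw [← hψ]
    simp only [div_eq_mul_inv]
    linear_combination α ^ 2 * h⁻¹ ^ 2 * (b * w - a * u) * t4
      - α ^ 2 * h⁻¹ * G * (b * w - a * u) * (u + w) * hhi
      + κ * ψ * (b - a) * u * w * h⁻¹ * hhi

end

end LightRay

namespace LightRay

noncomputable section

open Filter Topology Set

/-! ### The closed formulas in terms of the end points -/

section Expansion

variable {v w : E3}

theorem adaptedFrame_a (h : cross v w ≠ 0) :
    (adaptedFrame h).a = inner ℝ (vecN v w) v := rfl

theorem adaptedFrame_b (h : cross v w ≠ 0) :
    (adaptedFrame h).b = inner ℝ (vecN v w) w := rfl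

theorem adaptedFrame_h (h : cross v w ≠ 0) : (adaptedFrame h).h = rc v w := rfl

theorem adaptedFrame_e_zero (h : cross v w ≠ 0) : (adaptedFrame h).e 0 = vecN v w :=
  frameBasis_zero h

theorem adaptedFrame_e_one (h : cross v w ≠ 0) : (adaptedFrame h).e 1 = vecP v w :=
  frameBasis_one h

theorem inner_unitVec_unitVec (h : cross v w ≠ 0) : inner ℝ (unitVec v) (unitVec w)
    = ((adaptedFrame h).a * (adaptedFrame h).b + (adaptedFrame h).h ^ 2) * (‖v‖⁻¹ * ‖w‖⁻¹) := by
  have e := (adaptedFrame h).inner_eq v w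
  rw [(adaptedFrame h).coord_zero_A, (adaptedFrame h).coord_one_A, (adaptedFrame h).coord_two_A,
    (adaptedFrame h).coord_zero_B, (adaptedFrame h).coord_one_B,
    (adaptedFrame h).coord_two_B] at e
  rw [unitVec, unitVec, real_inner_smul_left, real_inner_smul_right, e]
  ring

theorem norm_cross_unitVec_unitVec (h : cross v w ≠ 0) : ‖cross (unitVec v) (unitVec w)‖
    = (adaptedFrame h).h * ((adaptedFrame h).b - (adaptedFrame h).a) * (‖v‖⁻¹ * ‖w‖⁻¹) := by
  have hv := norm_pos_iff.mpr (left_ne_zero_of_cross h)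
  have hw := norm_pos_iff.mpr (right_ne_zero_of_cross h)
  have hR := norm_pos_iff.mpr (sub_ne_zero_of_cross h)
  rw [← (adaptedFrame h).norm_A_sub_B, adaptedFrame_h, norm_sub_rev, rc]
  field_simp

theorem norm_cross_vecN_unitVec {x : E3} (h : cross v w ≠ 0) {s : ℝ} (hx : x ≠ 0)
    (hs : inner ℝ (vecN v w) x = s) (hn : ‖x‖ ^ 2 = s ^ 2 + (adaptedFrame h).h ^ 2) :
    ‖cross (vecN v w) (unitVec x)‖ = (adaptedFrame h).h * ‖x‖⁻¹ := by
  have hx' := norm_pos_iff.mpr hx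
  have e := norm_cross_sq (vecN v w) (unitVec x)
  rw [norm_vecN h, norm_unitVec hx, unitVec, real_inner_smul_right, hs] at e
  have hp := (adaptedFrame h).h_pos
  have e2 : 1 ^ 2 * 1 ^ 2 - (‖x‖⁻¹ * s) ^ 2 = ((adaptedFrame h).h * ‖x‖⁻¹) ^ 2 := by
    field_simp
    linarith
  rw [e2] at e
  exact (pow_left_inj₀ (norm_nonneg _) (by positivity) two_ne_zero).mp e

theorem one_add_inner_pos (h : cross v w ≠ 0) :
    0 < 1 + inner ℝ (unitVec v) (unitVec w) := by
  have hv := norm_pos_iff.mpr (left_ne_zero_of_cross h)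
  have hw := norm_pos_iff.mpr (right_ne_zero_of_cross h)
  have e := norm_cross_sq (unitVec v) (unitVec w)
  rw [norm_unitVec (left_ne_zero_of_cross h), norm_unitVec (right_ne_zero_of_cross h)] at e
  have hc : 0 < ‖cross (unitVec v) (unitVec w)‖ ^ 2 := by
    rw [unitVec, unitVec, cross_smul_left, cross_smul_right, norm_smul, norm_smul]
    have := norm_pos_iff.mpr h
    have h1 : 0 < ‖‖v‖⁻¹‖ := norm_pos_iff.mpr (inv_pos.mpr hv).ne'
    have h2 : 0 < ‖‖w‖⁻¹‖ := norm_pos_iff.mpr (inv_pos.mpr hw).ne'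
    positivity
  nlinarith

/-- The expansions hold uniformly for rays keeping away from the central mass. -/
theorem closeRay_expansion (P : Model) (O : Medium) (hα : O.α = 1 + P.γ) (hκ : O.κ = P.κ)
    (h : cross v w ≠ 0) {ρ : ℝ} (hρ : 0 < ρ) :
    ∃ C δ : ℝ, 0 < δ ∧ ∀ c : CloseRay O v w ρ, c.m < δ →
      ‖c.y 1 - emissionExpansion P c.m v w‖ ≤ C * c.m ^ 3 ∧
      ‖c.y 0 - receptionExpansion P c.m v w‖ ≤ C * c.m ^ 3 := by
  set F := adaptedFrame h with hF
  have hv := norm_pos_iff.mpr (left_ne_zero_of_cross h)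
  have hw := norm_pos_iff.mpr (right_ne_zero_of_cross h)
  have hh := F.h_pos
  have hab := sub_pos.mpr F.a_lt_b
  have nA := F.norm_sq_A
  have nB := F.norm_sq_B
  have eμ := inner_unitVec_unitVec h
  have eS := norm_cross_unitVec_unitVec h
  have esA := norm_cross_vecN_unitVec h (left_ne_zero_of_cross h) (adaptedFrame_a h).symm nA
  have esB := norm_cross_vecN_unitVec h (right_ne_zero_of_cross h) (adaptedFrame_b h).symm nB
  rw [← hF] at eμ eS esA esB
  have ecA : inner ℝ (vecN v w) (unitVec v) = F.a * ‖v‖⁻¹ := by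
    rw [unitVec, real_inner_smul_right, mul_comm]; rfl
  have ecB : inner ℝ (vecN v w) (unitVec w) = F.b * ‖w‖⁻¹ := by
    rw [unitVec, real_inner_smul_right, mul_comm]; rfl
  have hμ := one_add_inner_pos h
  set μ : ℝ := inner ℝ (unitVec v) (unitVec w) with hμd
  set S : ℝ := ‖cross (unitVec v) (unitVec w)‖ with hS
  have hS0 : S ≠ 0 := by rw [eS]; positivity
  set u : ℝ := ‖v‖⁻¹ with hu
  set z : ℝ := ‖w‖⁻¹ with hz
  set G : ℝ := (1 + μ)⁻¹ with hG
  have eΦ : Real.arccos μ = Real.arctan (F.b / F.h) - Real.arctan (F.a / F.h) := by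
    rw [← arccos_eq_arctan_sub F.a_lt_b hh hv hw nA nB, eμ]
    congr 1
    rw [hu, hz]
    field_simp
  -- The first-order transverse components are `∓ α tan (Φ/2) / r` at the two ends. The second-order
  -- ones are read off the claimed formulas, and these identities verify that they solve the
  -- end-point equations.
  obtain ⟨t3, e1, e1', e2, e2'⟩ := endpoint_identities (a := F.a) (b := F.b) (h := F.h) (u := u)
    (w := z) (α := O.α) (κ := O.κ) (Φ := Real.arccos μ) (ψ := Real.arccos μ / S) (G := G)
    (T := S / (1 + μ)) hh.ne' (by rw [← nA, hu]; field_simp) (by rw [← nB, hz]; field_simp)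
    (by rw [← eμ, hG]; field_simp) (by rw [← eS, hG, div_eq_mul_inv])
    (by rw [← eS]; field_simp)
  have eL : (F.a * u ^ 2 - F.b * z ^ 2) / F.h - Real.arccos μ / F.h ^ 2
      = F.lineIntegral F.a - F.lineIntegral F.b := by
    rw [Frame.lineIntegral, Frame.lineIntegral, eΦ, hu, hz, inv_pow, inv_pow, nA, nB,
      add_comm (F.a ^ 2), add_comm (F.b ^ 2)]
    field_simp
    ring
  rw [eL] at e2'
  obtain ⟨C, δ, hδ, H⟩ := CloseRay.exists_bound O F hρ e1
    (e1'.trans (by rw [div_eq_mul_inv F.a, div_eq_mul_inv F.b])) e2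
    (e2'.trans (by rw [div_eq_mul_inv F.a, div_eq_mul_inv F.b]))
  refine ⟨C, δ, hδ, fun c hc => ?_⟩
  obtain ⟨hA, hB⟩ := H c hc
  have eN : F.e 0 = vecN v w := adaptedFrame_e_zero h
  have eP : F.e 1 = vecP v w := adaptedFrame_e_one h
  have hq : ∀ k : ℝ, c.m / rc v w * (F.h * k) = c.m * k := fun k => by
    change c.m / F.h * (F.h * k) = c.m * k
    field_simp
  constructor
  · refine le_of_eq_of_le (congrArg (fun X => ‖c.y 1 - X‖) ?_) hA
    simp only [emissionExpansion, ← hμd, ← hS, esA, ecA, ecB, hq, eN, eP]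
    rw [← hα, ← hκ]
    have eh : rc v w = F.h := rfl
    rw [eh]
    -- The terms `-α²/2` and `-α² tan² (Φ/2) / 2` combine by the half-angle identity into `-α² / (1
    -- + cos Φ)`.
    have : (1 + O.α * (c.m * u) + (O.κ - O.α ^ 2 / 2) * (c.m * u) ^ 2
        - (c.m * -(O.α * u * (S / (1 + μ)))) ^ 2 / 2)
        = 1 + c.m * u * (O.α + c.m * u * (O.κ - O.α ^ 2 / (1 + μ))) := by
      rw [div_eq_mul_inv (O.α ^ 2) (1 + μ), ← hG]
      linear_combination (-(O.α ^ 2 * (c.m * u) ^ 2 / 2)) * t3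
    rw [this, div_eq_mul_inv (F.b * z - F.a * u) (1 + μ), ← hG]
    module
  · refine le_of_eq_of_le (congrArg (fun X => ‖c.y 0 - X‖) ?_) hB
    simp only [receptionExpansion, ← hμd, ← hS, esB, ecA, ecB, hq, eN, eP]
    rw [← hα, ← hκ]
    have eh : rc v w = F.h := rfl
    rw [eh]
    have : (1 + O.α * (c.m * z) + (O.κ - O.α ^ 2 / 2) * (c.m * z) ^ 2
        - (c.m * (O.α * z * (S / (1 + μ)))) ^ 2 / 2)
        = 1 + c.m * z * (O.α + c.m * z * (O.κ - O.α ^ 2 / (1 + μ))) := by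
      rw [div_eq_mul_inv (O.α ^ 2) (1 + μ), ← hG]
      linear_combination (-(O.α ^ 2 * (c.m * z) ^ 2 / 2)) * t3
    rw [this, div_eq_mul_inv (F.b * z - F.a * u) (1 + μ), ← hG]
    module

end Expansion

end

end LightRay

namespace LightRay

noncomputable section

open Filter Topology Set

/-! ### Null geodesics as light rays in an optical medium -/

/-- The function is constant along the time direction. No regularity of `φ` is needed, because
`fderiv` is zero where the derivative does not exist. -/
theorem fderiv_comp_snd_apply_fst {φ : E3 → ℝ} (p : Event) (k : ℝ) :
    fderiv ℝ (fun q : Event => φ q.2) p (k, 0) = 0 := by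
  by_cases h : DifferentiableAt ℝ (fun q : Event => φ q.2) p
  · rw [← h.lineDeriv_eq_fderiv]
    simp [lineDeriv]
  · rw [fderiv_zero_of_not_differentiableAt h]; rfl

theorem fderiv_comp_norm_snd_apply {B : ℝ → ℝ} {B' m : ℝ} {p : Event} (hp : p.2 ≠ 0)
    (hB : HasDerivAt B B' (m / ‖p.2‖)) (w : E3) :
    fderiv ℝ (fun q : Event => B (m / ‖q.2‖)) p (0, w)
      = B' * (-(m / ‖p.2‖ ^ 3)) * inner ℝ p.2 w := by
  have hr := norm_pos_iff.mpr hp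
  have h1 : HasFDerivAt (fun q : Event => ‖q.2‖ ^ 2) _ p := hasFDerivAt_snd.norm_sq
  have h2 := h1.sqrt (by positivity)
  simp only [Real.sqrt_sq (norm_nonneg _)] at h2
  have h3 : HasDerivAt (fun r : ℝ => m / r) (m * -(‖p.2‖ ^ 2)⁻¹) ‖p.2‖ := by
    simpa [div_eq_mul_inv] using (hasDerivAt_inv hr.ne').const_mul m
  have h4 : HasDerivAt (fun r : ℝ => B (m / r)) (B' * (m * -(‖p.2‖ ^ 2)⁻¹)) ‖p.2‖ :=
    hB.comp ‖p.2‖ h3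
  have h5 := (h4.comp_hasFDerivAt p h2).fderiv
  change fderiv ℝ (fun q : Event => B (m / ‖q.2‖)) p = _ at h5
  rw [h5]
  simp
  field_simp

theorem hasDerivAt_powSum {c : ℕ → ℝ} {u₁ u : ℝ} (hu : |u| < u₁)
    (hc : Summable fun n => c n * u₁ ^ n) :
    HasDerivAt (powSum c) (deriv (powSum c) u) u :=
  (powSum_analyticAt hu hc).differentiableAt.hasDerivAt

namespace Model

variable (P : Model)

theorem metric_apply (m : ℝ) (p V W : Event) : P.metric m p V W
    = powSum P.a (m / ‖p.2‖) * (V.1 * W.1) - powSum P.d (m / ‖p.2‖) * inner ℝ V.2 W.2 := by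
  rw [metric, potA, potB, inv_inv]; rfl

end Model

section Geodesic

variable {P : Model} {m : ℝ} {x : ℝ → Event}

/-- The covariant time component of the tangent vector. -/
def energy (P : Model) (m : ℝ) (x : ℝ → Event) (t : ℝ) : ℝ :=
  powSum P.a (m / ‖(x t).2‖) * (velocity x t).1

theorem directionTriple_eq (t : ℝ) : directionTriple (P.metric m) x t
    = (-(powSum P.d (m / ‖(x t).2‖) / energy P m x t)) • (velocity x t).2 := by
  ext i
  simp only [directionTriple, Model.metric_apply, energy, PiLp.smul_apply, smul_eq_mul]
  rw [EuclideanSpace.inner_single_right]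
  simp
  ring

theorem hasDerivWithinAt_velocity (hx : IsNullGeodesic (P.metric m) x) {t : ℝ}
    (ht : t ∈ Icc (0 : ℝ) 1) : HasDerivWithinAt x (velocity x t) (Icc 0 1) t :=
  (hx.differentiable t ht).hasDerivWithinAt

theorem hasDerivWithinAt_snd (hx : IsNullGeodesic (P.metric m) x) {t : ℝ}
    (ht : t ∈ Icc (0 : ℝ) 1) :
    HasDerivWithinAt (fun t => (x t).2) (velocity x t).2 (Icc 0 1) t :=
  (ContinuousLinearMap.snd ℝ ℝ E3).hasFDerivAt.comp_hasDerivWithinAt t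
    (hasDerivWithinAt_velocity hx ht)

theorem hasDerivWithinAt_fst (hx : IsNullGeodesic (P.metric m) x) {t : ℝ}
    (ht : t ∈ Icc (0 : ℝ) 1) :
    HasDerivWithinAt (fun t => (x t).1) (velocity x t).1 (Icc 0 1) t :=
  (ContinuousLinearMap.fst ℝ ℝ E3).hasFDerivAt.comp_hasDerivWithinAt t
    (hasDerivWithinAt_velocity hx ht)

/-- The metric is static, so the geodesic equation contracted with the time direction has a
vanishing right-hand side. -/
theorem energy_eq (hx : IsNullGeodesic (P.metric m) x) {t : ℝ} (ht : t ∈ Icc (0 : ℝ) 1) :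
    energy P m x t = energy P m x 0 := by
  have hE : energy P m x = fun s => P.metric m (x s) (velocity x s) (1, 0) := by
    funext s
    simp [energy, Model.metric_apply]
  have := norm_image_sub_le_of_norm_deriv_le_segment' (C := 0) (a := 0) (b := 1)
    (f := energy P m x) (f' := fun _ => 0) (fun s hs => by
      have h1 := hx.geodesic s hs (1, 0)
      rw [hE]
      refine h1.congr_deriv ?_
      have h2 := fderiv_comp_snd_apply_fst
        (φ := fun q => P.metric m (0, q) (velocity x s) (velocity x s)) (x s) 1
      exact mul_eq_zero_of_right _ h2) (by simp) t ht
  rw [zero_mul, norm_le_zero_iff, sub_eq_zero] at this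
  exact this

theorem null_eq (hx : IsNullGeodesic (P.metric m) x) {t : ℝ} (ht : t ∈ Icc (0 : ℝ) 1) :
    powSum P.a (m / ‖(x t).2‖) * (velocity x t).1 ^ 2
      = powSum P.d (m / ‖(x t).2‖) * ‖(velocity x t).2‖ ^ 2 := by
  have := hx.null t ht
  rw [Model.metric_apply, real_inner_self_eq_norm_sq] at this
  linarith

/-- A null vector without time component has no spatial part either, as the spatial potential is
positive; but the tangent vector does not vanish. -/
theorem velocity_fst_ne_zero (hm : 0 < m) (hx : IsNullGeodesic (P.metric m) x) {t : ℝ}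
    (ht : t ∈ Icc (0 : ℝ) 1) (hr : P.horizonRadius m < ‖(x t).2‖) : (velocity x t).1 ≠ 0 := by
  intro h
  have h1 := null_eq hx ht
  have hd : 0 < powSum P.d (m / ‖(x t).2‖) := P.d_pos m _ hm hr
  rw [h] at h1
  have h2 : ‖(velocity x t).2‖ ^ 2 = 0 := by
    have : powSum P.d (m / ‖(x t).2‖) * ‖(velocity x t).2‖ ^ 2 = 0 := by rw [← h1]; ring
    exact (mul_eq_zero.mp this).resolve_left hd.ne'
  have h3 : (velocity x t).2 = 0 := by simpa using h2
  exact hx.velocity_ne_zero t ht (Prod.ext h h3)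

theorem exists_velocity_fst_eq (hx : IsNullGeodesic (P.metric m) x) :
    ∃ t ∈ Icc (0 : ℝ) 1, (velocity x t).1 = (x 1).1 - (x 0).1 := by
  obtain ⟨t, ht, e⟩ := exists_hasDerivAt_eq_slope (fun t => (x t).1)
    (fun t => (velocity x t).1) zero_lt_one
    (fun t ht => (hasDerivWithinAt_fst hx ht).continuousWithinAt)
    (fun t ht => (hasDerivWithinAt_fst hx (Ioo_subset_Icc_self ht)).hasDerivAt
      (Icc_mem_nhds ht.1 ht.2))
  exact ⟨t, Ioo_subset_Icc_self ht, by simpa using e⟩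

/-- A null geodesic outside of the horizon radius, traversed towards the past, is a light ray
of the optical medium of the model. -/
theorem IsNullGeodesic.isRay (hx : IsNullGeodesic (P.metric m) x) (hm : 0 < m) {O : Medium}
    (hD : O.D = powSum P.d) (hn2 : O.n2 = fun u => powSum P.d u / powSum P.a u)
    (hf : O.f = fun u => deriv (fun u => powSum P.d u / powSum P.a u) u / 2)
    (hu0 : O.u0 < 1 / (2 * P.η)) (hr : ∀ t ∈ Icc (0 : ℝ) 1, P.horizonRadius m < ‖(x t).2‖)
    (hpast : (x 1).1 < (x 0).1) :
    IsRay O m (-energy P m x 0) (fun t => (x t).2) (directionTriple (P.metric m) x) := by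
  have hA : ∀ t ∈ Icc (0 : ℝ) 1, 0 < powSum P.a (m / ‖(x t).2‖) := fun t ht =>
    P.a_pos m _ hm (hr t ht)
  have hDp : ∀ t ∈ Icc (0 : ℝ) 1, 0 < powSum P.d (m / ‖(x t).2‖) := fun t ht =>
    P.d_pos m _ hm (hr t ht)
  have hE : energy P m x 0 < 0 := by
    obtain ⟨t, ht, e⟩ := exists_velocity_fst_eq hx
    rw [← energy_eq hx ht, energy, e]
    exact mul_neg_of_pos_of_neg (hA t ht) (by linarith)
  have hne : ∀ t ∈ Icc (0 : ℝ) 1, (x t).2 ≠ 0 := fun t ht h => by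
    have := hr t ht
    rw [h, norm_zero, Model.horizonRadius] at this
    have := mul_pos P.η_pos hm
    linarith
  refine ⟨hm, by linarith, fun t ht => (hasDerivWithinAt_snd hx ht).continuousWithinAt, hne,
    fun t ht hu => ?_, fun t ht hu => ?_, fun t ht hu => ?_⟩
  · refine (hasDerivWithinAt_snd hx ht).congr_deriv ?_
    rw [directionTriple_eq, energy_eq hx ht, hD, smul_smul]
    have h1 := (hDp t ht).ne'
    have h2 := hE.ne
    rw [show -energy P m x 0 / powSum P.d (m / ‖(x t).2‖)
      * -(powSum P.d (m / ‖(x t).2‖) / energy P m x 0) = 1 by field_simp, one_smul]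
  -- With the energy constant, the triple consists of the covariant components over a fixed number.
  -- The geodesic equation differentiates these directly, so no second derivative of the curve is
  -- needed.
  · have hsum : ∀ s ∈ Icc (0 : ℝ) 1, directionTriple (P.metric m) x s
        = ∑ i : Fin 3, (P.metric m (x s) (velocity x s) (0, EuclideanSpace.single i 1)
          / energy P m x 0) • EuclideanSpace.single i (1 : ℝ) := by
      intro s hs
      rw [directionTriple_eq, energy_eq hx hs]
      ext i
      simp only [Model.metric_apply, PiLp.smul_apply, smul_eq_mul, Fin.sum_univ_three,
        PiLp.add_apply, EuclideanSpace.inner_single_right]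
      fin_cases i <;> simp <;> ring
    have hder : HasDerivWithinAt (fun s => ∑ i : Fin 3,
        (P.metric m (x s) (velocity x s) (0, EuclideanSpace.single i 1)
          / energy P m x 0) • EuclideanSpace.single i (1 : ℝ))
        (∑ i : Fin 3, (1 / 2 * fderiv ℝ (fun p => P.metric m p (velocity x t) (velocity x t))
          (x t) (0, EuclideanSpace.single i 1) / energy P m x 0)
            • EuclideanSpace.single i (1 : ℝ)) (Icc 0 1) t :=
      HasDerivWithinAt.fun_sum fun i _ =>
        ((hx.geodesic t ht (0, EuclideanSpace.single i 1)).div_const _).smul_const _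
    refine (hder.congr_of_mem hsum ht).congr_deriv ?_
    set V := velocity x t with hV
    set u : ℝ := m / ‖(x t).2‖ with hu'
    have hup : 0 < u := div_pos hm (norm_pos_iff.mpr (hne t ht))
    have hul : |u| < 1 / (2 * P.η) := by rw [abs_of_pos hup]; linarith
    have dA := hasDerivAt_powSum hul P.summable_a_div_two
    have dD := hasDerivAt_powSum hul P.summable_d_div_two
    have hfd : ∀ w : E3, fderiv ℝ (fun p => P.metric m p V V) (x t) (0, w)
        = (deriv (powSum P.a) u * V.1 ^ 2 - deriv (powSum P.d) u * ‖V.2‖ ^ 2)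
          * (-(m / ‖(x t).2‖ ^ 3)) * inner ℝ (x t).2 w := by
      intro w
      have h2 : (fun p : Event => P.metric m p V V) = fun p : Event =>
          (fun u => powSum P.a u * V.1 ^ 2 - powSum P.d u * ‖V.2‖ ^ 2) (m / ‖p.2‖) := by
        funext p
        rw [Model.metric_apply, real_inner_self_eq_norm_sq]
        simp only
        ring
      rw [h2]
      exact fderiv_comp_norm_snd_apply (hne t ht)
        ((dA.mul_const (V.1 ^ 2)).sub (dD.mul_const (‖V.2‖ ^ 2))) w
    have hfu : O.f u = (deriv (powSum P.d) u * powSum P.a u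
        - powSum P.d u * deriv (powSum P.a) u) / powSum P.a u ^ 2 / 2 := by
      rw [hf]
      simp only
      have := (dD.div dA (hA t ht).ne').deriv
      rw [show deriv (fun u => powSum P.d u / powSum P.a u) u
        = deriv (powSum P.d / powSum P.a) u from rfl, this]
    have hnull := null_eq hx ht
    have hEt := energy_eq hx ht
    rw [energy, ← hu', ← hV] at hEt
    rw [← hu', ← hV] at hnull
    have a0 := (hA t ht).ne'
    have d0 := (hDp t ht).ne'
    rw [← hu'] at a0 d0
    have v0 : V.1 ≠ 0 := velocity_fst_ne_zero hm hx ht (hr t ht)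
    -- Nullness eliminates the spatial speed, which turns the separate derivatives of the two
    -- potentials into the derivative of their quotient `n²`.
    have hV2 : ‖V.2‖ ^ 2 = powSum P.a u * V.1 ^ 2 / powSum P.d u := by
      rw [eq_div_iff d0]; linarith
    have hr0 := (norm_pos_iff.mpr (hne t ht)).ne'
    have key : 1 / 2 * ((deriv (powSum P.a) u * V.1 ^ 2 - deriv (powSum P.d) u * ‖V.2‖ ^ 2)
        * (-(m / ‖(x t).2‖ ^ 3))) / energy P m x 0
        = -(-energy P m x 0 / O.D u * O.f u * (m / ‖(x t).2‖ ^ 3)) := by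
      rw [hfu, hD, hV2, ← hEt]
      field_simp
      ring
    rw [← key]
    ext i
    simp only [hfd, Fin.sum_univ_three, PiLp.add_apply, PiLp.smul_apply, smul_eq_mul,
      EuclideanSpace.inner_single_right]
    fin_cases i <;> simp <;> ring
  · rw [directionTriple_eq, energy_eq hx ht, norm_smul, mul_pow, hn2, norm_neg, Real.norm_eq_abs,
      sq_abs]
    have hnull := null_eq hx ht
    have hEt := energy_eq hx ht
    rw [energy] at hEt
    have a0 := (hA t ht).ne'
    have d0 := (hDp t ht).ne'
    have v0 := velocity_fst_ne_zero hm hx ht (hr t ht)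
    rw [← hEt]
    field_simp
    linarith

/-- The medium sees only `m / r`, so shrinking lengths and mass by the same factor preserves rays,
with the same direction triple. This is why constants can depend on the shape alone. -/
theorem IsRay.scale {V : Type*} [NormedAddCommGroup V] [InnerProductSpace ℝ V] {O : Medium}
    {m E s : ℝ} {x y : ℝ → V} (h : IsRay O m E x y) (hs : 0 < s) :
    IsRay O (m / s) (E / s) (fun t => s⁻¹ • x t) y := by
  have e : ∀ t, m / s / ‖s⁻¹ • x t‖ = m / ‖x t‖ := fun t => by
    rw [norm_smul, norm_inv, Real.norm_of_nonneg hs.le]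
    field_simp
  refine ⟨div_pos h.m_pos hs, div_pos h.E_pos hs, h.continuousOn.const_smul _,
    fun t ht => smul_ne_zero (inv_pos.mpr hs).ne' (h.ne_zero t ht), fun t ht hu => ?_,
    fun t ht hu => ?_, fun t ht hu => ?_⟩
  · rw [e] at hu ⊢
    refine ((h.deriv_x t ht hu).const_smul s⁻¹).congr_deriv ?_
    rw [smul_smul]
    congr 1
    field_simp
  · rw [e] at hu ⊢
    refine (h.deriv_y t ht hu).congr_deriv ?_
    rw [smul_smul, norm_smul, norm_inv, Real.norm_of_nonneg hs.le]
    congr 1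
    field_simp
  · rw [e] at hu ⊢
    exact h.norm_sq_y t ht hu

end Geodesic

end

end LightRay

namespace LightRay

noncomputable section

open Filter Topology Set

/-! ### Continuation in the expansion parameter -/

/-- The terms at the larger value `g₂` are bounded, which gives a geometric majorant on `[0, g₁]`.
Continuity includes `0`, the Minkowskian limit. -/
theorem continuousOn_tsum_pow_smul {W : Type*} [NormedAddCommGroup W] [NormedSpace ℝ W]
    [CompleteSpace W] {c : ℕ → W} {g₁ g₂ : ℝ} (h0 : 0 < g₁) (h12 : g₁ < g₂)
    (hc : Summable fun n : ℕ => g₂ ^ (n + 1) • c n) :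
    ContinuousOn (fun g : ℝ => ∑' n : ℕ, g ^ (n + 1) • c n) (Icc 0 g₁) := by
  have h2 : 0 < g₂ := h0.trans h12
  obtain ⟨K, hK⟩ := hc.tendsto_atTop_zero.norm.bddAbove_range
  have hK' : ∀ n : ℕ, ‖g₂ ^ (n + 1) • c n‖ ≤ K := fun n => hK ⟨n, rfl⟩
  have hK0 : 0 ≤ K := (norm_nonneg _).trans (hK' 0)
  have hq : g₁ / g₂ < 1 := (div_lt_one h2).mpr h12
  have hq0 : 0 ≤ g₁ / g₂ := by positivity
  refine continuousOn_tsum (u := fun n : ℕ => K * (g₁ / g₂) ^ (n + 1)) (fun n => by fun_prop)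
    (((summable_nat_add_iff 1).mpr (summable_geometric_of_lt_one hq0 hq)).mul_left K)
    fun n g hg => ?_
  have e : g ^ (n + 1) • c n = (g / g₂) ^ (n + 1) • (g₂ ^ (n + 1) • c n) := by
    rw [smul_smul, div_pow]
    congr 1
    field_simp
  rw [e, norm_smul, norm_pow, Real.norm_of_nonneg (div_nonneg hg.1 h2.le), mul_comm K]
  have := div_nonneg hg.1 h2.le
  have h3 : g / g₂ ≤ g₁ / g₂ := div_le_div_of_nonneg_right hg.2 h2.le
  have := norm_nonneg (g₂ ^ (n + 1) • c n)
  gcongr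
  exact hK' n

theorem norm_cross_le (v w : E3) : ‖cross v w‖ ≤ ‖v‖ * ‖w‖ := by
  refine abs_le_of_sq_le_sq' ?_ (by positivity) |>.2
  rw [norm_cross_sq]
  nlinarith [sq_nonneg (inner ℝ v w)]

theorem cross_swap (v w : E3) : cross w v = -cross v w := by
  ext i; fin_cases i <;> simp [cross, crossProduct, mul_comm]

/-- The mid-point of a segment has a definite distance from the line joining the origin to one of
its ends. -/
theorem norm_cross_div_le_norm_midpoint_sub {v : E3} (hv : v ≠ 0) (w : E3) (θ : ℝ) :
    ‖cross v w‖ / (2 * ‖v‖) ≤ ‖(1 / 2 : ℝ) • (v + w) - θ • v‖ := by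
  have hv' := norm_pos_iff.mpr hv
  have e : cross ((1 / 2 : ℝ) • (v + w) - θ • v) v = (-(1 / 2) : ℝ) • cross v w := by
    ext i; fin_cases i <;> simp [cross, crossProduct] <;> ring
  have h := norm_cross_le ((1 / 2 : ℝ) • (v + w) - θ • v) v
  rw [e, norm_smul, Real.norm_eq_abs, abs_neg, abs_of_pos (by norm_num : (0 : ℝ) < 1 / 2)] at h
  rw [div_le_iff₀ (by positivity)]
  linarith

section QuasiMinkowskian

variable {P : Model} {M c Gmax x0B : ℝ} {xA xB : E3} {Γ : ℝ → ℝ → Event}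

theorem IsQuasiMinkowskian.isNullGeodesic (h : IsQuasiMinkowskian P M c Gmax xA xB x0B Γ)
    {G : ℝ} (hG : G ∈ Ioo 0 Gmax) :
    IsNullGeodesic (P.metric (massLength G M c)) (Γ G) ∧
      ∀ t ∈ Icc (0 : ℝ) 1, P.horizonRadius (massLength G M c) < ‖(Γ G t).2‖ := by
  obtain ⟨X0, X, -, -, hΓ⟩ := h
  exact ⟨(hΓ G hG).1, fun t ht => ((hΓ G hG).2 t ht).1⟩

theorem IsQuasiMinkowskian.endpoints (h : IsQuasiMinkowskian P M c Gmax xA xB x0B Γ) {G : ℝ}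
    (hG : G ∈ Ioo 0 Gmax) : (Γ G 0).2 = xB ∧ (Γ G 1).2 = xA := by
  obtain ⟨X0, X, -, hX, hΓ⟩ := h
  obtain ⟨-, hs⟩ := hΓ G hG
  constructor
  · have h1 := (hs 0 ⟨le_rfl, zero_le_one⟩).2.2
    have h2 : (fun n : ℕ => G ^ (n + 1) • X (n + 1) 0) = fun _ => 0 := by
      funext n; rw [(hX (n + 1) (by omega)).1, smul_zero]
    rw [h2] at h1
    have := h1.unique hasSum_zero
    simpa [sub_eq_zero] using this
  · have h1 := (hs 1 ⟨zero_le_one, le_rfl⟩).2.2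
    have h2 : (fun n : ℕ => G ^ (n + 1) • X (n + 1) 1) = fun _ => 0 := by
      funext n; rw [(hX (n + 1) (by omega)).2, smul_zero]
    rw [h2] at h1
    have := h1.unique hasSum_zero
    simpa [sub_eq_zero] using this

/-- A quasi-Minkowskian ray is traversed towards the past. -/
theorem IsQuasiMinkowskian.past (h : IsQuasiMinkowskian P M c Gmax xA xB x0B Γ) (hM : 0 < M)
    (hc : 0 < c) (hAB : xB - xA ≠ 0) {G : ℝ} (hG : G ∈ Ioo 0 Gmax) :
    (Γ G 1).1 < (Γ G 0).1 := by
  obtain ⟨X0, X, hX0, hX, hΓ⟩ := h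
  have m0 : (0 : ℝ) ∈ Icc (0 : ℝ) 1 := ⟨le_rfl, zero_le_one⟩
  have m1 : (1 : ℝ) ∈ Icc (0 : ℝ) 1 := ⟨zero_le_one, le_rfl⟩
  set τ : ℝ → ℝ := fun g => (∑' n : ℕ, g ^ (n + 1) • X0 (n + 1) 1) - ‖xB - xA‖ with hτ
  have hval : ∀ g ∈ Ioo 0 Gmax, (Γ g 1).1 - (Γ g 0).1 = τ g := by
    intro g hg
    obtain ⟨-, hs⟩ := hΓ g hg
    have h1 := (hs 0 m0).2.1
    have h2 : (fun n : ℕ => g ^ (n + 1) * X0 (n + 1) 0) = fun _ => 0 := by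
      funext n; rw [hX0 (n + 1) (by omega), mul_zero]
    rw [h2] at h1
    have h3 := h1.unique hasSum_zero
    have h4 := (hs 1 m1).2.1.tsum_eq
    simp only [hτ, smul_eq_mul]
    rw [h4]
    linarith
  -- If the total lapse of `x⁰` vanished, the mean value theorem would give a point where the time
  -- component of the tangent vanishes. Being negative at `g = 0` and continuous, `τ` then keeps its
  -- sign.
  have hne : ∀ g ∈ Ioo 0 Gmax, τ g ≠ 0 := by
    intro g hg h0
    obtain ⟨hgeo, hs⟩ := hΓ g hg
    obtain ⟨t, ht, e⟩ := exists_velocity_fst_eq hgeo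
    have hm : 0 < massLength g M c := by
      have := hg.1
      unfold massLength
      positivity
    exact velocity_fst_ne_zero hm hgeo ht (hs t ht).1 (by rw [e, hval g hg, h0])
  -- A value beyond `G` at which the series still converges, as continuity up to `G` requires.
  have hmid : (G + Gmax) / 2 ∈ Ioo 0 Gmax := ⟨by linarith [hG.1, hG.2], by linarith [hG.2]⟩
  have hcont : ContinuousOn τ (Icc 0 G) :=
    (continuousOn_tsum_pow_smul hG.1 (show G < (G + Gmax) / 2 by linarith [hG.2])
      (by simpa only [smul_eq_mul] using ((hΓ _ hmid).2 1 m1).2.1.summable)).sub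
      continuousOn_const
  have hτ0 : τ 0 < 0 := by
    simp only [hτ, zero_pow (Nat.succ_ne_zero _), zero_smul, tsum_zero, zero_sub, neg_neg_iff_pos]
    exact norm_pos_iff.mpr hAB
  by_contra hcon
  have hG0 : 0 ≤ τ G := by rw [← hval G hG]; linarith
  obtain ⟨g, hg, e⟩ := intermediate_value_Icc hG.1.le hcont ⟨hτ0.le, hG0⟩
  rcases hg.1.eq_or_lt with h0 | h0
  · rw [← h0] at e; linarith
  · exact hne g ⟨h0, hg.2.trans_lt hG.2⟩ e

/-- The position at a fixed parameter value depends continuously on the expansion parameter, down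
to the Minkowskian limit. -/
theorem IsQuasiMinkowskian.exists_continuousOn (h : IsQuasiMinkowskian P M c Gmax xA xB x0B Γ)
    {t G : ℝ} (ht : t ∈ Icc (0 : ℝ) 1) (hG : G ∈ Ioo 0 Gmax) :
    ∃ ξ : ℝ → E3, ContinuousOn ξ (Icc 0 G) ∧ ξ 0 = xB - t • (xB - xA) ∧
      ∀ g ∈ Ioc 0 G, ξ g = (Γ g t).2 := by
  obtain ⟨X0, X, hX0, hX, hΓ⟩ := h
  have hmid : (G + Gmax) / 2 ∈ Ioo 0 Gmax := ⟨by linarith [hG.1, hG.2], by linarith [hG.2]⟩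
  refine ⟨fun g => (∑' n : ℕ, g ^ (n + 1) • X (n + 1) t) + (xB - t • (xB - xA)),
    (continuousOn_tsum_pow_smul hG.1 (show G < (G + Gmax) / 2 by linarith [hG.2])
      ((hΓ _ hmid).2 t ht).2.2.summable).add continuousOn_const, ?_, fun g hg => ?_⟩
  · simp
  · have := ((hΓ g ⟨hg.1, hg.2.trans_lt hG.2⟩).2 t ht).2.2.tsum_eq
    simp only [this, sub_add_cancel]

/-- A continuity argument: if the mid-point of a ray is never at a distance between `η / 2` and `η`
from the mid-point of the segment, then it is close to it. -/
theorem IsQuasiMinkowskian.norm_midpoint_sub_le {s η : ℝ} {yA yB : E3}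
    (hΓ : IsQuasiMinkowskian P M c Gmax (s • yA) (s • yB) x0B Γ) (hs : 0 < s) (hη0 : 0 < η)
    {G : ℝ} (hG : G ∈ Ioo 0 Gmax)
    (himp : ∀ g ∈ Ioc 0 G, ‖s⁻¹ • (Γ g (1 / 2)).2 - (1 / 2 : ℝ) • (yA + yB)‖ ≤ η →
      ‖s⁻¹ • (Γ g (1 / 2)).2 - (1 / 2 : ℝ) • (yA + yB)‖ ≤ η / 2) :
    ‖s⁻¹ • (Γ G (1 / 2)).2 - (1 / 2 : ℝ) • (yA + yB)‖ ≤ η := by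
  have hGG : G ∈ Ioc 0 G := ⟨hG.1, le_rfl⟩
  have hhalf : (1 / 2 : ℝ) ∈ Icc (0 : ℝ) 1 := ⟨by norm_num, by norm_num⟩
  by_contra hcon
  push Not at hcon
  obtain ⟨ξ, hξ, hξ0, hξg⟩ := hΓ.exists_continuousOn hhalf hG
  obtain ⟨f, hfdef⟩ : ∃ f : ℝ → ℝ, ∀ g, f g = ‖s⁻¹ • ξ g - (1 / 2 : ℝ) • (yA + yB)‖ :=
    ⟨_, fun _ => rfl⟩
  have hcont : ContinuousOn f (Icc 0 G) := by
    have : f = fun g => ‖s⁻¹ • ξ g - (1 / 2 : ℝ) • (yA + yB)‖ := funext hfdef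
    rw [this]
    fun_prop
  have h0 : f 0 = 0 := by
    rw [hfdef, hξ0, norm_eq_zero]
    rw [← smul_sub, smul_comm (1 / 2 : ℝ) s, ← smul_sub, smul_smul, inv_mul_cancel₀ hs.ne',
      one_smul]
    module
  have h1 : η ≤ f G := by rw [hfdef, hξg G hGG]; exact hcon.le
  obtain ⟨g, hg, e⟩ := intermediate_value_Icc hG.1.le hcont ⟨h0.trans_le hη0.le, h1⟩
  have hgp : 0 < g := by
    rcases hg.1.eq_or_lt with h1 | h1
    · rw [← h1, h0] at e; linarith
    · exact h1
  rw [hfdef, hξg g ⟨hgp, hg.2⟩] at e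
  have := himp g ⟨hgp, hg.2⟩ e.le
  linarith

end QuasiMinkowskian

end

end LightRay

/-! ### Conclusion: scaling, continuation in `G`, and the uniform bound -/

open LightRay in
theorem proposition3 (P : LightRay.Model) (yA yB : LightRay.E3)
    (hy : LightRay.cross yA yB ≠ 0) :
    ∃ C δ : ℝ, 0 < δ ∧
      ∀ (s M c Gmax x0B : ℝ) (xA xB : LightRay.E3) (Γ : ℝ → ℝ → LightRay.Event),
        0 < s → 0 < M → 0 < c → xA = s • yA → xB = s • yB →
        LightRay.IsQuasiMinkowskian P M c Gmax xA xB x0B Γ →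
        ∀ G ∈ Set.Ioo 0 Gmax, ∀ m : ℝ, m = LightRay.massLength G M c →
          (∀ l ∈ Set.Icc (0 : ℝ) 1, P.horizonRadius m < ‖xB - l • (xB - xA)‖) →
          m / LightRay.rc xA xB < δ →
          ‖LightRay.directionTriple (P.metric m) (Γ G) 1
              - LightRay.emissionExpansion P m xA xB‖
            ≤ C * (m / LightRay.rc xA xB) ^ 3 ∧
          ‖LightRay.directionTriple (P.metric m) (Γ G) 0
              - LightRay.receptionExpansion P m xA xB‖
            ≤ C * (m / LightRay.rc xA xB) ^ 3 := by
  obtain ⟨O, hα, hκ, hD, hn2, hf, hu0⟩ := P.exists_medium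
  have hA0 := left_ne_zero_of_cross hy
  have hB0 := right_ne_zero_of_cross hy
  have hA := norm_pos_iff.mpr hA0
  have hB := norm_pos_iff.mpr hB0
  have hc := norm_pos_iff.mpr hy
  have hrc := rc_pos hy
  -- The last two entries keep the mid-point at distance `2η` from the lines joining the origin to
  -- the end points. The first ensures that a ray within `η/2` of the segment stays at distance at
  -- least `η/2` from the centre.
  obtain ⟨η, hη⟩ : ∃ η, η = min (rc yA yB) (min (‖cross yA yB‖ / (2 * ‖yA‖) / 2)
    (‖cross yA yB‖ / (2 * ‖yB‖) / 2)) := ⟨_, rfl⟩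
  have hη0 : 0 < η := by rw [hη]; positivity
  have hηA : ∀ θ : ℝ, 2 * η ≤ ‖(1 / 2 : ℝ) • (yA + yB) - θ • yA‖ := fun θ => by
    refine le_trans ?_ (norm_cross_div_le_norm_midpoint_sub hA0 yB θ)
    have : η ≤ ‖cross yA yB‖ / (2 * ‖yA‖) / 2 :=
      hη.trans_le ((min_le_right _ _).trans (min_le_left _ _))
    linarith
  have hηB : ∀ θ : ℝ, 2 * η ≤ ‖(1 / 2 : ℝ) • (yA + yB) - θ • yB‖ := fun θ => by
    have h1 := norm_cross_div_le_norm_midpoint_sub hB0 yA θ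
    rw [cross_swap, norm_neg, add_comm yB] at h1
    refine le_trans ?_ h1
    have : η ≤ ‖cross yA yB‖ / (2 * ‖yB‖) / 2 :=
      hη.trans_le ((min_le_right _ _).trans (min_le_right _ _))
    linarith
  obtain ⟨m₀, hm₀, near⟩ := IsRay.exists_near_segment O yA yB hη0 hηA hηB
  obtain ⟨C, δ, hδ, bound⟩ := closeRay_expansion P O hα hκ hy (half_pos hη0)
  -- The bounds for the representative pair are in terms of `m / s`, which equals `rc yA yB` times
  -- the scale-invariant ratio; hence the powers of `rc yA yB`.
  refine ⟨C * rc yA yB ^ 3, min m₀ δ / rc yA yB, by positivity, ?_⟩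
  intro s M c Gmax x0B xA xB Γ hs hM hcp exA exB hΓ G hG m hm _ hsmall
  rw [exA, exB] at hΓ hsmall ⊢
  rw [rc_smul hs, ← div_div, div_lt_div_iff_of_pos_right hrc] at hsmall
  rw [rc_smul hs, ← div_div, emissionExpansion_smul P m hs, receptionExpansion_smul P m hs]
  have hlen : ∀ g : ℝ, 0 < g → 0 < massLength g M c := fun g hg => by
    unfold massLength; positivity
  -- The whole family down to `g = 0` is needed for the continuation argument. The mass length
  -- increases with `g`, so smallness at `G` implies it for all these `g`.
  have ray : ∀ g ∈ Set.Ioc 0 G, ∃ E, IsRay O (massLength g M c / s) E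
      (fun t => s⁻¹ • (Γ g t).2) (directionTriple (P.metric (massLength g M c)) (Γ g)) ∧
      s⁻¹ • (Γ g 0).2 = yB ∧ s⁻¹ • (Γ g 1).2 = yA ∧ massLength g M c / s < m₀ := by
    intro g hg
    have hg' : g ∈ Set.Ioo 0 Gmax := ⟨hg.1, hg.2.trans_lt hG.2⟩
    have hpast := hΓ.past hM hcp (by
      rw [← smul_sub]; exact smul_ne_zero hs.ne' (sub_ne_zero_of_cross hy)) hg'
    obtain ⟨e0, e1⟩ := hΓ.endpoints hg'
    have hle : massLength g M c / s ≤ m / s := by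
      rw [hm]
      unfold massLength
      gcongr
      exact hg.2
    obtain ⟨hgeo, hout⟩ := hΓ.isNullGeodesic hg'
    refine ⟨_, (hgeo.isRay (hlen g hg.1) hD hn2 hf hu0 hout hpast).scale hs, ?_, ?_,
      hle.trans_lt (hsmall.trans_le (min_le_left _ _))⟩
    · rw [e0, smul_smul, inv_mul_cancel₀ hs.ne', one_smul]
    · rw [e1, smul_smul, inv_mul_cancel₀ hs.ne', one_smul]
  have hhalf : (1 / 2 : ℝ) ∈ Set.Icc (0 : ℝ) 1 := ⟨by norm_num, by norm_num⟩
  have improve : ∀ g ∈ Set.Ioc 0 G,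
      ‖s⁻¹ • (Γ g (1 / 2)).2 - (1 / 2 : ℝ) • (yA + yB)‖ ≤ η →
      ‖s⁻¹ • (Γ g (1 / 2)).2 - (1 / 2 : ℝ) • (yA + yB)‖ ≤ η / 2 := by
    intro g hg h
    obtain ⟨E, hE, e0, e1, hlt⟩ := ray g hg
    have := ((near _ _ _ _ hE e0 e1 hlt h).2 (1 / 2) hhalf).2
    rwa [show yB + (1 / 2 : ℝ) • (yA - yB) = (1 / 2 : ℝ) • (yA + yB) by module] at this
  have hGG : G ∈ Set.Ioc 0 G := ⟨hG.1, le_rfl⟩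
  have hmidG := hΓ.norm_midpoint_sub_le hs hη0 hG improve
  obtain ⟨E, hE, e0, e1, hlt⟩ := ray G hGG
  rw [← hm] at hE hlt
  obtain ⟨n1, n2⟩ := near _ _ _ _ hE e0 e1 hlt hmidG
  have := bound ⟨m / s, E, _, _, hE, e0, e1, n1, fun t ht => by
    have h1 := (n2 t ht).2
    have h2 := (adaptedFrame hy).h_le_norm_segment t
    rw [adaptedFrame_h] at h2
    have h3 := norm_sub_norm_le (yB + t • (yA - yB)) (s⁻¹ • (Γ G t).2)
    rw [norm_sub_rev] at h3
    have h4 : η ≤ rc yA yB := hη.trans_le (min_le_left _ _)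
    linarith, fun t ht => (n2 t ht).1⟩ (hsmall.trans_le (min_le_right _ _))
  have e : C * rc yA yB ^ 3 * (m / s / rc yA yB) ^ 3 = C * (m / s) ^ 3 := by
    field_simp
  rw [e]
  exact this
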